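/- Let $S$ be a compact smooth manifold (without boundary) with a Riemannian metric $g_S$, let $M=C(S)=(0,\infty)\times S$ be its cone, with metric $g_0=d\rho^2+\rho^2g_S$, and suppose that $(M,g_0,I_1,I_2,I_3,\omega_1,\omega_2,\omega_3)$ is hyperkähler: each $(g_0,I_i,\omega_i)$ is Kähler, $\omega_i=g_0(I_i\cdot,\cdot)$, and $I_1I_2I_3=-1$. Let $\mathbb R$ act smoothly and isometrically on $S$ so that the extension of the action to $M$ (trivial on the factor $(0,\infty)$) preserves $I_1,I_2,I_3$. Let $T$ be the vector field on $M$ generating this action, and put $x_j=-\tfrac14\,d(\rho^2)(I_jT)$ for $j=1,2,3$ and $\theta=g_0(T,\cdot)$. For $a>0$, the Taub-NUT deformation of the hyperkähler structure (the hyperkähler quotient of $M\times\mathbb H$ by the $\mathbb R$-action generated by $aT+\partial/\partial q_0$, identified with $M$ by means of the slice $q_0=0$) has the complex structures and Kähler forms $$I_i^a=I_i-\frac{a^2}{1+a^2|T|_{g_0}^2}\,\theta\otimes I_iT+a^2\,dx_i\otimes T,\qquad \omega_i^a=\omega_i+a^2\,dx_j\wedge dx_k,$$ for $(i,j,k)$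 a cyclic permutation of $(1,2,3)$. Then there is a unique action $(z,m)\mapsto z\cdot m$ of $\mathbb C$ on $M$ such that $\frac{d}{dt}\big((it)\cdot m\big)=T\big((it)\cdot m\big)$ and $\frac{d}{d\tau}(\tau\cdot m)=-I_1T(\tau\cdot m)$ for all $m\in M$ and $t,\tau\in\mathbb R$, and the map $$\Phi_a:M\to M,\qquad \Phi_a(m)=(a^2x_1(m))\cdot m,$$ is $\mathbb R$-equivariant and is a complex symplectomorphism $(M,I_1^a,\omega_2^a+i\omega_3^a)\to(M,I_1,\omega_2+i\omega_3)$. That is, $(I_1^a,\omega_2^a+i\omega_3^a)$ and $(I_1,\omega_2+i\omega_3)$ are complex symplectic structures on $M$ (an integrable complex structure together with a closed non-degenerate complex $2$-form of type $(2,0)$), $\Phi_a$ is a diffeomorphism with $d\Phi_a\circ I_1^a=I_1\circ d\Phi_a$, and $\Phi_a^*(\omega_2+i\omega_3)=\omega_2^a+i\omega_3^a$. -/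

import Mathlib

open Set Bundle Topology
open scoped Manifold ContDiff

noncomputable section

section Tensors

variable {F : Type*} [NormedAddCommGroup F] [NormedSpace ℝ F]
  {H : Type*} [TopologicalSpace H] (I : ModelWithCorners ℝ F H)
  {M : Type*} [TopologicalSpace M] [ChartedSpace H M]
  {G : Type*} [NormedAddCommGroup G] [NormedSpace ℝ G]

/-- The vector field `X` on `M` is `C^∞`. -/
def IsSmoothVectorField [IsManifold I 1 M] (X : ∀ m : M, TangentSpace I m) : Prop :=
  ContMDiff I I.tangent ∞ (fun m : M => (⟨m, X m⟩ : TangentBundle I M))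

/-- The field `J` of endomorphisms of the tangent spaces is a `C^∞` section of `End(TM)`. -/
def IsSmoothEndomorphism [IsManifold I 1 M]
    (J : ∀ m : M, TangentSpace I m →L[ℝ] TangentSpace I m) : Prop :=
  ContMDiff I (I.prod 𝓘(ℝ, F →L[ℝ] F)) ∞
    (fun m : M => TotalSpace.mk' (F →L[ℝ] F)
      (E := fun m : M => TangentSpace I m →L[ℝ] TangentSpace I m) m (J m))

/-- The Nijenhuis bracket `[JX, JY] - J[JX, Y] - J[X, JY] - [X, Y]`. -/
def nijenhuis (J : ∀ m : M, TangentSpace I m →L[ℝ] TangentSpace I m)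
    (X Y : ∀ m : M, TangentSpace I m) (m : M) : TangentSpace I m :=
  VectorField.mlieBracket I (fun p => J p (X p)) (fun p => J p (Y p)) m
    - J m (VectorField.mlieBracket I (fun p => J p (X p)) Y m)
    - J m (VectorField.mlieBracket I X (fun p => J p (Y p)) m)
    - VectorField.mlieBracket I X Y m

/-- `J` is a complex structure on `M`: a smooth integrable almost complex structure. -/
structure IsComplexStructure [IsManifold I 1 M]
    (J : ∀ m : M, TangentSpace I m →L[ℝ] TangentSpace I m) : Prop where
  smooth : IsSmoothEndomorphism I J
  sq : ∀ (m : M) (X : TangentSpace I m), J m (J m X) = -X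
  integrable : ∀ X Y : ∀ m : M, TangentSpace I m,
    IsSmoothVectorField I X → IsSmoothVectorField I Y → ∀ m, nijenhuis I J X Y m = 0

/-- The expression of the bilinear form `β` in the coordinates given by the preferred chart
at `x₀`. -/
def coordForm (β : ∀ m : M, TangentSpace I m →L[ℝ] TangentSpace I m →L[ℝ] G)
    (x₀ : M) (y : F) (u v : F) : G :=
  β ((extChartAt I x₀).symm y)
    (mfderiv 𝓘(ℝ, F) I (extChartAt I x₀).symm y u)
    (mfderiv 𝓘(ℝ, F) I (extChartAt I x₀).symm y v)

/-- `dβ = 0` for a 2-form `β` (on a manifold without boundary): in the coordinates of every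
preferred chart, `∂_u β(v, w) + ∂_v β(w, u) + ∂_w β(u, v) = 0`. -/
def IsClosedTwoForm (β : ∀ m : M, TangentSpace I m →L[ℝ] TangentSpace I m →L[ℝ] G) : Prop :=
  ∀ x₀ : M, ∀ y ∈ (extChartAt I x₀).target, ∀ u v w : F,
    fderiv ℝ (fun z => coordForm I β x₀ z v w) y u
      + fderiv ℝ (fun z => coordForm I β x₀ z w u) y v
      + fderiv ℝ (fun z => coordForm I β x₀ z u v) y w = 0

/-- The form `ω(X, Y) = g(J X, Y)`. -/
def kahlerForm (g : ∀ m : M, TangentSpace I m →L[ℝ] TangentSpace I m →L[ℝ] ℝ)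
    (J : ∀ m : M, TangentSpace I m →L[ℝ] TangentSpace I m) (m : M) :
    TangentSpace I m →L[ℝ] TangentSpace I m →L[ℝ] ℝ :=
  (g m).comp (J m)

/-- `(g, J₀, J₁, J₂)` is a hyperkähler structure (for a given Riemannian metric `g`): each
`(g, Jᵢ)` is Kähler, and `J₀ J₁ J₂ = -1`. -/
structure IsHyperkahler [IsManifold I 1 M]
    (g : ∀ m : M, TangentSpace I m →L[ℝ] TangentSpace I m →L[ℝ] ℝ)
    (J : Fin 3 → ∀ m : M, TangentSpace I m →L[ℝ] TangentSpace I m) : Prop where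
  complex : ∀ i, IsComplexStructure I (J i)
  hermitian : ∀ i (m : M) (X Y : TangentSpace I m), g m (J i m X) (J i m Y) = g m X Y
  closed : ∀ i, IsClosedTwoForm I (kahlerForm I g (J i))
  quaternion : ∀ (m : M) (X : TangentSpace I m), J 0 m (J 1 m (J 2 m X)) = -X

/-- The complex valued form `β + iγ`. -/
def complexForm (β γ : ∀ m : M, TangentSpace I m →L[ℝ] TangentSpace I m →L[ℝ] ℝ) (m : M) :
    TangentSpace I m →L[ℝ] TangentSpace I m →L[ℝ] ℂ :=
  (Complex.ofRealCLM.postcomp (TangentSpace I m)).comp (β m)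
    + Complex.I • (Complex.ofRealCLM.postcomp (TangentSpace I m)).comp (γ m)

/-- `(J, Ω)` is a complex symplectic structure: `J` is a complex structure and `Ω` is a smooth
closed non-degenerate complex 2-form which is of type `(2, 0)` with respect to `J`. -/
structure IsComplexSymplectic [IsManifold I 1 M]
    (J : ∀ m : M, TangentSpace I m →L[ℝ] TangentSpace I m)
    (Ω : ∀ m : M, TangentSpace I m →L[ℝ] TangentSpace I m →L[ℝ] ℂ) : Prop where
  complex : IsComplexStructure I J
  alternating : ∀ (m : M) (X : TangentSpace I m), Ω m X X = 0
  smooth : ∀ X Y : ∀ m : M, TangentSpace I m,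
    IsSmoothVectorField I X → IsSmoothVectorField I Y →
      ContMDiff I 𝓘(ℝ, ℂ) ∞ (fun m => Ω m (X m) (Y m))
  closed : IsClosedTwoForm I Ω
  type_two_zero : ∀ (m : M) (X Y : TangentSpace I m), Ω m (J m X) Y = Complex.I * Ω m X Y
  nondegenerate : ∀ (m : M) (X : TangentSpace I m),
    (∀ Y : TangentSpace I m, Ω m X Y = 0) → X = 0

/-- `Φ : (M, J) → (M, J')` is a biholomorphism. -/
def IsBiholomorphism (J J' : ∀ m : M, TangentSpace I m →L[ℝ] TangentSpace I m)
    (Φ : M → M) : Prop :=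
  (∃ Ψ : M ≃ₘ^∞⟮I, I⟯ M, ⇑Ψ = Φ) ∧
    ∀ (m : M) (X : TangentSpace I m), mfderiv I I Φ m (J m X) = J' (Φ m) (mfderiv I I Φ m X)

/-- `Φ : (M, J, Ω) → (M, J', Ω')` is a complex symplectomorphism. -/
structure IsComplexSymplectomorphism [IsManifold I 1 M]
    (J : ∀ m : M, TangentSpace I m →L[ℝ] TangentSpace I m)
    (Ω : ∀ m : M, TangentSpace I m →L[ℝ] TangentSpace I m →L[ℝ] ℂ)
    (J' : ∀ m : M, TangentSpace I m →L[ℝ] TangentSpace I m)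
    (Ω' : ∀ m : M, TangentSpace I m →L[ℝ] TangentSpace I m →L[ℝ] ℂ)
    (Φ : M → M) : Prop where
  source : IsComplexSymplectic I J Ω
  target : IsComplexSymplectic I J' Ω'
  biholomorphism : IsBiholomorphism I J J' Φ
  pullback : ∀ (m : M) (X Y : TangentSpace I m),
    Ω' (Φ m) (mfderiv I I Φ m X) (mfderiv I I Φ m Y) = Ω m X Y

/-- `φ` is the `ℂ`-action obtained by complexifying, with respect to `J`, the flow of `T`:
the generator of `t ↦ φ(it)` is `T` and the generator of `τ ↦ φ(τ)` is `-J T`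
(`t, τ` real). -/
structure IsComplexifiedAction (J : ∀ m : M, TangentSpace I m →L[ℝ] TangentSpace I m)
    (T : ∀ m : M, TangentSpace I m) (φ : ℂ → M → M) : Prop where
  zero : ∀ m, φ 0 m = m
  add : ∀ z w m, φ (z + w) m = φ z (φ w m)
  imaginary : ∀ m, IsMIntegralCurve (I := I) (fun t : ℝ => φ (t * Complex.I) m) T
  real : ∀ m, IsMIntegralCurve (I := I) (fun τ : ℝ => φ (τ : ℂ) m) (fun p => -J p (T p))

/-- The differential of a real valued function, as a linear form on each tangent space. -/
def differential (f : M → ℝ) (m : M) : TangentSpace I m →L[ℝ] ℝ :=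
  mfderiv I 𝓘(ℝ, ℝ) f m

/-! ### The Taub-NUT deformation

The deformation of `(g, J₀, J₁, J₂)` along a vector field `T` with moment maps `x₀, x₁, x₂`. -/

/-- The complex structure
`Iᵢ^a = Iᵢ - a²V/(a² + V) θ ⊗ IᵢT + a² dxᵢ ⊗ T`, where `θ = g(T, ·)` and `V = 1/|T|²`. Here
`a²V/(a² + V)` is written as `a²/(1 + a²|T|²)`, which also makes sense at the zeros of `T`. -/
def deformedJ (g : ∀ m : M, TangentSpace I m →L[ℝ] TangentSpace I m →L[ℝ] ℝ)
    (J : Fin 3 → ∀ m : M, TangentSpace I m →L[ℝ] TangentSpace I m)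
    (T : ∀ m : M, TangentSpace I m) (x : Fin 3 → M → ℝ) (a : ℝ) (i : Fin 3) (m : M) :
    TangentSpace I m →L[ℝ] TangentSpace I m :=
  J i m - (a ^ 2 / (1 + a ^ 2 * g m (T m) (T m))) • (g m (T m)).smulRight (J i m (T m))
    + a ^ 2 • (differential I (x i) m).smulRight (T m)

/-- The form `ωᵢ^a = ωᵢ + a² dxⱼ ∧ dxₖ`, `(i, j, k)` cyclic. -/
def deformedForm (g : ∀ m : M, TangentSpace I m →L[ℝ] TangentSpace I m →L[ℝ] ℝ)
    (J : Fin 3 → ∀ m : M, TangentSpace I m →L[ℝ] TangentSpace I m)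
    (x : Fin 3 → M → ℝ) (a : ℝ) (i : Fin 3) (m : M) :
    TangentSpace I m →L[ℝ] TangentSpace I m →L[ℝ] ℝ :=
  kahlerForm I g (J i) m
    + a ^ 2 •
      ((differential I (x (i + 1)) m).smulRight (differential I (x (i + 2)) m)
        - (differential I (x (i + 2)) m).smulRight (differential I (x (i + 1)) m))

end Tensors

section HyperkahlerQuotient

/-! These two facts identify the formulas above with the hyperkähler quotient of `M × ℍ` by the
`ℝ`-action generated by `Z = aT + ∂/∂q₀`. The level sets of its moment map are the sets
`q_j = a x_j - λ_j`, and the slice `q₀ = 0` identifies the quotient with `M`. -/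

variable {F : Type*} [NormedAddCommGroup F] [NormedSpace ℝ F]
  {H : Type*} [TopologicalSpace H] (I : ModelWithCorners ℝ F H)
  {M : Type*} [TopologicalSpace M] [ChartedSpace H M]

/-- The imaginary units `i, j, k`. -/
def quaternionUnit : Fin 3 → Quaternion ℝ := ![⟨0, 1, 0, 0⟩, ⟨0, 0, 1, 0⟩, ⟨0, 0, 0, 1⟩]

/-- The `ℍ`-component of the derivative of the slice
`m ↦ (m, 0, a x₀ - λ₀, a x₁ - λ₁, a x₂ - λ₂)`; its `M`-component is the identity. -/
def sliceDeriv (x : Fin 3 → M → ℝ) (a : ℝ) (m : M) (X : TangentSpace I m) : Quaternion ℝ :=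
  ⟨0, a * differential I (x 0) m X, a * differential I (x 1) m X,
    a * differential I (x 2) m X⟩

/-- The pull-back to the slice of the Kähler form `ωᵢ + κᵢ` of `M × ℍ` is `ωᵢ^a`. -/
theorem deformedForm_eq_slice
    (g : ∀ m : M, TangentSpace I m →L[ℝ] TangentSpace I m →L[ℝ] ℝ)
    (J : Fin 3 → ∀ m : M, TangentSpace I m →L[ℝ] TangentSpace I m)
    (x : Fin 3 → M → ℝ) (a : ℝ) (i : Fin 3) (m : M) (X Y : TangentSpace I m) :
    deformedForm I g J x a i m X Y = g m (J i m X) Y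
      + inner ℝ (quaternionUnit i * sliceDeriv I x a m X) (sliceDeriv I x a m Y) := by
  have hre : ∀ p q : Quaternion ℝ, (inner ℝ p q : ℝ)
      = p.re * q.re + p.imI * q.imI + p.imJ * q.imJ + p.imK * q.imK := by
    intro p q
    rw [Quaternion.inner_def, Quaternion.re_mul, Quaternion.re_star, Quaternion.imI_star,
      Quaternion.imJ_star, Quaternion.imK_star]
    ring
  rw [hre, Quaternion.re_mul, Quaternion.imI_mul, Quaternion.imJ_mul, Quaternion.imK_mul]
  fin_cases i <;> simp [deformedForm, kahlerForm, quaternionUnit, sliceDeriv] <;> ring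

/-- Let `h` be the component orthogonal to `Z` of the vector `(X, dσ X)` tangent to the slice.
Applying `Iᵢ` to `h` and moving back to the slice along `Z` gives `Iᵢ^a X`. -/
theorem deformedJ_eq_slice
    (g : ∀ m : M, TangentSpace I m →L[ℝ] TangentSpace I m →L[ℝ] ℝ)
    (J : Fin 3 → ∀ m : M, TangentSpace I m →L[ℝ] TangentSpace I m)
    (T : ∀ m : M, TangentSpace I m) (x : Fin 3 → M → ℝ) (a : ℝ) (i : Fin 3) (m : M)
    (X : TangentSpace I m) (c : ℝ) (h₁ : TangentSpace I m) (h₂ : Quaternion ℝ)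
    (hc : c = (g m (a • T m) X + inner ℝ (1 : Quaternion ℝ) (sliceDeriv I x a m X))
      / (g m (a • T m) (a • T m) + inner ℝ (1 : Quaternion ℝ) (1 : Quaternion ℝ)))
    (hh₁ : h₁ = X - c • a • T m) (hh₂ : h₂ = sliceDeriv I x a m X - c • 1) :
    deformedJ I g J T x a i m X = J i m h₁ - (quaternionUnit i * h₂).re • a • T m := by
  have hs : inner ℝ (1 : Quaternion ℝ) (sliceDeriv I x a m X) = 0 := by
    rw [Quaternion.inner_def, one_mul, Quaternion.re_star]
    rfl
  have h1 : inner ℝ (1 : Quaternion ℝ) (1 : Quaternion ℝ) = 1 := by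
    rw [Quaternion.inner_def, one_mul, Quaternion.re_star]
    rfl
  have hre : (quaternionUnit i * h₂).re = -(a * differential I (x i) m X) := by
    rw [hh₂, mul_sub, Quaternion.re_sub, mul_smul_comm, mul_one, Quaternion.re_smul,
      Quaternion.re_mul]
    fin_cases i <;> simp [quaternionUnit, sliceDeriv]
  have hc' : c = a * g m (T m) X / (1 + a ^ 2 * g m (T m) (T m)) := by
    rw [hc, hs, h1]
    simp only [map_smul, smul_apply, smul_eq_mul, add_zero]
    congr 1
    ring
  rw [hre, hh₁, hc']
  simp only [deformedJ, map_smul, map_sub, add_apply, sub_apply, smul_apply,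
    ContinuousLinearMap.smulRight_apply, smul_smul]
  rw [neg_mul, neg_smul, sub_neg_eq_add]
  congr 1
  · congr 2
    ring
  · congr 1
    ring

end HyperkahlerQuotient

section ConeDefs

variable {E : Type*} [NormedAddCommGroup E] [NormedSpace ℝ E]
  {S : Type*} [TopologicalSpace S] [ChartedSpace E S]

/-- The open half line `(0, ∞)`, as an open submanifold of `ℝ`. -/
def PosReal : TopologicalSpace.Opens ℝ := ⟨Set.Ioi 0, isOpen_Ioi⟩

/-- The cone `C(S) = (0, ∞) × S`. -/
abbrev Cone (S : Type*) : Type _ := PosReal × S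

/-- The model of the manifold `C(S)`. -/
abbrev coneModel (E : Type*) [NormedAddCommGroup E] [NormedSpace ℝ E] :
    ModelWithCorners ℝ (ℝ × E) (ModelProd ℝ E) :=
  𝓘(ℝ, ℝ).prod 𝓘(ℝ, E)

/-- The radial coordinate. -/
def coneRadius (m : Cone S) : ℝ := (m.1 : ℝ)

/-- The cone metric `dρ² + ρ² g_S`. -/
def coneMetric [IsManifold 𝓘(ℝ, E) ∞ S]
    (gS : ContMDiffRiemannianMetric 𝓘(ℝ, E) ∞ E (fun s : S => TangentSpace 𝓘(ℝ, E) s))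
    (m : Cone S) :
    TangentSpace (coneModel E) m →L[ℝ] TangentSpace (coneModel E) m →L[ℝ] ℝ :=
  let dρ : TangentSpace (coneModel E) m →L[ℝ] ℝ := differential (coneModel E) coneRadius m
  let dπ : TangentSpace (coneModel E) m →L[ℝ] TangentSpace 𝓘(ℝ, E) m.2 :=
    mfderiv (coneModel E) 𝓘(ℝ, E) (fun p : Cone S => p.2) m
  dρ.smulRight dρ + coneRadius m ^ 2 • (dπ.precomp ℝ).comp ((gS.inner m.2).comp dπ)

/-- The extension to the cone of an `ℝ`-action on the link. -/
def coneAct (α : ℝ → S → S) (t : ℝ) (m : Cone S) : Cone S := (m.1, α t m.2)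

/-- `α` is a smooth `ℝ`-action on `S` by isometries whose extension to the cone preserves the
complex structures `J₀, J₁, J₂`. -/
structure IsHyperkahlerAction [IsManifold 𝓘(ℝ, E) ∞ S]
    (gS : ContMDiffRiemannianMetric 𝓘(ℝ, E) ∞ E (fun s : S => TangentSpace 𝓘(ℝ, E) s))
    (J : Fin 3 → ∀ m : Cone S,
      TangentSpace (coneModel E) m →L[ℝ] TangentSpace (coneModel E) m)
    (α : ℝ → S → S) : Prop where
  zero : ∀ s, α 0 s = s
  add : ∀ t t' s, α (t + t') s = α t (α t' s)
  smooth : ContMDiff (𝓘(ℝ, ℝ).prod 𝓘(ℝ, E)) 𝓘(ℝ, E) ∞ (fun p : ℝ × S => α p.1 p.2)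
  isometry : ∀ (t : ℝ) (s : S) (X Y : TangentSpace 𝓘(ℝ, E) s),
    gS.inner (α t s) (mfderiv 𝓘(ℝ, E) 𝓘(ℝ, E) (α t) s X) (mfderiv 𝓘(ℝ, E) 𝓘(ℝ, E) (α t) s Y)
      = gS.inner s X Y
  triholomorphic : ∀ (i : Fin 3) (t : ℝ) (m : Cone S) (X : TangentSpace (coneModel E) m),
    mfderiv (coneModel E) (coneModel E) (coneAct α t) m (J i m X)
      = J i (coneAct α t m) (mfderiv (coneModel E) (coneModel E) (coneAct α t) m X)

/-- The generator `T` of the `ℝ`-action on the cone, `T(m) = d/dt|₀ (α_t m)`. -/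
def generator (E : Type*) [NormedAddCommGroup E] [NormedSpace ℝ E] [ChartedSpace E S]
    (α : ℝ → S → S) (m : Cone S) : TangentSpace (coneModel E) m :=
  show ℝ × E from mfderiv 𝓘(ℝ, ℝ) (coneModel E) (fun t : ℝ => coneAct α t m) 0 (1 : ℝ)

/-- The moment map `xⱼ = -(1/4) d(ρ²)(Iⱼ T)`. -/
def coneMoment
    (J : Fin 3 → ∀ m : Cone S,
      TangentSpace (coneModel E) m →L[ℝ] TangentSpace (coneModel E) m)
    (α : ℝ → S → S) (j : Fin 3) (m : Cone S) : ℝ :=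
  -(1 / 4) * differential (coneModel E) (fun p : Cone S => coneRadius p ^ 2) m
    (J j m (generator E α m))

end ConeDefs

end

/-!
Indices run over `0, 1, 2`. Let `v = -J₀ T`, the generator of the real part of the complexified
action, and let `R = ρ ∂/∂ρ` be the Euler field of the cone.

*Moment maps.* `R` generates the dilations, so `L_R g = 2 g`, and `g(R, ·) = d(ρ²)/2` is closed. On
a Kähler manifold these two properties force `L_R J = 0`: the form `L_R ω = d(ι_R ω)` has type
`(1, 1)` by integrability of `J`, whereas `L_R ω - 2 ω = g((L_R J) ·, ·)` has type `(2, 0) + (0, 2)`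
(`lie_complexStructure_eq_zero`, `lieForm_kahlerForm_of_homothety`). Hence `L_R ωⱼ = 2 ωⱼ`, and
the dilations are holomorphic. As the action preserves `ωⱼ` and commutes with the dilations,
`xⱼ = -ωⱼ(T, R) / 2` satisfies `dxⱼ = -ωⱼ(T, ·)` (`differential_contraction_of_homothety`,
`isTriHamiltonian_cone`).

*The complexified action.* The field `v` is invariant under dilations, so its integral curves exist
for a uniform time, by compactness of the link, and `v` is complete
(`exists_flow_of_dilation_invariant`). The action preserves `v`, so the flow `φ` of `v` commutes
with it. Uniqueness is that of integral curves. That `φ` is smooth rests on the smooth dependence of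
solutions of differential equations on the initial point, which is obtained from the implicit
function theorem on the Banach space of paths (`exists_local_flow_contDiffAt_of_contDiff`,
`contMDiff_flow`).

*The deformation.* From `ω₁(v, ·) = -dx₂` and `ω₂(v, ·) = dx₁` it follows that `φ` preserves `ω₁`
and `ω₂` (`pullbackForm_eq_of_lieForm_eq`), hence also `J₀`, which is determined by `ω₁ + i ω₂`. The
differential of `Φ(m) = φ (a² x₀(m)) m` is the shear `X ↦ X + a² dx₀(X) v`, followed by the
differential of the flow at the fixed time `a² x₀(m)`. It is therefore a pointwise computation that
`Φ` pulls `ω₁ + i ω₂` and `J₀` back to the deformed structures (`IsTriHamiltonian.shear_deformedJ`).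
Since `dx₀(v) = |v|² ≥ 0`, the function `τ ↦ τ + a² x₀(φ_τ p)` is bijective on each orbit, which
makes `Φ` bijective, and the shear is injective, which makes the inverse smooth
(`contMDiff_of_mfderiv_injective`). Integrability of the deformed complex structure is transported
by `Φ` (`nijenhuis_eq_zero_of_intertwines`, `isComplexSymplectomorphism_deformationMap`).
-/

noncomputable section

/-! ### Smooth dependence of local flows on time and initial point -/

section Nemytskii

set_option synthInstance.maxHeartbeats 200000

universe u
variable {K : Type*} [TopologicalSpace K] [CompactSpace K]
  {F : Type u} [NormedAddCommGroup F] [NormedSpace ℝ F]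

/-- Pointwise application of a continuous family of linear maps to a continuous function. -/
def pointwiseApplyCLM (K : Type*) [TopologicalSpace K] [CompactSpace K]
    (F : Type*) [NormedAddCommGroup F] [NormedSpace ℝ F]
    (G : Type*) [NormedAddCommGroup G] [NormedSpace ℝ G] :
    C(K, F →L[ℝ] G) →L[ℝ] C(K, F) →L[ℝ] C(K, G) :=
  LinearMap.mkContinuous₂
    (LinearMap.mk₂ ℝ
      (fun (A : C(K, F →L[ℝ] G)) (η : C(K, F)) =>
        (⟨fun u => A u (η u), by fun_prop⟩ : C(K, G)))
      (fun A B η => by ext; simp) (fun c A η => by ext; simp)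
      (fun A η ζ => by ext; simp) (fun c A η => by ext; simp)) 1
    (fun A η => by
      rw [one_mul, ContinuousMap.norm_le _ (by positivity)]
      intro u
      exact ((A u).le_opNorm (η u)).trans (by gcongr <;> apply ContinuousMap.norm_coe_le_norm))

lemma hasFDerivAt_continuousMap_comp [ProperSpace F]
    {G : Type*} [NormedAddCommGroup G] [NormedSpace ℝ G]
    {v : F → G} {v' : F → F →L[ℝ] G} (hv : Continuous v) (hv' : Continuous v')
    (h : ∀ x, HasFDerivAt v (v' x) x) (γ : C(K, F)) :
    HasFDerivAt (fun γ : C(K, F) => (ContinuousMap.mk v hv).comp γ)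
      (pointwiseApplyCLM K F G ((ContinuousMap.mk v' hv').comp γ)) γ := by
  rw [hasFDerivAt_iff_isLittleO_nhds_zero, Asymptotics.isLittleO_iff]
  intro c hc
  have hu := (isCompact_closedBall (0 : F) (‖γ‖ + 1)).uniformContinuousOn_of_continuous
    hv'.continuousOn
  obtain ⟨δ, hδ, hδ'⟩ := Metric.uniformContinuousOn_iff.1 hu c hc
  filter_upwards [Metric.ball_mem_nhds (0 : C(K, F)) (lt_min hδ one_pos)] with η hη
  rw [mem_ball_zero_iff, lt_min_iff] at hη
  rw [ContinuousMap.norm_le _ (by positivity)]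
  intro u
  have hηu := η.norm_coe_le_norm u
  have hγu := γ.norm_coe_le_norm u
  have key : ‖v (γ u + η u) - v (γ u) - v' (γ u) (γ u + η u - γ u)‖ ≤ c * ‖γ u + η u - γ u‖ := by
    refine (convex_ball (γ u) (min δ 1)).norm_image_sub_le_of_norm_hasFDerivWithin_le'
      (fun x _ => (h x).hasFDerivWithinAt) (fun x hx => ?_) (Metric.mem_ball_self (lt_min hδ one_pos)) ?_
    · rw [Metric.mem_ball, lt_min_iff] at hx
      rw [← dist_eq_norm]
      refine (hδ' x ?_ (γ u) ?_ hx.1).le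
      · rw [mem_closedBall_zero_iff]
        have := norm_le_norm_add_norm_sub' x (γ u)
        rw [dist_eq_norm] at hx
        linarith [hx.2]
      · rw [mem_closedBall_zero_iff]
        linarith
    · rw [Metric.mem_ball, lt_min_iff, dist_eq_norm, add_sub_cancel_left]
      exact ⟨hηu.trans_lt hη.1, hηu.trans_lt hη.2⟩
  rw [add_sub_cancel_left] at key
  refine le_trans (le_of_eq ?_) (key.trans (by gcongr))
  simp [pointwiseApplyCLM]

/-- The operator `γ ↦ v ∘ γ` on continuous functions on a compact space is as smooth as `v`. -/
lemma contDiff_continuousMap_comp [ProperSpace F] (n : ℕ) :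
    ∀ {G : Type u} [NormedAddCommGroup G] [NormedSpace ℝ G] {v : F → G} (hv : ContDiff ℝ n v),
    ContDiff ℝ n (fun γ : C(K, F) => (ContinuousMap.mk v hv.continuous).comp γ) := by
  induction n with
  | zero =>
    intro G _ _ v hv
    exact contDiff_zero.2 (ContinuousMap.continuous_postcomp _)
  | succ n ih =>
    intro G _ _ v hv
    have hv1 : ContDiff ℝ n (fderiv ℝ v) := hv.fderiv_right (by simp)
    have hd : Differentiable ℝ v := hv.differentiable (by simp)
    push_cast
    rw [contDiff_succ_iff_hasFDerivAt]
    exact ⟨fun γ => pointwiseApplyCLM K F G ((ContinuousMap.mk _ hv1.continuous).comp γ),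
      (ih hv1).continuousLinearMap_comp (pointwiseApplyCLM K F G), fun γ =>
      hasFDerivAt_continuousMap_comp hv.continuous hv1.continuous
        (fun x => (hd x).hasFDerivAt) γ⟩

end Nemytskii

section LocalFlow

variable {F : Type*} [NormedAddCommGroup F] [NormedSpace ℝ F]

/-- The primitive vanishing at `0` of a continuous function on `[0, 1]`. -/
def primitiveCLM (F : Type*) [NormedAddCommGroup F] [NormedSpace ℝ F] :
    C(unitInterval, F) →L[ℝ] C(unitInterval, F) :=
  LinearMap.mkContinuous
    { toFun := fun γ => ⟨fun u => ∫ t in (0 : ℝ)..u, IccExtend zero_le_one γ t,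
        (intervalIntegral.continuous_primitive
          (fun a b => (γ.continuous.Icc_extend' (h := zero_le_one)).intervalIntegrable a b) 0).comp
          continuous_subtype_val⟩
      map_add' := fun γ η => by
        ext u
        simp only [ContinuousMap.coe_mk, ContinuousMap.add_apply]
        rw [← intervalIntegral.integral_add]
        · rfl
        · exact (γ.continuous.Icc_extend' (h := zero_le_one)).intervalIntegrable _ _
        · exact (η.continuous.Icc_extend' (h := zero_le_one)).intervalIntegrable _ _
      map_smul' := fun c γ => by
        ext u
        simp only [ContinuousMap.coe_mk, ContinuousMap.smul_apply, RingHom.id_apply]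
        rw [← intervalIntegral.integral_smul]
        rfl } 1
    (fun γ => by
      rw [one_mul, ContinuousMap.norm_le _ (by positivity)]
      intro u
      have := intervalIntegral.norm_integral_le_of_norm_le_const (a := (0 : ℝ)) (b := u)
        (f := IccExtend zero_le_one γ) (C := ‖γ‖) (fun x _ => γ.norm_coe_le_norm _)
      refine this.trans ?_
      rw [sub_zero, abs_of_nonneg u.2.1]
      exact mul_le_of_le_one_right (norm_nonneg _) u.2.2)

/-- The constant functions on `[0, 1]`. -/
def constCLM (F : Type*) [NormedAddCommGroup F] [NormedSpace ℝ F] :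
    F →L[ℝ] C(unitInterval, F) :=
  LinearMap.mkContinuous
    { toFun := fun x => ContinuousMap.const _ x
      map_add' := fun _ _ => rfl
      map_smul' := fun _ _ => rfl } 1
    (fun x => by
      rw [one_mul, ContinuousMap.norm_le _ (by positivity)]
      intro u
      rfl)

/-- The fixed point equation of Picard, for integral curves of `s • v` on `[0, 1]` starting at
`x`. Rescaling time moves the time `s` of the flow into the equation as a parameter, and at `s = 0`
the equation is trivially solvable. -/
def picardDefect {v : F → F} (hv : Continuous v)
    (p : (ℝ × F) × C(unitInterval, F)) : C(unitInterval, F) :=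
  p.2 - constCLM F p.1.2 - p.1.1 • primitiveCLM F ((ContinuousMap.mk v hv).comp p.2)

lemma contDiff_picardDefect [ProperSpace F] {v : F → F} {n : ℕ} (hv : ContDiff ℝ n v) :
    ContDiff ℝ n (picardDefect hv.continuous) := by
  have h1 := (primitiveCLM F).contDiff.comp
    ((contDiff_continuousMap_comp (K := unitInterval) n hv).comp
      (contDiff_snd (E := ℝ × F) (F := C(unitInterval, F))))
  have h2 := (constCLM F).contDiff (n := n).comp
    (contDiff_snd.comp (contDiff_fst (E := ℝ × F) (F := C(unitInterval, F))))
  exact (contDiff_snd.sub h2).sub ((contDiff_fst.comp contDiff_fst).smul h1)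

lemma fderiv_picardDefect_comp_inr [ProperSpace F] {v : F → F} (hv : ContDiff ℝ 1 v) (x : F) :
    (fderiv ℝ (picardDefect hv.continuous) ((0, x), constCLM F x)).comp
      (ContinuousLinearMap.inr ℝ (ℝ × F) C(unitInterval, F)) = ContinuousLinearMap.id ℝ _ := by
  have h1 := ((contDiff_picardDefect (n := 1) hv).differentiable (by simp)
    ((0, x), constCLM F x)).hasFDerivAt
  have h2 := h1.comp (constCLM F x) (hasFDerivAt_prodMk_right (𝕜 := ℝ) (0, x) (constCLM F x))
  refine h2.unique ?_
  have h3 : picardDefect hv.continuous ∘ Prod.mk (0, x) = fun γ => γ - constCLM F x := by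
    ext γ
    simp [picardDefect]
  rw [h3]
  exact (hasFDerivAt_id _).sub_const _

/-- An integral curve of `v`, with time rescaled by `s`, solves the fixed point equation. -/
lemma picardDefect_eq_zero [CompleteSpace F] {v : F → F} (hv : Continuous v) {c : ℝ → F} {ε s : ℝ}
    (hc : ∀ t ∈ Ioo (-ε) ε, HasDerivAt c (v (c t)) t) (hs : s ∈ Ioo (-ε) ε)
    {γ : C(unitInterval, F)} (hγ : ∀ u, γ u = c (s * u)) :
    picardDefect hv ((s, c 0), γ) = 0 := by
  ext u
  have hmem : ∀ t ∈ Icc (0 : ℝ) 1, s * t ∈ Ioo (-ε) ε := by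
    intro t ht
    rw [mem_Ioo, ← abs_lt] at hs ⊢
    rw [abs_mul, abs_of_nonneg ht.1]
    exact (mul_le_of_le_one_right (abs_nonneg _) ht.2).trans_lt hs
  have hsub : uIcc (0 : ℝ) u ⊆ Icc 0 1 := by
    rw [uIcc_of_le u.2.1]
    exact Icc_subset_Icc_right u.2.2
  have hd : ∀ t ∈ uIcc (0 : ℝ) u, HasDerivAt (fun t => c (s * t)) (s • v (c (s * t))) t := by
    intro t ht
    have := (hc _ (hmem t (hsub ht))).scomp t ((hasDerivAt_id t).const_mul s)
    rw [mul_one] at this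
    exact this
  have hcont : ContinuousOn (fun t => s • v (c (s * t))) (uIcc (0 : ℝ) u) :=
    continuousOn_const.smul (hv.comp_continuousOn
      (fun t ht => (hd t ht).continuousAt.continuousWithinAt))
  have hint := intervalIntegral.integral_eq_sub_of_hasDerivAt hd hcont.intervalIntegrable
  have h1 : ∫ t in (0 : ℝ)..u, IccExtend zero_le_one ((ContinuousMap.mk v hv).comp γ) t
      = ∫ t in (0 : ℝ)..u, v (c (s * t)) := by
    refine intervalIntegral.integral_congr (fun t ht => ?_)
    simp only [IccExtend_of_mem _ _ (hsub ht)]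
    simp [hγ]
  have h2 : picardDefect hv ((s, c 0), γ) u = γ u - c 0 -
      s • ∫ t in (0 : ℝ)..u, IccExtend zero_le_one ((ContinuousMap.mk v hv).comp γ) t := rfl
  rw [h2, h1, ← intervalIntegral.integral_smul, hint, hγ]
  simp

/-- The local flow of a smooth vector field on a finite dimensional vector space is jointly smooth
in time and initial point. -/
theorem exists_local_flow_contDiffAt_of_contDiff [FiniteDimensional ℝ F] {v : F → F}
    (hv : ContDiff ℝ ∞ v) (x₀ : F) :
    ∃ f : F → ℝ → F, ∃ ε > 0, (∀ x ∈ Metric.ball x₀ ε, f x 0 = x ∧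
      ∀ t ∈ Ioo (-ε) ε, HasDerivAt (f x) (v (f x t)) t) ∧
      ContDiffAt ℝ ∞ (fun p : ℝ × F => f p.2 p.1) (0, x₀) := by
  have : ProperSpace F := FiniteDimensional.proper ℝ F
  obtain ⟨ε, hε, a, r, L, K, hr, hpl⟩ :=
    IsPicardLindelof.of_contDiffAt_one (hv.contDiffAt.of_le (by simp) : ContDiffAt ℝ 1 v x₀)
  obtain ⟨α, hα, hαc⟩ := (hpl 0).exists_forall_mem_closedBall_eq_hasDerivWithinAt_continuousOn
  simp only [zero_sub, zero_add] at hα hαc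
  have hr' : (0 : ℝ) < r := hr
  have hα' : ∀ x ∈ Metric.closedBall x₀ r, ∀ t ∈ Ioo (-ε) ε,
      HasDerivAt (fun t => α (x, t)) (v (α (x, t))) t := fun x hx t ht =>
    ((hα x hx).2 t (Ioo_subset_Icc_self ht)).hasDerivAt (Icc_mem_nhds ht.1 ht.2)
  refine ⟨fun x t => α (x, t), min ε r, lt_min hε hr', fun x hx => ?_, ?_⟩
  · have hx' : x ∈ Metric.closedBall x₀ r :=
      Metric.ball_subset_closedBall (Metric.ball_subset_ball (min_le_right _ _) hx)
    exact ⟨(hα x hx').1, fun t ht => hα' x hx' t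
      ⟨(neg_le_neg (min_le_left _ _)).trans_lt ht.1, ht.2.trans_le (min_le_left _ _)⟩⟩
  rw [contDiffAt_infty]
  intro n
  suffices h : ContDiffAt ℝ (n + 1 : ℕ) (fun p : ℝ × F => α (p.2, p.1)) (0, x₀) from
    h.of_le (by exact_mod_cast n.le_succ)
  have hvn : ContDiff ℝ (n + 1 : ℕ) v := hv.of_le (by exact_mod_cast le_top)
  set G := picardDefect hvn.continuous with hG
  have hGs : ContDiffAt ℝ (n + 1 : ℕ) G ((0, x₀), constCLM F x₀) :=
    (contDiff_picardDefect hvn).contDiffAt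
  have hn0 : ((n + 1 : ℕ) : WithTop ℕ∞) ≠ 0 := by simp
  have hinv : ((fderiv ℝ G ((0, x₀), constCLM F x₀)).comp
      (ContinuousLinearMap.inr ℝ (ℝ × F) C(unitInterval, F))).IsInvertible := by
    rw [hG, fderiv_picardDefect_comp_inr (hv.of_le (by simp)) x₀]
    exact ContinuousLinearMap.isInvertible_equiv (f := ContinuousLinearEquiv.refl ℝ _)
  have hiff := hGs.eventually_apply_eq_iff_implicitFunction hn0 hinv
  have hsm := hGs.contDiffAt_implicitFunction hn0 hinv
  set ψ := hGs.implicitFunction hn0 hinv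
  have hG0 : G ((0, x₀), constCLM F x₀) = 0 := by
    simp [hG, picardDefect]
  classical
  -- the curve `u ↦ α (x, s u)`, as a continuous function on `[0, 1]`
  let γ : ℝ × F → C(unitInterval, F) := fun p =>
    if h : Continuous (fun u : unitInterval => α (p.2, p.1 * u)) then ⟨_, h⟩ else 0
  have hγ : ∀ p : ℝ × F, p.1 ∈ Ioo (-ε) ε → p.2 ∈ Metric.closedBall x₀ r →
      ∀ u, γ p u = α (p.2, p.1 * u) := by
    intro p hp1 hp2 u
    have : Continuous (fun u : unitInterval => α (p.2, p.1 * u)) := by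
      rw [continuous_iff_continuousAt]
      intro u
      refine ContinuousAt.comp (f := fun u : unitInterval => p.1 * (u : ℝ))
        (g := fun t => α (p.2, t)) (hα' p.2 hp2 _ ?_).continuousAt (by fun_prop)
      rw [mem_Ioo, ← abs_lt] at hp1 ⊢
      rw [abs_mul, abs_of_nonneg u.2.1]
      exact (mul_le_of_le_one_right (abs_nonneg _) u.2.2).trans_lt hp1
    simp [γ, dif_pos this]
  have hnear : ∀ᶠ p : ℝ × F in 𝓝 (0, x₀), p.1 ∈ Ioo (-ε) ε ∧ p.2 ∈ Metric.closedBall x₀ r :=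
    (continuousAt_fst.eventually (Ioo_mem_nhds (neg_lt_zero.2 hε) hε)).and
      (continuousAt_snd.eventually (Metric.closedBall_mem_nhds x₀ hr'))
  have hαat : ContinuousAt α (x₀, 0) :=
    hαc.continuousAt (prod_mem_nhds (Metric.closedBall_mem_nhds x₀ hr')
      (Icc_mem_nhds (neg_lt_zero.2 hε) hε))
  have hα0 : α (x₀, 0) = x₀ := (hα x₀ (Metric.mem_closedBall_self hr'.le)).1
  have htend : Filter.Tendsto γ (𝓝 (0, x₀)) (𝓝 (constCLM F x₀)) := by
    rw [Metric.tendsto_nhds]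
    intro δ hδ
    obtain ⟨η, hη, hη'⟩ := Metric.continuousAt_iff.1 hαat (δ / 2) (half_pos hδ)
    filter_upwards [hnear, Metric.ball_mem_nhds _ hη] with p hp hpη
    refine lt_of_le_of_lt ((ContinuousMap.dist_le (half_pos hδ).le).2 fun u => ?_) (half_lt_self hδ)
    rw [hγ p hp.1 hp.2]
    have h1 : dist (p.2, p.1 * (u : ℝ)) (x₀, 0) < η := by
      rw [Metric.mem_ball, Prod.dist_eq, max_lt_iff] at hpη
      rw [Prod.dist_eq, max_lt_iff]
      refine ⟨hpη.2, ?_⟩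
      have := hpη.1
      rw [dist_zero_right, Real.norm_eq_abs] at this ⊢
      rw [abs_mul, abs_of_nonneg u.2.1]
      exact (mul_le_of_le_one_right (abs_nonneg _) u.2.2).trans_lt this
    have h2 := (hη' h1).le
    rw [hα0] at h2
    exact h2
  have hpair : Filter.Tendsto (fun p : ℝ × F => (p, γ p)) (𝓝 (0, x₀))
      (𝓝 ((0, x₀), constCLM F x₀)) := Filter.tendsto_id.prodMk_nhds htend
  have heq : (fun p : ℝ × F => α (p.2, p.1)) =ᶠ[𝓝 (0, x₀)] fun p => ψ p 1 := by
    filter_upwards [hpair.eventually hiff, hnear] with p hp hp'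
    have h0 : G (p, γ p) = 0 := by
      have := picardDefect_eq_zero hvn.continuous (hα' p.2 hp'.2) hp'.1 (hγ p hp'.1 hp'.2)
      rwa [(hα p.2 hp'.2).1] at this
    have h1 : ψ p = γ p := hp.1 (h0.trans hG0.symm)
    rw [h1, hγ p hp'.1 hp'.2]
    simp
  refine ContDiffAt.congr_of_eventuallyEq ?_ heq
  exact (ContinuousMap.evalCLM ℝ (1 : unitInterval)).contDiff.contDiffAt.comp _ hsm

/-- The local flow of a vector field which is smooth near `x₀` is jointly smooth at `(0, x₀)`. -/
theorem exists_local_flow_contDiffAt [FiniteDimensional ℝ F] {v : F → F} {x₀ : F} {U : Set F}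
    (hU : U ∈ 𝓝 x₀) (hv : ContDiffOn ℝ ∞ v U) :
    ∃ f : F → ℝ → F, ∃ ε > 0, (∀ x ∈ Metric.ball x₀ ε, f x 0 = x ∧
      ∀ t ∈ Ioo (-ε) ε, f x t ∈ U ∧ HasDerivAt (f x) (v (f x t)) t) ∧
      ContDiffAt ℝ ∞ (fun p : ℝ × F => f p.2 p.1) (0, x₀) := by
  obtain ⟨R, hR, hRU⟩ := Metric.nhds_basis_closedBall.mem_iff.1 (interior_mem_nhds.2 hU)
  let χ : ContDiffBump x₀ := ⟨R / 2, R, half_pos hR, half_lt_self hR⟩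
  have hχv : ContDiff ℝ ∞ (fun x => χ x • v x) := by
    rw [contDiff_iff_contDiffAt]
    intro x
    by_cases hx : x ∈ Metric.closedBall x₀ R
    · exact χ.contDiffAt.smul (hv.contDiffAt (mem_interior_iff_mem_nhds.1 (hRU hx)))
    · have : (fun x => χ x • v x) =ᶠ[𝓝 x] fun _ => 0 := by
        filter_upwards [Metric.isClosed_closedBall.isOpen_compl.mem_nhds hx] with y hy
        rw [χ.zero_of_le_dist, zero_smul]
        rw [mem_compl_iff, Metric.mem_closedBall, not_le] at hy
        exact hy.le
      exact contDiffAt_const.congr_of_eventuallyEq this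
  obtain ⟨f, ε, hε, hf, hsm⟩ := exists_local_flow_contDiffAt_of_contDiff hχv x₀
  have hf0 : f x₀ 0 = x₀ := (hf x₀ (Metric.mem_ball_self hε)).1
  have hcont : ∀ᶠ p : ℝ × F in 𝓝 (0, x₀), f p.2 p.1 ∈ Metric.closedBall x₀ (R / 2) := by
    refine hsm.continuousAt.eventually (Metric.closedBall_mem_nhds_of_mem ?_)
    simp only [hf0]
    exact Metric.mem_ball_self (half_pos hR)
  obtain ⟨δ, hδ, hδ'⟩ := Metric.eventually_nhds_iff_ball.1 hcont
  refine ⟨f, min ε δ, lt_min hε hδ, fun x hx => ?_, hsm⟩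
  have hx1 : x ∈ Metric.ball x₀ ε := Metric.ball_subset_ball (min_le_left _ _) hx
  have hx2 : x ∈ Metric.ball x₀ δ := Metric.ball_subset_ball (min_le_right _ _) hx
  refine ⟨(hf x hx1).1, fun t ht => ?_⟩
  rw [mem_Ioo, ← abs_lt, lt_min_iff] at ht
  have h1 : f x t ∈ Metric.closedBall x₀ (R / 2) := hδ' (t, x) (by
    rw [Metric.mem_ball, Prod.dist_eq, max_lt_iff]
    exact ⟨by rw [dist_zero_right]; exact ht.2, hx2⟩)
  refine ⟨interior_subset (hRU (Metric.closedBall_subset_closedBall (half_le_self hR.le) h1)), ?_⟩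
  have h2 := (hf x hx1).2 t (abs_lt.1 ht.1)
  have h3 : χ (f x t) = 1 := χ.one_of_mem_closedBall h1
  rwa [h3, one_smul] at h2

end LocalFlow

/-! ### Tensor fields in the preferred charts -/

section ChartCalculus

set_option linter.unusedSectionVars false

variable {F : Type*} [NormedAddCommGroup F] [NormedSpace ℝ F]
  {H : Type*} [TopologicalSpace H] (I : ModelWithCorners ℝ F H)
  {M : Type*} [TopologicalSpace M] [ChartedSpace H M]
  {G : Type*} [NormedAddCommGroup G] [NormedSpace ℝ G]

/-- The derivative of the preferred chart at `x₀`. -/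
def chartDeriv (x₀ p : M) : TangentSpace I p →L[ℝ] F :=
  mfderiv I 𝓘(ℝ, F) (extChartAt I x₀) p

/-- The derivative of the inverse of the preferred chart at `x₀`. -/
def chartSymmDeriv (x₀ : M) (y : F) : F →L[ℝ] TangentSpace I ((extChartAt I x₀).symm y) :=
  mfderiv 𝓘(ℝ, F) I (extChartAt I x₀).symm y

/-- A vector field, in the coordinates given by the preferred chart at `x₀`. -/
def vecCoord (X : ∀ m : M, TangentSpace I m) (x₀ : M) (y : F) : F :=
  chartDeriv I x₀ _ (X ((extChartAt I x₀).symm y))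

/-- A field of endomorphisms, in the coordinates given by the preferred chart at `x₀`. -/
def endCoord (J : ∀ m : M, TangentSpace I m →L[ℝ] TangentSpace I m) (x₀ : M) (y : F) : F →L[ℝ] F :=
  ((chartDeriv I x₀ _).comp (J ((extChartAt I x₀).symm y))).comp (chartSymmDeriv I x₀ y)

/-- A bilinear form, in the coordinates given by the preferred chart at `x₀`, as a function with
values in the bilinear forms on the model space. -/
def formCoord (β : ∀ m : M, TangentSpace I m →L[ℝ] TangentSpace I m →L[ℝ] G)
    (x₀ : M) (y : F) : F →L[ℝ] F →L[ℝ] G :=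
  ((chartSymmDeriv I x₀ y).precomp G).comp
    ((β ((extChartAt I x₀).symm y)).comp (chartSymmDeriv I x₀ y))

lemma formCoord_apply (β : ∀ m : M, TangentSpace I m →L[ℝ] TangentSpace I m →L[ℝ] G)
    (x₀ : M) (y u v : F) : formCoord I β x₀ y u v
      = β ((extChartAt I x₀).symm y) (chartSymmDeriv I x₀ y u) (chartSymmDeriv I x₀ y v) := rfl

lemma endCoord_apply (J : ∀ m : M, TangentSpace I m →L[ℝ] TangentSpace I m)
    (x₀ : M) (y u : F) : endCoord I J x₀ y u
      = chartDeriv I x₀ _ (J ((extChartAt I x₀).symm y) (chartSymmDeriv I x₀ y u)) := rfl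

lemma coordForm_eq_formCoord (β : ∀ m : M, TangentSpace I m →L[ℝ] TangentSpace I m →L[ℝ] G)
    (x₀ : M) (y u v : F) : coordForm I β x₀ y u v = formCoord I β x₀ y u v := rfl

variable [I.Boundaryless] [IsManifold I ∞ M]

lemma extChartAt_target_mem {x₀ : M} {y : F} (hy : y ∈ (extChartAt I x₀).target) :
    (extChartAt I x₀).target ∈ 𝓝 y :=
  (isOpen_extChartAt_target x₀).mem_nhds hy

lemma mdifferentiableAt_extChartAt_symm {x₀ : M} {y : F} (hy : y ∈ (extChartAt I x₀).target) :
    MDifferentiableAt 𝓘(ℝ, F) I (extChartAt I x₀).symm y := by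
  have := mdifferentiableWithinAt_extChartAt_symm hy
  rwa [I.range_eq_univ, mdifferentiableWithinAt_univ] at this

lemma mdifferentiableAt_extChartAt' {x₀ p : M} (hp : p ∈ (extChartAt I x₀).source) :
    MDifferentiableAt I 𝓘(ℝ, F) (extChartAt I x₀) p :=
  mdifferentiableAt_extChartAt (by rwa [extChartAt_source] at hp)

lemma chartDeriv_chartSymmDeriv {x₀ : M} {y : F} (hy : y ∈ (extChartAt I x₀).target) (u : F) :
    chartDeriv I x₀ _ (chartSymmDeriv I x₀ y u) = u := by
  have h := mfderiv_extChartAt_comp_mfderivWithin_extChartAt_symm hy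
  rw [I.range_eq_univ, mfderivWithin_univ] at h
  exact congrArg (fun A : F →L[ℝ] F => A u) h

lemma chartSymmDeriv_chartDeriv {x₀ : M} {y : F} (hy : y ∈ (extChartAt I x₀).target)
    (X : TangentSpace I ((extChartAt I x₀).symm y)) :
    chartSymmDeriv I x₀ y (chartDeriv I x₀ _ X) = X := by
  have h := mfderivWithin_extChartAt_symm_comp_mfderiv_extChartAt hy
  rw [I.range_eq_univ, mfderivWithin_univ] at h
  exact congrArg (fun A : TangentSpace I ((extChartAt I x₀).symm y) →L[ℝ]
    TangentSpace I ((extChartAt I x₀).symm y) => A X) h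

lemma chartSymmDeriv_vecCoord {x₀ : M} {y : F} (hy : y ∈ (extChartAt I x₀).target)
    (X : ∀ m : M, TangentSpace I m) :
    chartSymmDeriv I x₀ y (vecCoord I X x₀ y) = X ((extChartAt I x₀).symm y) :=
  chartSymmDeriv_chartDeriv I hy _

lemma chartSymmDeriv_endCoord {x₀ : M} {y : F} (hy : y ∈ (extChartAt I x₀).target)
    (J : ∀ m : M, TangentSpace I m →L[ℝ] TangentSpace I m) (u : F) :
    chartSymmDeriv I x₀ y (endCoord I J x₀ y u)
      = J ((extChartAt I x₀).symm y) (chartSymmDeriv I x₀ y u) :=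
  chartSymmDeriv_chartDeriv I hy _

lemma vecCoord_apply_endo {x₀ : M} {y : F} (hy : y ∈ (extChartAt I x₀).target)
    (J : ∀ m : M, TangentSpace I m →L[ℝ] TangentSpace I m) (X : ∀ m : M, TangentSpace I m) :
    vecCoord I (fun p => J p (X p)) x₀ y = endCoord I J x₀ y (vecCoord I X x₀ y) := by
  rw [endCoord_apply, chartSymmDeriv_vecCoord I hy]
  rfl

lemma formCoord_vecCoord {x₀ : M} {y : F} (hy : y ∈ (extChartAt I x₀).target)
    (β : ∀ m : M, TangentSpace I m →L[ℝ] TangentSpace I m →L[ℝ] G)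
    (X Y : ∀ m : M, TangentSpace I m) :
    formCoord I β x₀ y (vecCoord I X x₀ y) (vecCoord I Y x₀ y)
      = β ((extChartAt I x₀).symm y) (X _) (Y _) := by
  rw [formCoord_apply, chartSymmDeriv_vecCoord I hy, chartSymmDeriv_vecCoord I hy]

lemma formCoord_kahlerForm {x₀ : M} {y : F} (hy : y ∈ (extChartAt I x₀).target)
    (g : ∀ m : M, TangentSpace I m →L[ℝ] TangentSpace I m →L[ℝ] ℝ)
    (J : ∀ m : M, TangentSpace I m →L[ℝ] TangentSpace I m) (u v : F) :
    formCoord I (kahlerForm I g J) x₀ y u v = formCoord I g x₀ y (endCoord I J x₀ y u) v := by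
  rw [formCoord_apply, formCoord_apply, chartSymmDeriv_endCoord I hy]
  rfl

lemma contDiffOn_comp_extChartAt_symm {f : M → G} {x₀ : M}
    (hf : ContMDiffOn I 𝓘(ℝ, G) ∞ f (extChartAt I x₀).source) :
    ContDiffOn ℝ ∞ (f ∘ (extChartAt I x₀).symm) (extChartAt I x₀).target :=
  contMDiffOn_iff_contDiffOn.1 (hf.comp (contMDiffOn_extChartAt_symm x₀)
    (fun _ hy => (extChartAt I x₀).map_target hy))

lemma contMDiffAt_of_comp_extChartAt_symm {f : M → G} {x₀ : M} {n : ℕ∞}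
    (hf : ContDiffAt ℝ n (f ∘ (extChartAt I x₀).symm) (extChartAt I x₀ x₀)) :
    ContMDiffAt I 𝓘(ℝ, G) n f x₀ := by
  have h := hf.contMDiffAt.comp x₀ ((contMDiffAt_extChartAt (I := I) (x := x₀) (n := ∞)).of_le
    (by exact_mod_cast le_top))
  refine h.congr_of_eventuallyEq ?_
  filter_upwards [extChartAt_source_mem_nhds (I := I) x₀] with p hp
  exact congrArg f ((extChartAt I x₀).left_inv hp).symm

lemma trivializationAt_snd_eq_chartDeriv {x₀ p : M} (hp : p ∈ (extChartAt I x₀).source)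
    (X : TangentSpace I p) :
    (trivializationAt F (TangentSpace I) x₀ ⟨p, X⟩).2 = chartDeriv I x₀ p X := by
  rw [extChartAt_source] at hp
  have h := TangentBundle.continuousLinearMapAt_trivializationAt (I := I) hp
  rw [← Bundle.Trivialization.continuousLinearMapAt_apply_of_mem (R := ℝ)
    (trivializationAt F (TangentSpace I) x₀) (by simpa using hp)]
  exact congrArg (fun A : TangentSpace I p →L[ℝ] F => A X) h

lemma trivializationAt_symmL_eq {x₀ : M} {y : F} (hy : y ∈ (extChartAt I x₀).target) (u : F) :
    (trivializationAt F (TangentSpace I) x₀).symmL ℝ ((extChartAt I x₀).symm y) u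
      = chartSymmDeriv I x₀ y u := by
  have hp := (extChartAt I x₀).map_target hy
  have hp' : (extChartAt I x₀).symm y ∈ (trivializationAt F (TangentSpace I) x₀).baseSet := by
    rw [extChartAt_source] at hp
    simpa using hp
  have h := trivializationAt_snd_eq_chartDeriv I hp (chartSymmDeriv I x₀ y u)
  rw [chartDeriv_chartSymmDeriv I hy] at h
  have h2 := (trivializationAt F (TangentSpace I) x₀).symmL_continuousLinearMapAt (R := ℝ) hp'
    (chartSymmDeriv I x₀ y u)
  rw [Bundle.Trivialization.continuousLinearMapAt_apply_of_mem (R := ℝ) _ hp', h] at h2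
  exact h2

lemma contDiffOn_vecCoord {X : ∀ m : M, TangentSpace I m} (hX : IsSmoothVectorField I X) (x₀ : M) :
    ContDiffOn ℝ ∞ (vecCoord I X x₀) (extChartAt I x₀).target := by
  have h1 := ((trivializationAt F (TangentSpace I) x₀).contMDiffOn_section_baseSet_iff
    (IB := I) (n := ∞) (s := X)).1 hX.contMDiffOn
  rw [TangentBundle.trivializationAt_baseSet, ← extChartAt_source I] at h1
  refine (contDiffOn_comp_extChartAt_symm I h1).congr fun y hy => ?_
  exact (trivializationAt_snd_eq_chartDeriv I ((extChartAt I x₀).map_target hy) _).symm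

lemma isSmoothVectorField_of_vecCoord {X : ∀ m : M, TangentSpace I m}
    (hX : ∀ x₀, ContDiffAt ℝ ∞ (vecCoord I X x₀) (extChartAt I x₀ x₀)) :
    IsSmoothVectorField I X := by
  intro x₀
  refine (Bundle.contMDiffAt_section x₀).2 (contMDiffAt_of_comp_extChartAt_symm I ?_)
  refine (hX x₀).congr_of_eventuallyEq ?_
  filter_upwards [extChartAt_target_mem I (mem_extChartAt_target (I := I) x₀)] with y hy
  exact trivializationAt_snd_eq_chartDeriv I ((extChartAt I x₀).map_target hy) _

lemma inCoordinates_eq_endCoord {x₀ : M} {y : F} (hy : y ∈ (extChartAt I x₀).target)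
    (J : ∀ m : M, TangentSpace I m →L[ℝ] TangentSpace I m) :
    ContinuousLinearMap.inCoordinates F (TangentSpace I) F (TangentSpace I) x₀
      ((extChartAt I x₀).symm y) x₀ ((extChartAt I x₀).symm y) (J ((extChartAt I x₀).symm y))
      = endCoord I J x₀ y := by
  have hp := (extChartAt I x₀).map_target hy
  have hp' : (extChartAt I x₀).symm y ∈ (trivializationAt F (TangentSpace I) x₀).baseSet := by
    rw [extChartAt_source] at hp
    simpa using hp
  ext u
  rw [endCoord_apply, ← trivializationAt_snd_eq_chartDeriv I hp, ← trivializationAt_symmL_eq I hy,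
    ← Bundle.Trivialization.continuousLinearMapAt_apply_of_mem (R := ℝ) _ hp']
  rfl

lemma contDiffOn_endCoord {J : ∀ m : M, TangentSpace I m →L[ℝ] TangentSpace I m}
    (hJ : IsSmoothEndomorphism I J) (x₀ : M) :
    ContDiffOn ℝ ∞ (endCoord I J x₀) (extChartAt I x₀).target := by
  have h1 := ((trivializationAt (F →L[ℝ] F)
    (fun m : M => TangentSpace I m →L[ℝ] TangentSpace I m) x₀).contMDiffOn_section_baseSet_iff
    (IB := I) (n := ∞) (s := J)).1 hJ.contMDiffOn
  rw [hom_trivializationAt_baseSet, inter_self, TangentBundle.trivializationAt_baseSet,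
    ← extChartAt_source I] at h1
  refine (contDiffOn_comp_extChartAt_symm I h1).congr fun y hy => ?_
  exact (inCoordinates_eq_endCoord I hy J).symm

lemma isSmoothEndomorphism_of_endCoord {J : ∀ m : M, TangentSpace I m →L[ℝ] TangentSpace I m}
    (hJ : ∀ x₀, ContDiffAt ℝ ∞ (endCoord I J x₀) (extChartAt I x₀ x₀)) :
    IsSmoothEndomorphism I J := by
  intro x₀
  refine (Bundle.contMDiffAt_section x₀).2 (contMDiffAt_of_comp_extChartAt_symm I ?_)
  refine (hJ x₀).congr_of_eventuallyEq ?_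
  filter_upwards [extChartAt_target_mem I (mem_extChartAt_target (I := I) x₀)] with y hy
  exact inCoordinates_eq_endCoord I hy J

lemma contDiffOn_formCoord {β : ∀ m : M, TangentSpace I m →L[ℝ] TangentSpace I m →L[ℝ] ℝ}
    (hβ : ContMDiff I (I.prod 𝓘(ℝ, F →L[ℝ] F →L[ℝ] ℝ)) ∞
      (fun m : M => TotalSpace.mk' (F →L[ℝ] F →L[ℝ] ℝ)
        (E := fun m : M => TangentSpace I m →L[ℝ] TangentSpace I m →L[ℝ] ℝ) m (β m))) (x₀ : M) :
    ContDiffOn ℝ ∞ (formCoord I β x₀) (extChartAt I x₀).target := by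
  have h1 := ((trivializationAt (F →L[ℝ] F →L[ℝ] ℝ)
    (fun m : M => TangentSpace I m →L[ℝ] TangentSpace I m →L[ℝ] ℝ)
    x₀).contMDiffOn_section_baseSet_iff (IB := I) (n := ∞) (s := β)).1 hβ.contMDiffOn
  have hb : (trivializationAt (F →L[ℝ] F →L[ℝ] ℝ)
    (fun m : M => TangentSpace I m →L[ℝ] TangentSpace I m →L[ℝ] ℝ) x₀).baseSet
      = (extChartAt I x₀).source := by
    rw [hom_trivializationAt_baseSet, hom_trivializationAt_baseSet, extChartAt_source]
    simp
  rw [hb] at h1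
  refine (contDiffOn_comp_extChartAt_symm I h1).congr fun y hy => ?_
  have hp := (extChartAt I x₀).map_target hy
  have hp' : (extChartAt I x₀).symm y ∈ (trivializationAt F (TangentSpace I) x₀).baseSet := by
    rw [extChartAt_source] at hp
    simpa using hp
  ext u v
  have h2 := inCoordinates_apply_eq₂ (𝕜 := ℝ) (F₁ := F) (E₁ := fun m : M => TangentSpace I m)
    (F₂ := F) (E₂ := fun m : M => TangentSpace I m) (F₃ := ℝ) (E₃ := Bundle.Trivial M ℝ)
    (ϕ := β ((extChartAt I x₀).symm y)) (v := u) (w := v) (x₀ := x₀) hp' hp' (by simp)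
  refine Eq.trans ?_ h2.symm
  rw [formCoord_apply, ← trivializationAt_symmL_eq I hy, ← trivializationAt_symmL_eq I hy,
    Bundle.Trivialization.symmL_apply _ hp', Bundle.Trivialization.symmL_apply _ hp']
  simp only [Bundle.Trivial.fiberBundle_trivializationAt',
    Bundle.Trivial.linearMapAt_trivialization]
  rfl

end ChartCalculus

section ChartBracket

set_option linter.unusedSectionVars false

variable {F : Type*} [NormedAddCommGroup F] [NormedSpace ℝ F]
  {H : Type*} [TopologicalSpace H] (I : ModelWithCorners ℝ F H)
  {M : Type*} [TopologicalSpace M] [ChartedSpace H M]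
  {G : Type*} [NormedAddCommGroup G] [NormedSpace ℝ G]
  [I.Boundaryless] [IsManifold I ∞ M]

lemma fderiv_comp_extChartAt_symm {f : M → ℝ} {x₀ : M} {y : F}
    (hy : y ∈ (extChartAt I x₀).target)
    (hf : MDifferentiableAt I 𝓘(ℝ, ℝ) f ((extChartAt I x₀).symm y)) (u : F) :
    fderiv ℝ (f ∘ (extChartAt I x₀).symm) y u
      = differential I f _ (chartSymmDeriv I x₀ y u) := by
  have h := hf.hasMFDerivAt.comp y (mdifferentiableAt_extChartAt_symm I hy).hasMFDerivAt
  have h2 : HasFDerivAt (f ∘ (extChartAt I x₀).symm)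
      ((differential I f _).comp (chartSymmDeriv I x₀ y)) y := hasMFDerivAt_iff_hasFDerivAt.1 h
  rw [h2.fderiv]
  rfl

/-- If `γ` has velocity `X` in the manifold, then it has velocity `vecCoord X` in coordinates. -/
lemma hasDerivAt_extChartAt_comp {X : ∀ m : M, TangentSpace I m} {γ : ℝ → M} {t : ℝ} {x₀ : M}
    (hγ : HasMFDerivAt 𝓘(ℝ, ℝ) I γ t ((1 : ℝ →L[ℝ] ℝ).smulRight (X (γ t))))
    (ht : γ t ∈ (extChartAt I x₀).source) :
    HasDerivAt (fun s => extChartAt I x₀ (γ s)) (vecCoord I X x₀ (extChartAt I x₀ (γ t))) t := by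
  have h := (mdifferentiableAt_extChartAt' I ht).hasMFDerivAt.comp t hγ
  have h2 : HasFDerivAt (fun s => extChartAt I x₀ (γ s))
      ((chartDeriv I x₀ (γ t)).comp ((1 : ℝ →L[ℝ] ℝ).smulRight (X (γ t)))) t :=
    hasMFDerivAt_iff_hasFDerivAt.1 h
  have h3 : vecCoord I X x₀ (extChartAt I x₀ (γ t)) = chartDeriv I x₀ (γ t) (X (γ t)) := by
    unfold vecCoord
    rw [(extChartAt I x₀).left_inv ht]
  rw [h3]
  refine h2.hasDerivAt.congr_deriv ?_
  change chartDeriv I x₀ (γ t) ((1 : ℝ) • X (γ t)) = _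
  rw [one_smul]

/-- If `c` has velocity `vecCoord X` in coordinates, then it has velocity `X` in the manifold. -/
lemma hasMFDerivAt_extChartAt_symm_comp {X : ∀ m : M, TangentSpace I m} {c : ℝ → F} {t : ℝ}
    {x₀ : M} (hc : HasDerivAt c (vecCoord I X x₀ (c t)) t) (ht : c t ∈ (extChartAt I x₀).target) :
    HasMFDerivAt 𝓘(ℝ, ℝ) I (fun s => (extChartAt I x₀).symm (c s)) t
      ((1 : ℝ →L[ℝ] ℝ).smulRight (X ((extChartAt I x₀).symm (c t)))) := by
  have h := (mdifferentiableAt_extChartAt_symm I ht).hasMFDerivAt.comp t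
    hc.hasFDerivAt.hasMFDerivAt
  refine h.congr_mfderiv ?_
  ext
  change chartSymmDeriv I x₀ (c t) ((1 : ℝ) • vecCoord I X x₀ (c t)) = (1 : ℝ) • X _
  rw [one_smul, one_smul, chartSymmDeriv_vecCoord I ht]

lemma chartDeriv_self (x₀ : M) (X : TangentSpace I x₀) : chartDeriv I x₀ x₀ X = (X : F) := by
  have h := mfderiv_extChartAt_self (I := I) (x := x₀)
  exact congrArg (fun A : F →L[ℝ] F => A X) h

lemma mpullbackWithin_extChartAt_symm_eq_vecCoord (X : ∀ m : M, TangentSpace I m) {x₀ : M} {y : F}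
    (hy : y ∈ (extChartAt I x₀).target) :
    VectorField.mpullbackWithin 𝓘(ℝ, F) I (extChartAt I x₀).symm X (range I) y
      = vecCoord I X x₀ y := by
  rw [VectorField.mpullbackWithin_apply, I.range_eq_univ, mfderivWithin_univ]
  have h : (mfderiv 𝓘(ℝ, F) I (extChartAt I x₀).symm y).inverse = chartDeriv I x₀ _ := by
    refine ContinuousLinearMap.inverse_eq ?_ ?_
    · ext X
      exact chartSymmDeriv_chartDeriv I hy X
    · ext u
      exact chartDeriv_chartSymmDeriv I hy u
  rw [h]
  rfl

/-- The Lie bracket at the centre of a chart is computed in coordinates. -/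
lemma chartDeriv_mlieBracket (X Y : ∀ m : M, TangentSpace I m) (x₀ : M) :
    chartDeriv I x₀ x₀ (VectorField.mlieBracket I X Y x₀)
      = VectorField.lieBracket ℝ (vecCoord I X x₀) (vecCoord I Y x₀) (extChartAt I x₀ x₀) := by
  rw [chartDeriv_self, VectorField.mlieBracket, VectorField.mlieBracketWithin_apply]
  have h1 : (mfderiv I 𝓘(ℝ, F) (extChartAt I x₀) x₀).inverse
      = ContinuousLinearMap.id ℝ F := by
    rw [mfderiv_extChartAt_self]
    exact ContinuousLinearMap.inverse_id
  rw [h1]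
  have h2 : ∀ Z : ∀ m : M, TangentSpace I m,
      (VectorField.mpullbackWithin 𝓘(ℝ, F) I (extChartAt I x₀).symm Z (range I) : F → F)
        =ᶠ[𝓝 (extChartAt I x₀ x₀)] vecCoord I Z x₀ := by
    intro Z
    filter_upwards [extChartAt_target_mem I (mem_extChartAt_target (I := I) x₀)] with y hy
    exact mpullbackWithin_extChartAt_symm_eq_vecCoord I Z hy
  have h3 := Filter.EventuallyEq.lieBracket_vectorField_eq (𝕜 := ℝ) (h2 X) (h2 Y)
  have h4 : ∀ (V W : F → F) (y : F),
      VectorField.lieBracketWithin ℝ V W univ y = VectorField.lieBracket ℝ V W y := fun V W y => by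
    rw [VectorField.lieBracketWithin_univ]
  rw [preimage_univ, univ_inter]
  nth_rw 3 [I.range_eq_univ]
  exact (h4 _ _ _).trans h3

/-- Every vector of the model space extends to a global smooth vector field whose coordinates are
constant near the centre of a given chart. -/
lemma exists_isSmoothVectorField_vecCoord_eq [FiniteDimensional ℝ F] [T2Space M] (x₀ : M) (u : F) :
    ∃ X : ∀ m : M, TangentSpace I m, IsSmoothVectorField I X ∧
      vecCoord I X x₀ =ᶠ[𝓝 (extChartAt I x₀ x₀)] fun _ => u := by
  set e := trivializationAt F (TangentSpace I) x₀ with he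
  let χ : SmoothBumpFunction I x₀ := Classical.arbitrary _
  let s : ∀ m : M, TangentSpace I m := fun m => e.symm m u
  have hs : ContMDiffOn I (I.prod 𝓘(ℝ, F)) ∞ (fun m => TotalSpace.mk' F m (s m)) e.baseSet := by
    rw [e.contMDiffOn_section_baseSet_iff]
    refine (contMDiffOn_const (c := u)).congr fun m hm => ?_
    exact congrArg Prod.snd (e.apply_mk_symm hm u)
  have hb : e.baseSet = (extChartAt I x₀).source := by
    rw [he, TangentBundle.trivializationAt_baseSet, extChartAt_source]
  refine ⟨fun m => χ m • s m, ?_, ?_⟩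
  · refine ContMDiffOn.smul_section_of_tsupport (χ.contMDiff.contMDiffOn) e.open_baseSet ?_ hs
    rw [hb]
    exact χ.tsupport_subset_extChartAt_source
  · have h1 : ∀ᶠ y in 𝓝 (extChartAt I x₀ x₀), χ ((extChartAt I x₀).symm y) = 1 := by
      have h2 : ContinuousAt (extChartAt I x₀).symm (extChartAt I x₀ x₀) :=
        continuousAt_extChartAt_symm x₀
      refine h2.eventually (p := fun m => χ m = 1) ?_
      rw [(extChartAt I x₀).left_inv (mem_extChartAt_source x₀)]
      exact χ.eventuallyEq_one
    filter_upwards [h1, extChartAt_target_mem I (mem_extChartAt_target (I := I) x₀)] with y hy hy'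
    have hp := (extChartAt I x₀).map_target hy'
    unfold vecCoord
    beta_reduce
    rw [hy, one_smul, ← trivializationAt_snd_eq_chartDeriv I hp]
    exact congrArg Prod.snd (e.apply_mk_symm (hb ▸ hp) u)

/-- The vanishing of the Nijenhuis tensor, in coordinates at the centre of a chart. -/
lemma nijenhuis_coord [FiniteDimensional ℝ F] [T2Space M]
    {J : ∀ m : M, TangentSpace I m →L[ℝ] TangentSpace I m} (hJ : IsComplexStructure I J)
    (x₀ : M) {A : F → F →L[ℝ] F} (hA : A = endCoord I J x₀) {y : F} (hy : y = extChartAt I x₀ x₀)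
    (u v : F) :
    fderiv ℝ A y (A y u) v - fderiv ℝ A y (A y v) u + A y (fderiv ℝ A y v u)
      - A y (fderiv ℝ A y u v) = 0 := by
  subst hA
  obtain ⟨X, hX, hXu⟩ := exists_isSmoothVectorField_vecCoord_eq I x₀ u
  obtain ⟨Y, hY, hYv⟩ := exists_isSmoothVectorField_vecCoord_eq I x₀ v
  rw [← hy] at hXu hYv
  have hT := extChartAt_target_mem I (mem_extChartAt_target (I := I) x₀)
  rw [← hy] at hT
  have hd : DifferentiableAt ℝ (endCoord I J x₀) y :=
    ((contDiffOn_endCoord I hJ.smooth x₀).contDiffAt hT).differentiableAt (by simp)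
  have hJX : ∀ {Z : ∀ m : M, TangentSpace I m} {w : F}, (vecCoord I Z x₀ =ᶠ[𝓝 y] fun _ => w) →
      vecCoord I (fun p => J p (Z p)) x₀ =ᶠ[𝓝 y] fun z => endCoord I J x₀ z w := by
    intro Z w hZ
    filter_upwards [hZ, hT] with z hz hz'
    rw [vecCoord_apply_endo I hz', hz]
  have hN := congrArg (chartDeriv I x₀ x₀) (hJ.integrable X Y hX hY x₀)
  have hJc : ∀ W : TangentSpace I x₀,
      chartDeriv I x₀ x₀ (J x₀ W) = endCoord I J x₀ y (chartDeriv I x₀ x₀ W) := by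
    have hl : (extChartAt I x₀).symm y = x₀ := by
      rw [hy]
      exact (extChartAt I x₀).left_inv (mem_extChartAt_source x₀)
    intro W
    have : ∀ p, p = (extChartAt I x₀).symm y → ∀ W : TangentSpace I p,
        chartDeriv I x₀ p (J p W) = endCoord I J x₀ y (chartDeriv I x₀ p W) := by
      rintro p rfl W
      rw [endCoord_apply, chartSymmDeriv_chartDeriv I (hy ▸ mem_extChartAt_target x₀)]
    exact this x₀ hl.symm W
  have hl : ∀ w : F, fderiv ℝ (fun z => endCoord I J x₀ z w) y = (fderiv ℝ (endCoord I J x₀) y).flip w := by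
    intro w
    have := hd.hasFDerivAt.clm_apply (hasFDerivAt_const w y)
    rw [this.fderiv]
    ext z
    simp
  unfold nijenhuis at hN
  simp only [map_sub, map_zero, hJc, chartDeriv_mlieBracket, ← hy] at hN
  rw [(hJX hXu).lieBracket_vectorField_eq (hJX hYv), (hJX hXu).lieBracket_vectorField_eq hYv,
    hXu.lieBracket_vectorField_eq (hJX hYv), hXu.lieBracket_vectorField_eq hYv] at hN
  simp only [VectorField.lieBracket, hl, fderiv_fun_const, ContinuousLinearMap.flip_apply] at hN
  simp only [Pi.zero_apply, zero_apply, zero_sub, sub_zero, map_neg, sub_neg_eq_add] at hN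
  exact hN

end ChartBracket

/-! ### Cartan calculus at a point

The identities below concern the values and the first derivatives, at one point of a vector space,
of a metric `g`, a 2-form `β`, an almost complex structure `J` and vector fields `R`, `T`, `v`.
A prime marks the derivative, whose direction is its first argument. -/

section PointwiseCartan

set_option synthInstance.maxHeartbeats 200000

variable {F : Type*} [NormedAddCommGroup F] [NormedSpace ℝ F]

/-- Cartan's formula: `L_R β = d(ι_R β)` for a closed form `β`. -/
lemma lie_eq_of_closed {β : F →L[ℝ] F →L[ℝ] ℝ} {β' : F →L[ℝ] F →L[ℝ] F →L[ℝ] ℝ}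
    {R : F} {R' : F →L[ℝ] F} (hβ : ∀ u v, β u v = -β v u) (hβ' : ∀ w u v, β' w u v = -β' w v u)
    (hclosed : ∀ u v w, β' u v w + β' v w u + β' w u v = 0) (u v : F) :
    β' R u v + β (R' u) v + β u (R' v)
      = (β' u R v + β (R' u) v) - (β' v R u + β (R' v) u) := by
  linarith [hclosed R u v, hβ u (R' v), hβ' u v R]

/-- If `ι_v β` is closed (as the differential of a function is), then `L_v β = 0`. -/
lemma lie_eq_zero_of_contraction_closed {β : F →L[ℝ] F →L[ℝ] ℝ}
    {β' : F →L[ℝ] F →L[ℝ] F →L[ℝ] ℝ} {v : F} {v' : F →L[ℝ] F}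
    (hβ : ∀ u v, β u v = -β v u) (hβ' : ∀ w u v, β' w u v = -β' w v u)
    (hclosed : ∀ u v w, β' u v w + β' v w u + β' w u v = 0)
    (hv : ∀ u w, β' u v w + β (v' u) w = β' w v u + β (v' w) u) (u w : F) :
    β' v u w + β (v' u) w + β u (v' w) = 0 := by
  rw [lie_eq_of_closed hβ hβ' hclosed, hv, sub_self]

/-- If `T` preserves the closed form `β`, if `R` rescales it with weight `2`, and if `[R, T] = 0`,
then `d(β(T, R)) = 2 ι_T β`. -/
lemma deriv_contraction_of_lie {β : F →L[ℝ] F →L[ℝ] ℝ} {β' : F →L[ℝ] F →L[ℝ] F →L[ℝ] ℝ}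
    {R T : F} {R' T' : F →L[ℝ] F} (hβ : ∀ u v, β u v = -β v u)
    (hclosed : ∀ u v w, β' u v w + β' v w u + β' w u v = 0)
    (hT : ∀ u v, β' T u v + β (T' u) v + β u (T' v) = 0)
    (hR : ∀ u v, β' R u v + β (R' u) v + β u (R' v) = 2 * β u v) (hRT : T' R = R' T) (u : F) :
    β' u T R + β (T' u) R + β T (R' u) = 2 * β T u := by
  have h1 := hT R u
  rw [hRT] at h1
  linarith [hclosed u T R, hR u T, hβ R (T' u), hβ (R' u) T, hβ (R' T) u, hβ u T]

/-- On a Kähler manifold, let `R` be a gradient vector field (`g(R, ·)` is closed) with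
`L_R g = 2 g`. Then `L_R J = 0`. Indeed `L_R β = d(ι_R β)` is of type `(1, 1)`, by integrability of
`J`, and so is `2 β`; but `L_R β - 2 β = g((L_R J) ·, ·)` has type `(2, 0) + (0, 2)`, because
`L_R J` anticommutes with `J`. -/
lemma lie_complexStructure_eq_zero {g : F →L[ℝ] F →L[ℝ] ℝ} {g' : F →L[ℝ] F →L[ℝ] F →L[ℝ] ℝ}
    {J : F →L[ℝ] F} {J' : F →L[ℝ] F →L[ℝ] F} {R : F} {R' : F →L[ℝ] F}
    (gsymm : ∀ u v, g u v = g v u) (gsymm' : ∀ w u v, g' w u v = g' w v u)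
    (gnondeg : ∀ u, (∀ v, g u v = 0) → u = 0)
    (herm : ∀ u v, g (J u) (J v) = g u v)
    (herm' : ∀ w u v, g' w (J u) (J v) + g (J' w u) (J v) + g (J u) (J' w v) = g' w u v)
    (hJ : ∀ u, J (J u) = -u) (hJ' : ∀ w u, J' w (J u) + J (J' w u) = 0)
    (hN : ∀ u v, J' (J u) v - J' (J v) u + J (J' v u) - J (J' u v) = 0)
    (hclosed : ∀ u v w, (g' u (J v) w + g (J' u v) w) + (g' v (J w) u + g (J' v w) u)
      + (g' w (J u) v + g (J' w u) v) = 0)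
    (hR : ∀ u v, g' R u v + g (R' u) v + g u (R' v) = 2 * g u v)
    (hgrad : ∀ u v, g' u R v + g (R' u) v = g' v R u + g (R' v) u) (u : F) :
    J' R u + J (R' u) - R' (J u) = 0 := by
  -- the antisymmetry of `β` and of its derivative
  have hβ : ∀ u v, g (J u) v = -g u (J v) := by
    intro u v
    have h := herm u (J v)
    rw [hJ, map_neg] at h
    linarith
  have hβ' : ∀ w u v, g' w (J u) v + g (J' w u) v = -(g' w u (J v) + g u (J' w v)) := by
    intro w u v
    have h := herm' w u (J v)
    have h2 : g (J u) (J' w (J v)) = -g u (J' w v) := by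
      rw [eq_neg_of_add_eq_zero_left (hJ' w v), map_neg, herm]
    rw [hJ, map_neg, map_neg, h2] at h
    linarith
  -- `L_R β = d(ι_R β)`, where `ι_R β = -g(R, J ·)`
  have hL : ∀ u v, g' R (J u) v + g (J' R u) v + g (J (R' u)) v + g (J u) (R' v)
      = -(g' u R (J v) + g (R' u) (J v)) - g R (J' u v)
        + (g' v R (J u) + g (R' v) (J u)) + g R (J' v u) := by
    intro u v
    have h1 := hclosed R u v
    have h2 := hβ' u R v
    have h3 := hβ' v u R
    have h4 := hβ (R' u) v
    have h5 := gsymm (J u) (R' v)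
    have h6 := gsymm' v R (J u)
    have h7 := hβ' u v R
    have h8 := hβ' v R u
    have h9 := gsymm' v u (J R)
    have h10 := gsymm u (J' v R)
    have h11 := gsymm' u v (J R)
    have h12 := gsymm v (J' u R)
    linarith
  -- `L_R β` is of type `(1, 1)`
  have h11 : ∀ u v, g' R (J (J u)) (J v) + g (J' R (J u)) (J v) + g (J (R' (J u))) (J v)
      + g (J (J u)) (R' (J v))
      = g' R (J u) v + g (J' R u) v + g (J (R' u)) v + g (J u) (R' v) := by
    intro u v
    rw [hL, hL]
    have h1 := hgrad (J u) (J (J v))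
    have h2 := hgrad (J v) (J (J u))
    have h3 := congrArg (fun w => g R (J w)) (hN u v)
    have h4 : g R (J' (J u) (J v)) = -g R (J (J' (J u) v)) := by
      rw [eq_neg_of_add_eq_zero_left (hJ' (J u) v), map_neg]
    have h5 : g R (J' (J v) (J u)) = -g R (J (J' (J v) u)) := by
      rw [eq_neg_of_add_eq_zero_left (hJ' (J v) u), map_neg]
    simp only [map_sub, map_add, hJ, map_neg, map_zero, neg_apply] at h1 h2 h3 ⊢
    linarith
  -- `B = L_R J` anticommutes with `J`
  set B : F → F := fun u => J' R u + J (R' u) - R' (J u) with hB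
  have hBJ : ∀ u, B (J u) = -J (B u) := by
    intro u
    have h := eq_neg_of_add_eq_zero_left (hJ' R u)
    simp only [hB, h, hJ, map_neg, map_sub, map_add]
    abel
  have hgB : ∀ u v, g (B u) v
      = g' R (J u) v + g (J' R u) v + g (J (R' u)) v + g (J u) (R' v) - 2 * g (J u) v := by
    intro u v
    have h := hR (J u) v
    simp only [hB, map_sub, map_add, sub_apply, add_apply]
    linarith
  refine gnondeg _ fun v => ?_
  have h1 := hgB (J u) (J v)
  have h2 := hgB u v
  rw [hBJ, map_neg, neg_apply, herm, h11 u v, herm] at h1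
  change g (B u) v = 0
  linarith

end PointwiseCartan

/-! ### Global flows on manifolds -/

section Flow

set_option linter.unusedSectionVars false

variable {F : Type*} [NormedAddCommGroup F] [NormedSpace ℝ F] [FiniteDimensional ℝ F]
  {H : Type*} [TopologicalSpace H] {I : ModelWithCorners ℝ F H}
  {M : Type*} [TopologicalSpace M] [ChartedSpace H M]
  [I.Boundaryless] [IsManifold I ∞ M] [T2Space M]
  {v : ∀ m : M, TangentSpace I m}

lemma IsSmoothVectorField.contMDiff_one (hv : IsSmoothVectorField I v) :
    ContMDiff I I.tangent 1 (fun m : M => (⟨m, v m⟩ : TangentBundle I M)) :=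
  ContMDiff.of_le hv (by simp)

/-- Near each point, the integral curves of a smooth vector field are given in coordinates by a
jointly smooth family of curves, on a common interval of time. -/
lemma exists_local_flow (hv : IsSmoothVectorField I v) (m₀ : M) :
    ∃ c : M → ℝ → M, ∃ ε > 0, (∀ᶠ m in 𝓝 m₀, c m 0 = m ∧
      IsMIntegralCurveOn (c m) v (Ioo (-ε) ε)) ∧
      ContMDiffAt (𝓘(ℝ, ℝ).prod I) I ∞ (fun p : ℝ × M => c p.2 p.1) (0, m₀) := by
  have hT := extChartAt_target_mem I (mem_extChartAt_target (I := I) m₀)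
  obtain ⟨f, ε, hε, hf, hsm⟩ := exists_local_flow_contDiffAt hT (contDiffOn_vecCoord I hv m₀)
  refine ⟨fun m t => (extChartAt I m₀).symm (f (extChartAt I m₀ m) t), ε, hε, ?_, ?_⟩
  · filter_upwards [extChartAt_source_mem_nhds (I := I) m₀,
      (continuousAt_extChartAt (I := I) m₀).eventually (Metric.ball_mem_nhds _ hε)] with m hm hm'
    obtain ⟨h0, h1⟩ := hf _ hm'
    refine ⟨by rw [h0, (extChartAt I m₀).left_inv hm], fun t ht => ?_⟩
    exact (hasMFDerivAt_extChartAt_symm_comp I (h1 t ht).2 (h1 t ht).1).hasMFDerivWithinAt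
  · have h0 : f (extChartAt I m₀ m₀) 0 = extChartAt I m₀ m₀ := (hf _ (Metric.mem_ball_self hε)).1
    have h1 : ContMDiffAt (𝓘(ℝ, ℝ).prod I) 𝓘(ℝ, ℝ × F) ∞
        (fun p : ℝ × M => (p.1, extChartAt I m₀ p.2)) (0, m₀) :=
      contMDiffAt_fst.prodMk_space (ContMDiffAt.comp (g := extChartAt I m₀)
        (f := fun p : ℝ × M => p.2) (0, m₀) contMDiffAt_extChartAt contMDiffAt_snd)
    have h2 := hsm.contMDiffAt.comp (0, m₀) h1
    have h3 := (contMDiffOn_extChartAt_symm (I := I) (n := ∞) m₀).contMDiffAt hT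
    rw [← h0] at h3
    exact ContMDiffAt.comp (g := (extChartAt I m₀).symm)
      (f := fun p : ℝ × M => f (extChartAt I m₀ p.2) p.1) (0, m₀) h3 h2

variable {φ : ℝ → M → M}

/-- The flow of a complete vector field is an action of `ℝ`. -/
lemma flow_add (hv : IsSmoothVectorField I v) (h0 : ∀ m, φ 0 m = m)
    (hφ : ∀ m, IsMIntegralCurve (fun t => φ t m) v) (s t : ℝ) (m : M) :
    φ (s + t) m = φ s (φ t m) := by
  have h := isMIntegralCurve_Ioo_eq_of_contMDiff_boundaryless (t₀ := 0) hv.contMDiff_one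
    ((hφ m).comp_add t) (hφ (φ t m)) (by simp [h0])
  exact congrFun h s

lemma contMDiffAt_flow_zero (hv : IsSmoothVectorField I v) (h0 : ∀ m, φ 0 m = m)
    (hφ : ∀ m, IsMIntegralCurve (fun t => φ t m) v) (m₀ : M) :
    ContMDiffAt (𝓘(ℝ, ℝ).prod I) I ∞ (fun p : ℝ × M => φ p.1 p.2) (0, m₀) := by
  obtain ⟨c, ε, hε, hc, hsm⟩ := exists_local_flow hv m₀
  refine hsm.congr_of_eventuallyEq ?_
  have h1 : ∀ᶠ p : ℝ × M in 𝓝 (0, m₀), p.1 ∈ Ioo (-ε) ε :=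
    Filter.Tendsto.eventually continuousAt_fst (Ioo_mem_nhds (neg_lt_zero.2 hε) hε)
  have h2 : ∀ᶠ p : ℝ × M in 𝓝 (0, m₀), c p.2 0 = p.2 ∧
      IsMIntegralCurveOn (c p.2) v (Ioo (-ε) ε) := by
    have h3 : ContinuousAt (Prod.snd : ℝ × M → M) (0, m₀) := continuousAt_snd
    exact Filter.Tendsto.eventually h3 hc
  filter_upwards [h1, h2] with p hp hp'
  refine isMIntegralCurveOn_Ioo_eqOn_of_contMDiff_boundaryless (t₀ := 0)
    ⟨neg_lt_zero.2 hε, hε⟩ hv.contMDiff_one ((hφ p.2).isMIntegralCurveOn _) hp'.2 ?_ hp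
  rw [h0, hp'.1]

/-- The flow of a complete smooth vector field is jointly smooth in time and initial point. -/
theorem contMDiff_flow (hv : IsSmoothVectorField I v) (h0 : ∀ m, φ 0 m = m)
    (hφ : ∀ m, IsMIntegralCurve (fun t => φ t m) v) :
    ContMDiff (𝓘(ℝ, ℝ).prod I) I ∞ (fun p : ℝ × M => φ p.1 p.2) := by
  rw [contMDiff_infty]
  rintro n ⟨t₀, m⟩
  set P : ℝ × M → M := fun p => φ p.1 p.2
  have hcont : Continuous (fun t => φ t m) := (hφ m).continuous
  have hev : ∀ p, ContMDiffAt (𝓘(ℝ, ℝ).prod I) I n P p →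
      ∀ᶠ q in 𝓝 p, ContMDiffAt (𝓘(ℝ, ℝ).prod I) I n P q :=
    fun p hp => by
      have : IsManifold I n M := IsManifold.of_le (n := ∞) (by exact_mod_cast le_top)
      exact (contMDiffAt_iff_contMDiffAt_nhds (by simp)).1 hp
  -- the times at which the flow is smooth form an open and closed set
  suffices h : IsClopen {t : ℝ | ContMDiffAt (𝓘(ℝ, ℝ).prod I) I n P (t, m)} by
    have hne : {t : ℝ | ContMDiffAt (𝓘(ℝ, ℝ).prod I) I n P (t, m)}.Nonempty :=
      ⟨0, (contMDiffAt_flow_zero hv h0 hφ m).of_le (by exact_mod_cast le_top)⟩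
    exact (h.eq_univ hne).symm.subset (mem_univ t₀)
  constructor
  · rw [← closure_subset_iff_isClosed]
    intro t ht
    have h1 := hev (0, φ t m)
      ((contMDiffAt_flow_zero hv h0 hφ (φ t m)).of_le (by exact_mod_cast le_top))
    have h2 : Filter.Tendsto (fun s => (t - s, φ s m)) (𝓝 t) (𝓝 (0, φ t m)) := by
      have : Continuous (fun s => (t - s, φ s m)) := by fun_prop
      simpa using this.tendsto t
    obtain ⟨s, hs1, hs2⟩ := (mem_closure_iff_frequently.1 ht).and_eventually (h2.eventually h1) |>.exists
    have h3 : P = fun q => P (q.1 - s, P (s, q.2)) := by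
      ext q
      change φ q.1 q.2 = φ (q.1 - s) (φ s q.2)
      rw [← flow_add hv h0 hφ, sub_add_cancel]
    change ContMDiffAt _ _ _ P (t, m)
    rw [h3]
    have h4 : ContMDiffAt (𝓘(ℝ, ℝ).prod I) I n (fun q : ℝ × M => P (s, q.2)) (t, m) :=
      ContMDiffAt.comp (g := P) (f := fun q : ℝ × M => (s, q.2)) (t, m) hs1
        (contMDiffAt_const.prodMk contMDiffAt_snd)
    have h5 : ContMDiffAt (𝓘(ℝ, ℝ).prod I) 𝓘(ℝ, ℝ) n (fun q : ℝ × M => q.1 - s) (t, m) :=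
      contMDiffAt_fst.sub contMDiffAt_const
    exact ContMDiffAt.comp (g := P) (f := fun q : ℝ × M => (q.1 - s, P (s, q.2))) (t, m) hs2
      (h5.prodMk h4)
  · rw [isOpen_iff_mem_nhds]
    intro t ht
    have h2 : Filter.Tendsto (fun s => (s, m)) (𝓝 t) (𝓝 (t, m)) :=
      (Continuous.prodMk_left m).tendsto t
    exact h2.eventually (hev _ ht)

lemma IsMIntegralCurve.comp_of_mfderiv_apply {P : M → M} {γ : ℝ → M}
    (hγ : IsMIntegralCurve γ v) (hP : MDifferentiable I I P)
    (h : ∀ m, mfderiv I I P m (v m) = v (P m)) : IsMIntegralCurve (P ∘ γ) v := by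
  intro t
  refine ((hP (γ t)).hasMFDerivAt.comp t (hγ t)).congr_mfderiv ?_
  ext
  change mfderiv I I P (γ t) ((1 : ℝ) • v (γ t)) = (1 : ℝ) • v (P (γ t))
  rw [one_smul, one_smul, h]

lemma mfderiv_apply_of_isMIntegralCurve_comp {P : M → M} {γ : ℝ → M}
    (hγ : IsMIntegralCurve γ v) (hP : MDifferentiable I I P)
    (h : IsMIntegralCurve (P ∘ γ) v) (t : ℝ) :
    mfderiv I I P (γ t) (v (γ t)) = v (P (γ t)) := by
  have h1 := hasMFDerivAt_unique ((hP (γ t)).hasMFDerivAt.comp t (hγ t)) (h t)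
  have h2 : mfderiv I I P (γ t) ((1 : ℝ) • v (γ t)) = (1 : ℝ) • v (P (γ t)) :=
    congrArg (fun A : ℝ →L[ℝ] TangentSpace I (P (γ t)) => A 1) h1
  rwa [one_smul, one_smul] at h2

/-- The maps of an `ℝ`-action preserve its generator. -/
lemma mfderiv_action_apply (h0 : ∀ m, φ 0 m = m) (hadd : ∀ s t m, φ (s + t) m = φ s (φ t m))
    (hφ : ∀ m, IsMIntegralCurve (fun t => φ t m) v) (s : ℝ) (hs : MDifferentiable I I (φ s))
    (m : M) : mfderiv I I (φ s) m (v m) = v (φ s m) := by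
  have h1 : φ s ∘ (fun t => φ t m) = (fun t => φ t m) ∘ fun t => t + s := by
    ext t
    simp only [Function.comp_apply]
    rw [add_comm, hadd]
  have h2 := mfderiv_apply_of_isMIntegralCurve_comp (hφ m) hs (h1 ▸ (hφ m).comp_add s) 0
  beta_reduce at h2
  rwa [h0 m] at h2

end Flow

/-! ### Families of maps in coordinates -/

section FlowCoordinates

set_option linter.unusedSectionVars false

variable {F : Type*} [NormedAddCommGroup F] [NormedSpace ℝ F]
  {H : Type*} [TopologicalSpace H] {I : ModelWithCorners ℝ F H}
  {M : Type*} [TopologicalSpace M] [ChartedSpace H M]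
  [I.Boundaryless] [IsManifold I ∞ M]
  {v : ∀ m : M, TangentSpace I m} {P : ℝ → M → M}

lemma contMDiff_of_uncurry (hP : ContMDiff (𝓘(ℝ, ℝ).prod I) I ∞ (fun p : ℝ × M => P p.1 p.2))
    (t : ℝ) : ContMDiff I I ∞ (P t) :=
  hP.comp (contMDiff_const.prodMk contMDiff_id)

variable (I P) in
/-- The expression of the family of maps `P` in the coordinates given by the preferred chart at
`m`. -/
def flowCoord (m : M) (q : ℝ × F) : F := extChartAt I m (P q.1 ((extChartAt I m).symm q.2))

lemma contDiffAt_flowCoord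
    (hP : ContMDiff (𝓘(ℝ, ℝ).prod I) I ∞ (fun p : ℝ × M => P p.1 p.2)) (hP0 : ∀ m, P 0 m = m)
    {m : M} {y : F} (hy : y ∈ (extChartAt I m).target) :
    ContDiffAt ℝ ∞ (flowCoord I P m) (0, y) := by
  have h1 : ContMDiffAt 𝓘(ℝ, F) I ∞ (extChartAt I m).symm y :=
    (contMDiffOn_extChartAt_symm m).contMDiffAt (extChartAt_target_mem I hy)
  have h2 : ContMDiffAt 𝓘(ℝ, ℝ × F) (𝓘(ℝ, ℝ).prod I) ∞
      (fun q : ℝ × F => (q.1, (extChartAt I m).symm q.2)) (0, y) :=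
    contDiff_fst.contMDiff.contMDiffAt.prodMk
      (ContMDiffAt.comp (g := (extChartAt I m).symm) (f := fun q : ℝ × F => q.2)
        (0, y) h1 contDiff_snd.contMDiff.contMDiffAt)
  have h3 := ContMDiffAt.comp (g := fun p : ℝ × M => P p.1 p.2) (0, y) hP.contMDiffAt h2
  have h4 : ContMDiffAt I 𝓘(ℝ, F) ∞ (extChartAt I m) (P 0 ((extChartAt I m).symm y)) := by
    rw [hP0]
    have h := (extChartAt I m).map_target hy
    rw [extChartAt_source] at h
    exact contMDiffAt_extChartAt' h
  exact (ContMDiffAt.comp (g := extChartAt I m)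
    (f := fun q : ℝ × F => P q.1 ((extChartAt I m).symm q.2)) (0, y) h4 h3).contDiffAt

lemma flowCoord_zero (hP0 : ∀ m, P 0 m = m) {m : M} {y : F} (hy : y ∈ (extChartAt I m).target) :
    flowCoord I P m (0, y) = y := by
  simp only [flowCoord, hP0, (extChartAt I m).right_inv hy]

/-- In coordinates, the orbits of `P` have velocity `vecCoord v` at time `0`. -/
lemma hasDerivAt_flowCoord (hP0 : ∀ m, P 0 m = m)
    (hv : ∀ m, HasMFDerivAt 𝓘(ℝ, ℝ) I (fun t => P t m) 0
      ((1 : ℝ →L[ℝ] ℝ).smulRight (v (P 0 m)))) {m : M} {y : F}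
    (hy : y ∈ (extChartAt I m).target) :
    HasDerivAt (fun t => flowCoord I P m (t, y)) (vecCoord I v m y) 0 := by
  have h1 := hasDerivAt_extChartAt_comp I (x₀ := m) (hv ((extChartAt I m).symm y))
    (by rw [hP0]; exact (extChartAt I m).map_target hy)
  beta_reduce at h1
  rwa [hP0, (extChartAt I m).right_inv hy] at h1

end FlowCoordinates

/-! ### Lie derivatives of bilinear forms -/

section LieDerivative

set_option linter.unusedSectionVars false
set_option synthInstance.maxHeartbeats 200000

variable {F : Type*} [NormedAddCommGroup F] [NormedSpace ℝ F]

/-- The Lie derivative of the field of bilinear forms `B` along the vector field `V`, on a vector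
space. -/
def lieForm (B : F → F →L[ℝ] F →L[ℝ] ℝ) (V : F → F) (y u w : F) : ℝ :=
  fderiv ℝ B y (V y) u w + B y (fderiv ℝ V y u) w + B y u (fderiv ℝ V y w)

/-- The derivative at time `0` of the spatial derivative of a flow is the derivative of its
generator, by the symmetry of the second derivative. -/
lemma hasDerivAt_fderiv_flow {p : ℝ × F → F} {V : F → F} {y₀ : F}
    (hp : ContDiffAt ℝ 2 p (0, y₀))
    (hV : ∀ᶠ y in 𝓝 y₀, HasDerivAt (fun t => p (t, y)) (V y) 0) (u : F) :
    HasDerivAt (fun t : ℝ => fderiv ℝ p (t, y₀) ((0 : ℝ), u)) (fderiv ℝ V y₀ u) 0 := by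
  have hD : ContDiffAt ℝ 1 (fderiv ℝ p) (0, y₀) := hp.fderiv_right (m := 1) le_rfl
  obtain ⟨D, hDD⟩ : ∃ D, HasFDerivAt (fderiv ℝ p) D (0, y₀) :=
    ⟨_, (hD.differentiableAt one_ne_zero).hasFDerivAt⟩
  have h2 : HasDerivAt (fun t : ℝ => (t, y₀)) ((1 : ℝ), (0 : F)) 0 :=
    (hasDerivAt_id 0).prodMk (hasDerivAt_const 0 y₀)
  have h3 : HasDerivAt (fun t : ℝ => fderiv ℝ p (t, y₀)) (D (1, 0)) 0 :=
    HasFDerivAt.comp_hasDerivAt (f := fun t : ℝ => (t, y₀)) (0 : ℝ) hDD h2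
  have h3' : HasDerivAt (fun t : ℝ => fderiv ℝ p (t, y₀) ((0 : ℝ), u)) (D (1, 0) (0, u)) 0 :=
    ((ContinuousLinearMap.apply ℝ F ((0 : ℝ), u)).hasFDerivAt).comp_hasDerivAt (0 : ℝ) h3
  have h4 : V =ᶠ[𝓝 y₀] fun y => fderiv ℝ p (0, y) (1, 0) := by
    have h5 : ∀ᶠ q in 𝓝 ((0 : ℝ), y₀), DifferentiableAt ℝ p q :=
      (hp.eventually (by decide)).mono fun q hq => hq.differentiableAt two_ne_zero
    have h6 : Filter.Tendsto (fun y => ((0 : ℝ), y)) (𝓝 y₀) (𝓝 (0, y₀)) :=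
      (Continuous.prodMk_right (0 : ℝ)).tendsto y₀
    filter_upwards [hV, h6.eventually h5] with y hy hy'
    have h7 : HasDerivAt (fun t : ℝ => (t, y)) ((1 : ℝ), (0 : F)) 0 :=
      (hasDerivAt_id 0).prodMk (hasDerivAt_const 0 y)
    exact hy.unique (HasFDerivAt.comp_hasDerivAt (f := fun t : ℝ => (t, y)) (0 : ℝ)
      hy'.hasFDerivAt h7)
  have h8 : HasFDerivAt (fun y : F => ((0 : ℝ), y)) (ContinuousLinearMap.inr ℝ ℝ F) y₀ :=
    hasFDerivAt_prodMk_right 0 y₀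
  have h9 : HasFDerivAt (fun y : F => fderiv ℝ p (0, y))
      (D.comp (ContinuousLinearMap.inr ℝ ℝ F)) y₀ :=
    HasFDerivAt.comp (f := fun y : F => ((0 : ℝ), y)) y₀ hDD h8
  have h9' : HasFDerivAt (fun y : F => fderiv ℝ p (0, y) ((1 : ℝ), (0 : F)))
      ((ContinuousLinearMap.apply ℝ F ((1 : ℝ), (0 : F))).comp
        (D.comp (ContinuousLinearMap.inr ℝ ℝ F))) y₀ :=
    HasFDerivAt.comp (f := fun y : F => fderiv ℝ p (0, y)) y₀
      (ContinuousLinearMap.apply ℝ F ((1 : ℝ), (0 : F))).hasFDerivAt h9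
  have h10 : fderiv ℝ V y₀ u = D (0, u) (1, 0) := by
    rw [h4.fderiv_eq, h9'.fderiv]
    rfl
  have hs : D (0, u) (1, 0) = D (1, 0) (0, u) := by
    have h := hp.isSymmSndFDerivAt (by simp)
    rw [IsSymmSndFDerivAt, hDD.fderiv] at h
    exact h _ _
  rw [h10, hs]
  exact h3'

lemma hasDerivAt_bilin_apply {B : ℝ → F →L[ℝ] F →L[ℝ] ℝ} {B' : F →L[ℝ] F →L[ℝ] ℝ}
    {u w : ℝ → F} {u' w' : F} {t : ℝ} (hB : HasDerivAt B B' t) (hu : HasDerivAt u u' t)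
    (hw : HasDerivAt w w' t) :
    HasDerivAt (fun s => B s (u s) (w s)) (B' (u t) (w t) + B t u' (w t) + B t (u t) w') t :=
  (hB.clm_apply hu).clm_apply hw

lemma hasDerivAt_pullback {p : ℝ × F → F} {V : F → F} {B : F → F →L[ℝ] F →L[ℝ] ℝ} {y₀ : F}
    (hp : ContDiffAt ℝ 2 p (0, y₀)) (hp0 : ∀ᶠ y in 𝓝 y₀, p (0, y) = y)
    (hV : ∀ᶠ y in 𝓝 y₀, HasDerivAt (fun t => p (t, y)) (V y) 0)
    (hB : DifferentiableAt ℝ B y₀) (u w : F) :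
    HasDerivAt (fun t : ℝ => B (p (t, y₀)) (fderiv ℝ p (t, y₀) ((0 : ℝ), u))
      (fderiv ℝ p (t, y₀) ((0 : ℝ), w))) (lieForm B V y₀ u w) 0 := by
  have h0 : p (0, y₀) = y₀ := hp0.self_of_nhds
  have h1 : HasFDerivAt B (fderiv ℝ B y₀) (p (0, y₀)) := by
    rw [h0]
    exact hB.hasFDerivAt
  have h2 : ∀ z : F, fderiv ℝ p (0, y₀) ((0 : ℝ), z) = z := by
    intro z
    have h3 : HasFDerivAt (fun y : F => ((0 : ℝ), y)) (ContinuousLinearMap.inr ℝ ℝ F) y₀ :=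
      hasFDerivAt_prodMk_right 0 y₀
    have h4 : HasFDerivAt (fun y : F => p (0, y))
        ((fderiv ℝ p (0, y₀)).comp (ContinuousLinearMap.inr ℝ ℝ F)) y₀ :=
      HasFDerivAt.comp (f := fun y : F => ((0 : ℝ), y)) y₀
        (hp.differentiableAt two_ne_zero).hasFDerivAt h3
    have h5 : HasFDerivAt (fun y : F => p (0, y)) (ContinuousLinearMap.id ℝ F) y₀ :=
      (hasFDerivAt_id y₀).congr_of_eventuallyEq hp0
    exact congrArg (fun A : F →L[ℝ] F => A z) (h4.unique h5)
  have hBt : HasDerivAt (fun t : ℝ => B (p (t, y₀))) (fderiv ℝ B y₀ (V y₀)) 0 :=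
    HasFDerivAt.comp_hasDerivAt (E := F →L[ℝ] F →L[ℝ] ℝ) (l := B)
      (f := fun t : ℝ => p (t, y₀)) (0 : ℝ) h1 hV.self_of_nhds
  have h6 := hasDerivAt_bilin_apply hBt (hasDerivAt_fderiv_flow hp hV u)
    (hasDerivAt_fderiv_flow hp hV w)
  rw [h0, h2, h2] at h6
  exact h6

variable {H : Type*} [TopologicalSpace H] (I : ModelWithCorners ℝ F H)
  {M : Type*} [TopologicalSpace M] [ChartedSpace H M]
  [I.Boundaryless] [IsManifold I ∞ M]

lemma formCoord_chartDeriv {G : Type*} [NormedAddCommGroup G] [NormedSpace ℝ G]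
    (β : ∀ m : M, TangentSpace I m →L[ℝ] TangentSpace I m →L[ℝ] G)
    {x₀ q : M} (hq : q ∈ (extChartAt I x₀).source) (X Y : TangentSpace I q) :
    formCoord I β x₀ (extChartAt I x₀ q) (chartDeriv I x₀ q X) (chartDeriv I x₀ q Y)
      = β q X Y := by
  obtain ⟨y, hy, rfl⟩ : ∃ y ∈ (extChartAt I x₀).target, q = (extChartAt I x₀).symm y :=
    ⟨_, (extChartAt I x₀).map_source hq, ((extChartAt I x₀).left_inv hq).symm⟩
  rw [(extChartAt I x₀).right_inv hy, formCoord_apply, chartSymmDeriv_chartDeriv I hy,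
    chartSymmDeriv_chartDeriv I hy]

/-- The pull-back `f^*β` at `m`, evaluated on `X` and `Y`. -/
def pullbackForm (β : ∀ m : M, TangentSpace I m →L[ℝ] TangentSpace I m →L[ℝ] ℝ) (f : M → M) (m : M)
    (X Y : TangentSpace I m) : ℝ :=
  β (f m) (mfderiv I I f m X) (mfderiv I I f m Y)

lemma pullbackForm_id (β : ∀ m : M, TangentSpace I m →L[ℝ] TangentSpace I m →L[ℝ] ℝ) (m : M)
    (X Y : TangentSpace I m) : pullbackForm I β id m X Y = β m X Y := by
  unfold pullbackForm
  rw [mfderiv_id]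
  rfl

lemma pullbackForm_comp (β : ∀ m : M, TangentSpace I m →L[ℝ] TangentSpace I m →L[ℝ] ℝ)
    {f h : M → M} {m : M} (hf : MDifferentiableAt I I f (h m)) (hh : MDifferentiableAt I I h m)
    (X Y : TangentSpace I m) : pullbackForm I β (f ∘ h) m X Y
      = pullbackForm I β f (h m) (mfderiv I I h m X) (mfderiv I I h m Y) := by
  unfold pullbackForm
  rw [mfderiv_comp m hf hh]
  rfl

variable {v : ∀ m : M, TangentSpace I m} {P : ℝ → M → M}

/-- The derivative at time `0` of the pull-backs of a form by a flow is its Lie derivative. -/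
lemma hasDerivAt_pullback_form
    {β : ∀ m : M, TangentSpace I m →L[ℝ] TangentSpace I m →L[ℝ] ℝ}
    (hP : ContMDiff (𝓘(ℝ, ℝ).prod I) I ∞ (fun p : ℝ × M => P p.1 p.2)) (hP0 : ∀ m, P 0 m = m)
    (hv : ∀ m, IsMIntegralCurve (fun t => P t m) v) (m : M)
    (hβ : DifferentiableAt ℝ (formCoord I β m) (extChartAt I m m)) (X Y : TangentSpace I m) :
    HasDerivAt (fun t => pullbackForm I β (P t) m X Y)
      (lieForm (formCoord I β m) (vecCoord I v m) (extChartAt I m m)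
        (chartDeriv I m m X) (chartDeriv I m m Y)) 0 := by
  have hy := mem_extChartAt_target (I := I) m
  have hT := extChartAt_target_mem I hy
  have hm := mem_extChartAt_source (I := I) m
  set p := flowCoord I P m
  have hsm : ContDiffAt ℝ ∞ p (0, extChartAt I m m) := contDiffAt_flowCoord hP hP0 hy
  have hp0 : ∀ᶠ y in 𝓝 (extChartAt I m m), p (0, y) = y := by
    filter_upwards [hT] with y hy
    exact flowCoord_zero hP0 hy
  have hV : ∀ᶠ y in 𝓝 (extChartAt I m m),
      HasDerivAt (fun t => p (t, y)) (vecCoord I v m y) 0 := by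
    filter_upwards [hT] with y hy
    exact hasDerivAt_flowCoord hP0 (fun m => hv m 0) hy
  have key := hasDerivAt_pullback (hsm.of_le (WithTop.coe_le_coe.2 le_top)) hp0 hV hβ
    (chartDeriv I m m X) (chartDeriv I m m Y)
  refine key.congr_of_eventuallyEq ?_
  have hc : Continuous (fun t => P t m) := (hv m).continuous
  have hsrc : ∀ᶠ t in 𝓝 (0 : ℝ), P t m ∈ (extChartAt I m).source := by
    refine hc.continuousAt.eventually_mem ?_
    rw [hP0]
    exact extChartAt_source_mem_nhds m
  have hdiff : ∀ᶠ t in 𝓝 (0 : ℝ), DifferentiableAt ℝ p (t, extChartAt I m m) := by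
    have h1 : ∀ᶠ q in 𝓝 ((0 : ℝ), extChartAt I m m), DifferentiableAt ℝ p q :=
      ((hsm.of_le (by simp) : ContDiffAt ℝ 1 p _).eventually (by simp)).mono
        fun q hq => hq.differentiableAt (by simp)
    have h2 : Filter.Tendsto (fun t : ℝ => (t, extChartAt I m m)) (𝓝 0)
        (𝓝 (0, extChartAt I m m)) := (Continuous.prodMk_left _).tendsto 0
    exact h2.eventually h1
  filter_upwards [hsrc, hdiff] with t ht ht'
  have h1 : ∀ Z : TangentSpace I m, fderiv ℝ p (t, extChartAt I m m) (0, chartDeriv I m m Z)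
      = chartDeriv I m (P t m) (mfderiv I I (P t) m Z) := by
    intro Z
    have h2 := (mdifferentiableAt_extChartAt' I ht).hasMFDerivAt.comp m
      ((contMDiff_of_uncurry hP t).mdifferentiableAt (by simp)).hasMFDerivAt
    have h3 : HasFDerivAt (fun y : F => p (t, y)) ((fderiv ℝ p (t, extChartAt I m m)).comp
        (ContinuousLinearMap.inr ℝ ℝ F)) (extChartAt I m m) :=
      HasFDerivAt.comp (extChartAt I m m) ht'.hasFDerivAt
        (hasFDerivAt_prodMk_right t (extChartAt I m m))
    have h4 := h3.hasMFDerivAt.comp m (mdifferentiableAt_extChartAt' I hm).hasMFDerivAt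
    have h5 : (fun y : F => p (t, y)) ∘ extChartAt I m =ᶠ[𝓝 m] extChartAt I m ∘ P t := by
      filter_upwards [extChartAt_source_mem_nhds (I := I) m] with q hq
      simp only [p, flowCoord, Function.comp_apply, (extChartAt I m).left_inv hq]
    have h6 := hasMFDerivAt_unique (h4.congr_of_eventuallyEq h5.symm) h2
    exact congrArg (fun A : TangentSpace I m →L[ℝ] F => A Z) h6
  have h7 : p (t, extChartAt I m m) = extChartAt I m (P t m) := by
    simp only [p, flowCoord, (extChartAt I m).left_inv hm]
  rw [h1, h1, h7, formCoord_chartDeriv I β ht]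
  rfl

/-- A form which is rescaled by a flow, with exponential weight `c`, is rescaled by its generator. -/
lemma lieForm_eq_of_pullbackForm_eq
    {β : ∀ m : M, TangentSpace I m →L[ℝ] TangentSpace I m →L[ℝ] ℝ} {c : ℝ}
    (hP : ContMDiff (𝓘(ℝ, ℝ).prod I) I ∞ (fun p : ℝ × M => P p.1 p.2)) (hP0 : ∀ m, P 0 m = m)
    (hv : ∀ m, IsMIntegralCurve (fun t => P t m) v) (m : M)
    (hβ : DifferentiableAt ℝ (formCoord I β m) (extChartAt I m m))
    (hinv : ∀ t (X Y : TangentSpace I m),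
      pullbackForm I β (P t) m X Y = Real.exp (c * t) * β m X Y) (u w : F) :
    lieForm (formCoord I β m) (vecCoord I v m) (extChartAt I m m) u w
      = c * formCoord I β m (extChartAt I m m) u w := by
  have hm := mem_extChartAt_target (I := I) m
  have key : ∀ X Y : TangentSpace I m,
      lieForm (formCoord I β m) (vecCoord I v m) (extChartAt I m m)
        (chartDeriv I m m X) (chartDeriv I m m Y)
        = c * formCoord I β m (extChartAt I m m) (chartDeriv I m m X) (chartDeriv I m m Y) := by
    intro X Y
    have h := hasDerivAt_pullback_form I hP hP0 hv m hβ X Y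
    have h1 : HasDerivAt (fun t => Real.exp (c * t) * β m X Y)
        (Real.exp (c * 0) * (c * 1) * β m X Y) 0 :=
      (((hasDerivAt_id (0 : ℝ)).const_mul c).exp).mul_const _
    rw [show (fun t => pullbackForm I β (P t) m X Y) = fun t => Real.exp (c * t) * β m X Y from
      funext fun t => hinv t X Y] at h
    rw [h.unique h1, formCoord_chartDeriv I β (mem_extChartAt_source m), mul_zero, Real.exp_zero,
      one_mul, mul_one]
  have h := key (u : F) (w : F)
  have hu : chartDeriv I m m (u : F) = u := chartDeriv_self I m u
  have hw : chartDeriv I m m (w : F) = w := chartDeriv_self I m w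
  have h1 := congrArg₂ (lieForm (formCoord I β m) (vecCoord I v m) (extChartAt I m m)) hu hw
  have h2 := congrArg₂ (fun u w => c * formCoord I β m (extChartAt I m m) u w) hu hw
  exact h1.symm.trans (h.trans h2)

/-- A form which is rescaled by the generator of a flow is rescaled by the flow. -/
lemma pullbackForm_eq_of_lieForm_eq
    {β : ∀ m : M, TangentSpace I m →L[ℝ] TangentSpace I m →L[ℝ] ℝ} {c : ℝ}
    (hP : ContMDiff (𝓘(ℝ, ℝ).prod I) I ∞ (fun p : ℝ × M => P p.1 p.2)) (hP0 : ∀ m, P 0 m = m)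
    (hadd : ∀ s t m, P (s + t) m = P s (P t m))
    (hv : ∀ m, IsMIntegralCurve (fun t => P t m) v)
    (hβ : ∀ m, DifferentiableAt ℝ (formCoord I β m) (extChartAt I m m))
    (hlie : ∀ m u w, lieForm (formCoord I β m) (vecCoord I v m) (extChartAt I m m) u w
      = c * formCoord I β m (extChartAt I m m) u w)
    (t : ℝ) (m : M) (X Y : TangentSpace I m) :
    pullbackForm I β (P t) m X Y = Real.exp (c * t) * β m X Y := by
  have hPt := contMDiff_of_uncurry hP
  have hd : ∀ t₀, HasDerivAt (fun t => pullbackForm I β (P t) m X Y)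
      (c * pullbackForm I β (P t₀) m X Y) t₀ := by
    intro t₀
    have h1 := hasDerivAt_pullback_form I hP hP0 hv (P t₀ m) (hβ _)
      (mfderiv I I (P t₀) m X) (mfderiv I I (P t₀) m Y)
    rw [hlie, formCoord_chartDeriv I β (mem_extChartAt_source (P t₀ m))] at h1
    have h3 : ∀ s, pullbackForm I β (P s) (P t₀ m) (mfderiv I I (P t₀) m X)
        (mfderiv I I (P t₀) m Y) = pullbackForm I β (P (s + t₀)) m X Y := by
      intro s
      rw [show P (s + t₀) = P s ∘ P t₀ from funext fun m => hadd s t₀ m,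
        pullbackForm_comp I β ((hPt s).mdifferentiableAt (by simp))
          ((hPt t₀).mdifferentiableAt (by simp))]
    simp only [h3] at h1
    have h4 : HasDerivAt (fun s => pullbackForm I β (P (s + t₀)) m X Y)
        (c * pullbackForm I β (P t₀) m X Y) (t₀ - t₀) := by
      rw [sub_self]
      exact h1
    have h5 := h4.comp_sub_const t₀ t₀
    simpa only [sub_add_cancel] using h5
  -- `exp(-ct)` times the pull-back has derivative zero
  have hd' : ∀ t₀, HasDerivAt (fun t => Real.exp (-c * t) * pullbackForm I β (P t) m X Y) 0 t₀ := by
    intro t₀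
    refine ((((hasDerivAt_id t₀).const_mul (-c)).exp).mul (hd t₀)).congr_deriv ?_
    simp only [id]
    ring
  have hc := is_const_of_deriv_eq_zero (fun t => (hd' t).differentiableAt)
    (fun t => (hd' t).deriv) t 0
  beta_reduce at hc
  rw [show P 0 = id from funext hP0, pullbackForm_id, mul_zero, Real.exp_zero, one_mul] at hc
  rw [← hc, ← mul_assoc, ← Real.exp_add]
  simp

end LieDerivative

/-! ### Actions of the real line and their generators -/

section Generators

set_option linter.unusedSectionVars false

variable {F : Type*} [NormedAddCommGroup F] [NormedSpace ℝ F]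
  {H : Type*} [TopologicalSpace H] {I : ModelWithCorners ℝ F H}
  {M : Type*} [TopologicalSpace M] [ChartedSpace H M]
  [I.Boundaryless] [IsManifold I ∞ M]
  {v : ∀ m : M, TangentSpace I m} {P : ℝ → M → M}

/-- The generator of a smooth `ℝ`-action is a smooth vector field. -/
lemma isSmoothVectorField_of_flow
    (hP : ContMDiff (𝓘(ℝ, ℝ).prod I) I ∞ (fun p : ℝ × M => P p.1 p.2)) (hP0 : ∀ m, P 0 m = m)
    (hv : ∀ m, HasMFDerivAt 𝓘(ℝ, ℝ) I (fun t => P t m) 0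
      ((1 : ℝ →L[ℝ] ℝ).smulRight (v (P 0 m)))) : IsSmoothVectorField I v := by
  refine isSmoothVectorField_of_vecCoord I fun m => ?_
  have hm := mem_extChartAt_target (I := I) m
  have h1 : ContDiffAt ℝ ∞ (fun y : F => fderiv ℝ (flowCoord I P m) (0, y) ((1 : ℝ), (0 : F)))
      (extChartAt I m m) := by
    have h2 := (contDiffAt_flowCoord hP hP0 hm).fderiv_right (m := ∞) (by simp)
    have h3 : ContDiffAt ℝ ∞ (fun y : F => ((0 : ℝ), y)) (extChartAt I m m) :=
      contDiffAt_const.prodMk contDiffAt_id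
    exact (ContDiffAt.comp (g := fderiv ℝ (flowCoord I P m)) (f := fun y : F => ((0 : ℝ), y))
      (extChartAt I m m) h2 h3).clm_apply contDiffAt_const
  refine h1.congr_of_eventuallyEq ?_
  filter_upwards [extChartAt_target_mem I hm] with y hy
  have h7 : HasDerivAt (fun t : ℝ => (t, y)) ((1 : ℝ), (0 : F)) 0 :=
    (hasDerivAt_id 0).prodMk (hasDerivAt_const 0 y)
  have h8 : HasFDerivAt (flowCoord I P m) (fderiv ℝ (flowCoord I P m) (0, y)) (0, y) :=
    ((contDiffAt_flowCoord hP hP0 hy).differentiableAt (by simp)).hasFDerivAt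
  exact (hasDerivAt_flowCoord hP0 hv hy).unique
    (HasFDerivAt.comp_hasDerivAt (f := fun t : ℝ => (t, y)) (0 : ℝ) h8 h7)

/-- The orbits of an `ℝ`-action are integral curves of its generator. -/
lemma isMIntegralCurve_of_flow (hadd : ∀ s t m, P (s + t) m = P s (P t m))
    (hP0 : ∀ m, P 0 m = m)
    (hv : ∀ m, HasMFDerivAt 𝓘(ℝ, ℝ) I (fun t => P t m) 0
      ((1 : ℝ →L[ℝ] ℝ).smulRight (v (P 0 m)))) (m : M) :
    IsMIntegralCurve (fun t => P t m) v := by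
  intro t₀
  have h1 : HasMFDerivAt 𝓘(ℝ, ℝ) 𝓘(ℝ, ℝ) (fun t : ℝ => t - t₀) t₀ (ContinuousLinearMap.id ℝ ℝ) :=
    ((hasFDerivAt_id t₀).sub_const t₀).hasMFDerivAt
  have h2 : HasMFDerivAt 𝓘(ℝ, ℝ) I (fun t => P t (P t₀ m)) (t₀ - t₀)
      ((1 : ℝ →L[ℝ] ℝ).smulRight (v (P t₀ m))) := by
    rw [sub_self]
    have := hv (P t₀ m)
    rwa [hP0] at this
  have h3 := HasMFDerivAt.comp (g := fun t => P t (P t₀ m)) (f := fun t : ℝ => t - t₀) t₀ h2 h1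
  have h4 : (fun t => P t (P t₀ m)) ∘ (fun t : ℝ => t - t₀) = fun t => P t m := by
    ext t
    simp only [Function.comp_apply, ← hadd, sub_add_cancel]
  rw [h4] at h3
  exact h3

/-- If the vector field `w` is invariant under a flow with generator `v`, then `[v, w] = 0`, in
coordinates. -/
lemma fderiv_vecCoord_eq_of_invariant {w : ∀ m : M, TangentSpace I m}
    (hP : ContMDiff (𝓘(ℝ, ℝ).prod I) I ∞ (fun p : ℝ × M => P p.1 p.2)) (hP0 : ∀ m, P 0 m = m)
    (hv : ∀ m, HasMFDerivAt 𝓘(ℝ, ℝ) I (fun t => P t m) 0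
      ((1 : ℝ →L[ℝ] ℝ).smulRight (v (P 0 m)))) (hw : IsSmoothVectorField I w)
    (h : ∀ t m, mfderiv I I (P t) m (w m) = w (P t m)) {m : M} {y : F}
    (hy : y ∈ (extChartAt I m).target) :
    fderiv ℝ (vecCoord I v m) y (vecCoord I w m y)
      = fderiv ℝ (vecCoord I w m) y (vecCoord I v m y) := by
  have hp := contDiffAt_flowCoord hP hP0 hy
  have hV : ∀ᶠ z in 𝓝 y, HasDerivAt (fun t => flowCoord I P m (t, z)) (vecCoord I v m z) 0 := by
    filter_upwards [extChartAt_target_mem I hy] with z hz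
    exact hasDerivAt_flowCoord hP0 hv hz
  have h1 := hasDerivAt_fderiv_flow (hp.of_le (WithTop.coe_le_coe.2 le_top)) hV (vecCoord I w m y)
  have hwd : HasFDerivAt (vecCoord I w m) (fderiv ℝ (vecCoord I w m) y)
      (flowCoord I P m (0, y)) := by
    rw [flowCoord_zero hP0 hy]
    exact (((contDiffOn_vecCoord I hw m).contDiffAt (extChartAt_target_mem I hy)).differentiableAt
      (by simp)).hasFDerivAt
  have h2 : HasDerivAt (fun t => vecCoord I w m (flowCoord I P m (t, y)))
      (fderiv ℝ (vecCoord I w m) y (vecCoord I v m y)) 0 :=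
    HasFDerivAt.comp_hasDerivAt (f := fun t : ℝ => flowCoord I P m (t, y)) (0 : ℝ) hwd
      hV.self_of_nhds
  refine h1.unique (h2.congr_of_eventuallyEq ?_)
  set q := (extChartAt I m).symm y with hq
  have hqs : q ∈ (extChartAt I m).source := (extChartAt I m).map_target hy
  have hc : ContinuousAt (fun t => P t q) 0 := (hv q).continuousAt
  have hsrc : ∀ᶠ t in 𝓝 (0 : ℝ), P t q ∈ (extChartAt I m).source := by
    refine hc.eventually_mem ?_
    rw [hP0]
    exact extChartAt_source_mem_nhds' hqs
  have hdiff : ∀ᶠ t in 𝓝 (0 : ℝ), DifferentiableAt ℝ (flowCoord I P m) (t, y) := by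
    have h3 : ∀ᶠ p in 𝓝 ((0 : ℝ), y), DifferentiableAt ℝ (flowCoord I P m) p :=
      ((hp.of_le (WithTop.coe_le_coe.2 le_top) : ContDiffAt ℝ 1 _ _).eventually (by simp)).mono
        fun p hp => hp.differentiableAt (by simp)
    have h4 : Filter.Tendsto (fun t : ℝ => (t, y)) (𝓝 0) (𝓝 (0, y)) :=
      (Continuous.prodMk_left _).tendsto 0
    exact h4.eventually h3
  filter_upwards [hsrc, hdiff] with t ht ht'
  have h3 : HasFDerivAt (fun z : F => flowCoord I P m (t, z))
      ((fderiv ℝ (flowCoord I P m) (t, y)).comp (ContinuousLinearMap.inr ℝ ℝ F)) y :=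
    HasFDerivAt.comp (f := fun z : F => (t, z)) y ht'.hasFDerivAt (hasFDerivAt_prodMk_right t y)
  have h4 := (mdifferentiableAt_extChartAt' I ht).hasMFDerivAt.comp y
    ((((contMDiff_of_uncurry hP t).mdifferentiableAt (by simp)).hasMFDerivAt).comp y
      (mdifferentiableAt_extChartAt_symm I hy).hasMFDerivAt)
  have h5 : HasFDerivAt (fun z : F => flowCoord I P m (t, z))
      ((chartDeriv I m (P t q)).comp ((mfderiv I I (P t) q).comp (chartSymmDeriv I m y))) y :=
    hasMFDerivAt_iff_hasFDerivAt.1 h4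
  have h6 := congrArg (fun A : F →L[ℝ] F => A (vecCoord I w m y)) (h3.unique h5)
  have h7 : chartDeriv I m (P t q) (mfderiv I I (P t) q (chartSymmDeriv I m y (vecCoord I w m y)))
      = vecCoord I w m (flowCoord I P m (t, y)) := by
    rw [chartSymmDeriv_vecCoord I hy, h t]
    unfold vecCoord flowCoord
    rw [(extChartAt I m).left_inv ht]
  exact h6.trans h7

end Generators

/-! ### Diffeomorphisms and transport of complex structures -/

section Diffeomorphisms

set_option linter.unusedSectionVars false

variable {F : Type*} [NormedAddCommGroup F] [NormedSpace ℝ F]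
  {H : Type*} [TopologicalSpace H] {I : ModelWithCorners ℝ F H}
  {M : Type*} [TopologicalSpace M] [ChartedSpace H M]
  [I.Boundaryless] [IsManifold I ∞ M]

lemma mfderiv_apply_of_eq_id {f : M → M} (hf : f = id) (m : M) (X : TangentSpace I m) :
    (mfderiv I I f m X : F) = X := by
  rw [hf, mfderiv_id]
  rfl

lemma mfderiv_injective_of_leftInverse {f h : M → M} (hfh : Function.LeftInverse f h)
    (hf : MDifferentiable I I f) (hh : MDifferentiable I I h) (m : M) :
    Function.Injective (mfderiv I I h m) := by
  have key : ∀ X : TangentSpace I m, (mfderiv I I f (h m) (mfderiv I I h m X) : F) = X := by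
    intro X
    have h1 := mfderiv_apply_of_eq_id (I := I) (f := f ∘ h) (funext hfh) m X
    rw [mfderiv_comp m (hf _) (hh _)] at h1
    exact h1
  intro X Y hXY
  have h1 := key X
  rw [hXY] at h1
  exact h1.symm.trans (key Y)

variable [FiniteDimensional ℝ F]

lemma isInvertible_of_injective {A : F →L[ℝ] F} (hA : Function.Injective A) : A.IsInvertible :=
  ⟨(LinearEquiv.ofInjectiveEndo (A : F →ₗ[ℝ] F) hA).toContinuousLinearEquiv, by ext; rfl⟩

/-- A smooth bijection with injective differentials is a diffeomorphism. -/
theorem contMDiff_of_mfderiv_injective {Φ Ψ : M → M} (hΦ : ContMDiff I I ∞ Φ)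
    (hl : Function.LeftInverse Ψ Φ) (hr : Function.RightInverse Ψ Φ)
    (hinj : ∀ m, Function.Injective (mfderiv I I Φ m)) : ContMDiff I I ∞ Ψ := by
  intro q
  obtain ⟨m, rfl⟩ : ∃ m, Φ m = q := ⟨Ψ q, hr q⟩
  have hm := mem_extChartAt_target (I := I) m
  have hms := mem_extChartAt_source (I := I) m
  have hmq := mem_extChartAt_source (I := I) (Φ m)
  set y := extChartAt I m m with hy
  let G : F → F := fun z => extChartAt I (Φ m) (Φ ((extChartAt I m).symm z))
  have hsymm : (extChartAt I m).symm y = m := (extChartAt I m).left_inv hms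
  have hGsm : ContDiffAt ℝ ∞ G y := by
    have h1 : ContMDiffAt 𝓘(ℝ, F) I ∞ (extChartAt I m).symm y :=
      (contMDiffOn_extChartAt_symm m).contMDiffAt (extChartAt_target_mem I hm)
    have h2 : ContMDiffAt I 𝓘(ℝ, F) ∞ (extChartAt I (Φ m)) (Φ ((extChartAt I m).symm y)) := by
      rw [hsymm]
      exact contMDiffAt_extChartAt
    exact (ContMDiffAt.comp (g := extChartAt I (Φ m)) (f := Φ ∘ (extChartAt I m).symm) y h2
      (hΦ.contMDiffAt.comp y h1)).contDiffAt
  have hGd : ∃ A : F →L[ℝ] F, HasFDerivAt G A y ∧ Function.Injective A := by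
    have h1 : MDifferentiableAt I 𝓘(ℝ, F) (extChartAt I (Φ m)) (Φ ((extChartAt I m).symm y)) := by
      rw [hsymm]
      exact mdifferentiableAt_extChartAt' I hmq
    have h2 := h1.hasMFDerivAt.comp y
      ((hΦ.mdifferentiableAt (by simp)).hasMFDerivAt.comp y
        (mdifferentiableAt_extChartAt_symm I hm).hasMFDerivAt)
    have h3 : HasFDerivAt G ((chartDeriv I (Φ m) (Φ ((extChartAt I m).symm y))).comp
        ((mfderiv I I Φ ((extChartAt I m).symm y)).comp (chartSymmDeriv I m y))) y :=
      hasMFDerivAt_iff_hasFDerivAt.1 h2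
    refine ⟨_, h3, fun u w huw => ?_⟩
    have hcs : ∀ p, p = Φ m → Function.Injective (chartDeriv I (Φ m) p) := by
      rintro p rfl X Y hXY
      rwa [chartDeriv_self, chartDeriv_self] at hXY
    have h4 := hinj _ (hcs _ (by rw [hsymm]) huw)
    have h5 := congrArg (chartDeriv I m _) h4
    exact (chartDeriv_chartSymmDeriv I hm u).symm.trans
      (h5.trans (chartDeriv_chartSymmDeriv I hm w))
  obtain ⟨A, hA, hAinj⟩ := hGd
  obtain ⟨A', rfl⟩ := isInvertible_of_injective hAinj
  set L := hGsm.localInverse hA (by simp) with hL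
  have hLsm : ContDiffAt ℝ ∞ L (G y) := hGsm.to_localInverse hA (by simp)
  have hLy : L (G y) = y := hGsm.localInverse_apply_image hA (by simp)
  have hGy : G y = extChartAt I (Φ m) (Φ m) := by
    simp only [G, hsymm]
  have hright : ∀ᶠ z in 𝓝 (G y), G (L z) = z :=
    (hGsm.hasStrictFDerivAt' hA (by simp)).eventually_right_inverse
  -- in coordinates, the inverse is the local inverse
  have hsm : ContMDiffAt I I ∞ (fun p => (extChartAt I m).symm (L (extChartAt I (Φ m) p))) (Φ m) := by
    have h1 : ContMDiffAt I 𝓘(ℝ, F) ∞ (extChartAt I (Φ m)) (Φ m) := contMDiffAt_extChartAt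
    rw [hGy] at hLsm hLy
    have h2 := ContMDiffAt.comp (g := L) (Φ m) hLsm.contMDiffAt h1
    have h3 : ContMDiffAt 𝓘(ℝ, F) I ∞ (extChartAt I m).symm (L (extChartAt I (Φ m) (Φ m))) := by
      rw [hLy]
      exact (contMDiffOn_extChartAt_symm m).contMDiffAt (extChartAt_target_mem I hm)
    exact ContMDiffAt.comp (g := (extChartAt I m).symm) (f := L ∘ extChartAt I (Φ m)) (Φ m) h3 h2
  refine hsm.congr_of_eventuallyEq ?_
  have hc : ContinuousAt (fun p => Φ ((extChartAt I m).symm (L (extChartAt I (Φ m) p)))) (Φ m) :=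
    ContinuousAt.comp (g := Φ) hΦ.continuous.continuousAt hsm.continuousAt
  have h0 : Φ ((extChartAt I m).symm (L (extChartAt I (Φ m) (Φ m)))) = Φ m := by
    rw [← hGy, hLy, hsymm]
  have hs : ∀ᶠ p in 𝓝 (Φ m), Φ ((extChartAt I m).symm (L (extChartAt I (Φ m) p)))
      ∈ (extChartAt I (Φ m)).source := by
    refine hc.eventually_mem ?_
    rw [h0]
    exact extChartAt_source_mem_nhds _
  have hr' : ∀ᶠ p in 𝓝 (Φ m), G (L (extChartAt I (Φ m) p)) = extChartAt I (Φ m) p := by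
    rw [hGy] at hright
    exact (continuousAt_extChartAt (I := I) (Φ m)).eventually hright
  filter_upwards [hs, hr', extChartAt_source_mem_nhds (I := I) (Φ m)] with p hp hp' hp''
  have h1 := (extChartAt I (Φ m)).injOn hp hp'' hp'
  rw [← h1, hl, h1]

lemma isSmoothVectorField_apply {J : ∀ m : M, TangentSpace I m →L[ℝ] TangentSpace I m}
    (hJ : IsSmoothEndomorphism I J) {X : ∀ m : M, TangentSpace I m}
    (hX : IsSmoothVectorField I X) : IsSmoothVectorField I (fun m => J m (X m)) := by
  refine isSmoothVectorField_of_vecCoord I fun m => ?_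
  have hT := extChartAt_target_mem I (mem_extChartAt_target (I := I) m)
  refine (((contDiffOn_endCoord I hJ m).contDiffAt hT).clm_apply
    ((contDiffOn_vecCoord I hX m).contDiffAt hT)).congr_of_eventuallyEq ?_
  filter_upwards [hT] with y hy
  exact vecCoord_apply_endo I hy J X

/-- The Lie brackets of related vector fields are related. -/
lemma mlieBracket_apply_of_related {Φ : M → M} (hΦ : ContMDiff I I ∞ Φ)
    (hinj : ∀ m, Function.Injective (mfderiv I I Φ m)) {X Y X' Y' : ∀ m : M, TangentSpace I m}
    (hX' : IsSmoothVectorField I X') (hY' : IsSmoothVectorField I Y')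
    (hX : ∀ m, X' (Φ m) = mfderiv I I Φ m (X m)) (hY : ∀ m, Y' (Φ m) = mfderiv I I Φ m (Y m))
    (m : M) : VectorField.mlieBracket I X' Y' (Φ m)
      = mfderiv I I Φ m (VectorField.mlieBracket I X Y m) := by
  have hinv : ∀ m, (mfderiv I I Φ m).IsInvertible := fun m =>
    isInvertible_of_injective (F := F) (hinj m)
  have hpull : ∀ Z Z' : ∀ m : M, TangentSpace I m, (∀ m, Z' (Φ m) = mfderiv I I Φ m (Z m)) →
      VectorField.mpullback I I Φ Z' = Z := by
    intro Z Z' h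
    ext1 m
    rw [VectorField.mpullback_apply, (hinv m).inverse_apply_eq, h]
  have : IsManifold I (minSmoothness ℝ 3) M := by
    rw [minSmoothness_of_isRCLikeNormedField]
    exact IsManifold.of_le (n := ∞) (WithTop.coe_le_coe.2 (le_top : (3 : ℕ∞) ≤ ⊤))
  have h := VectorField.mpullback_mlieBracket (n := ∞) (I := I) (I' := I) (f := Φ) (x₀ := m)
    (V := X') (W := Y')
    ((ContMDiff.mdifferentiable hX' (by simp)) _) ((ContMDiff.mdifferentiable hY' (by simp)) _)
    hΦ.contMDiffAt (by
      rw [minSmoothness_of_isRCLikeNormedField]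
      exact WithTop.coe_le_coe.2 (le_top : (2 : ℕ∞) ≤ ⊤))
  rw [hpull X X' hX, hpull Y Y' hY, VectorField.mpullback_apply, (hinv m).inverse_apply_eq] at h
  exact h

/-- The push-forward of a smooth vector field by a diffeomorphism is smooth. -/
lemma exists_isSmoothVectorField_related {Φ Ψ : M → M} (hΦ : ContMDiff I I ∞ Φ)
    (hΨ : ContMDiff I I ∞ Ψ) (hl : Function.LeftInverse Ψ Φ) (hr : Function.RightInverse Ψ Φ)
    {X : ∀ m : M, TangentSpace I m} (hX : IsSmoothVectorField I X) :
    ∃ X' : ∀ m : M, TangentSpace I m, IsSmoothVectorField I X' ∧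
      ∀ m, X' (Φ m) = mfderiv I I Φ m (X m) := by
  have hinv : ∀ q, (mfderiv I I Ψ q).IsInvertible := fun q => isInvertible_of_injective (F := F)
    (mfderiv_injective_of_leftInverse hr (hΦ.mdifferentiable (by simp))
      (hΨ.mdifferentiable (by simp)) q)
  refine ⟨VectorField.mpullback I I Ψ X, fun q => ?_, fun m => ?_⟩
  · exact ContMDiffAt.mpullback_vectorField_preimage (hX (Ψ q)) hΨ.contMDiffAt (hinv q) (by simp)
  · rw [VectorField.mpullback_apply, (hinv _).inverse_apply_eq]
    have h1 : ∀ f : M → M, f = id → X (f m) = mfderiv I I f m (X m) := by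
      rintro _ rfl
      rw [mfderiv_id]
      rfl
    have h2 := h1 (Ψ ∘ Φ) (funext hl)
    rw [mfderiv_comp m (hΨ.mdifferentiable (by simp) _) (hΦ.mdifferentiable (by simp) _)] at h2
    exact h2

/-- Integrability is transported by diffeomorphisms. -/
theorem nijenhuis_eq_zero_of_intertwines {Φ Ψ : M → M} (hΦ : ContMDiff I I ∞ Φ)
    (hΨ : ContMDiff I I ∞ Ψ) (hl : Function.LeftInverse Ψ Φ) (hr : Function.RightInverse Ψ Φ)
    {J J' : ∀ m : M, TangentSpace I m →L[ℝ] TangentSpace I m} (hJ' : IsComplexStructure I J')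
    (h : ∀ m X, mfderiv I I Φ m (J m X) = J' (Φ m) (mfderiv I I Φ m X))
    {X Y : ∀ m : M, TangentSpace I m} (hX : IsSmoothVectorField I X)
    (hY : IsSmoothVectorField I Y) (m : M) : nijenhuis I J X Y m = 0 := by
  have hinj : ∀ m, Function.Injective (mfderiv I I Φ m) := mfderiv_injective_of_leftInverse hl
    (hΨ.mdifferentiable (by simp)) (hΦ.mdifferentiable (by simp))
  obtain ⟨X', hX', hXX'⟩ := exists_isSmoothVectorField_related hΦ hΨ hl hr hX
  obtain ⟨Y', hY', hYY'⟩ := exists_isSmoothVectorField_related hΦ hΨ hl hr hY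
  have hJX : ∀ m, J' (Φ m) (X' (Φ m)) = mfderiv I I Φ m (J m (X m)) := fun m => by rw [h, hXX']
  have hJY : ∀ m, J' (Φ m) (Y' (Φ m)) = mfderiv I I Φ m (J m (Y m)) := fun m => by rw [h, hYY']
  have hJX' := isSmoothVectorField_apply hJ'.smooth hX'
  have hJY' := isSmoothVectorField_apply hJ'.smooth hY'
  have key := hJ'.integrable X' Y' hX' hY' (Φ m)
  unfold nijenhuis at key ⊢
  rw [mlieBracket_apply_of_related hΦ hinj hJX' hJY' (X := fun m => J m (X m))
      (Y := fun m => J m (Y m)) hJX hJY,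
    mlieBracket_apply_of_related hΦ hinj hJX' hY' (X := fun m => J m (X m)) hJX hYY',
    mlieBracket_apply_of_related hΦ hinj hX' hJY' (Y := fun m => J m (Y m)) hXX' hJY,
    mlieBracket_apply_of_related hΦ hinj hX' hY' hXX' hYY', ← h, ← h, ← map_sub, ← map_sub,
    ← map_sub] at key
  exact hinj m (key.trans (map_zero _).symm)

/-- The differential of `m ↦ P (f m) m`, where `P` is a flow with generator `v`. -/
lemma mfderiv_flow_comp {v : ∀ m : M, TangentSpace I m} {P : ℝ → M → M}
    (hP : ContMDiff (𝓘(ℝ, ℝ).prod I) I ∞ (fun p : ℝ × M => P p.1 p.2))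
    (hv : ∀ m, IsMIntegralCurve (fun t => P t m) v) {f : M → ℝ}
    (hf : MDifferentiable I 𝓘(ℝ, ℝ) f) (m : M) (X : TangentSpace I m) :
    mfderiv I I (fun m => P (f m) m) m X
      = mfderiv I I (P (f m)) m X + differential I f m X • v (P (f m) m) := by
  have hPd : MDifferentiableAt (𝓘(ℝ, ℝ).prod I) I (fun p : ℝ × M => P p.1 p.2) (f m, m) :=
    hP.mdifferentiableAt (by simp)
  have h1 := HasMFDerivAt.comp (f := fun m : M => (f m, m)) m hPd.hasMFDerivAt ((hf m).hasMFDerivAt.prodMk (hasMFDerivAt_id m))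
  have h2 := congrArg (fun A : F →L[ℝ] F => A X) h1.mfderiv
  have h3 := mfderiv_prod_eq_add_apply (v := ((differential I f m X, X) :
    TangentSpace (𝓘(ℝ, ℝ).prod I) (f m, m))) hPd
  have h4 : mfderiv 𝓘(ℝ, ℝ) I (fun z : ℝ => P z m) (f m) (differential I f m X)
      = differential I f m X • v (P (f m) m) := by
    rw [(hv m (f m)).mfderiv]
    rfl
  rw [add_comm, ← h4]
  exact h2.trans h3

end Diffeomorphisms

/-! ### Smooth forms, closed forms and Hamiltonian vector fields -/

section Forms

set_option linter.unusedSectionVars false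
set_option synthInstance.maxHeartbeats 200000

variable {F : Type*} [NormedAddCommGroup F] [NormedSpace ℝ F]

lemma fderiv_bilin_apply {G : Type*} [NormedAddCommGroup G] [NormedSpace ℝ G]
    {B : F → F →L[ℝ] F →L[ℝ] G} {y : F} (hB : DifferentiableAt ℝ B y) (u v w : F) :
    fderiv ℝ (fun z => B z v w) y u = fderiv ℝ B y u v w := by
  have h1 : HasFDerivAt (fun z => B z v) ((ContinuousLinearMap.apply ℝ (F →L[ℝ] G) v).comp
      (fderiv ℝ B y)) y :=
    HasFDerivAt.comp (f := B) y (ContinuousLinearMap.apply ℝ (F →L[ℝ] G) v).hasFDerivAt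
      hB.hasFDerivAt
  have h2 : HasFDerivAt (fun z => B z v w) ((ContinuousLinearMap.apply ℝ G w).comp
      ((ContinuousLinearMap.apply ℝ (F →L[ℝ] G) v).comp (fderiv ℝ B y))) y :=
    HasFDerivAt.comp (f := fun z => B z v) y (ContinuousLinearMap.apply ℝ G w).hasFDerivAt h1
  rw [h2.fderiv]
  rfl

/-- The derivative of `B(V, w)`, for a field of bilinear forms `B` and a vector field `V`. -/
lemma fderiv_bilin_contraction {B : F → F →L[ℝ] F →L[ℝ] ℝ} {V : F → F} {y : F}
    (hB : DifferentiableAt ℝ B y) (hV : DifferentiableAt ℝ V y) (u w : F) :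
    fderiv ℝ (fun z => B z (V z) w) y u = fderiv ℝ B y u (V y) w + B y (fderiv ℝ V y u) w := by
  have h1 : HasFDerivAt (fun z => B z (V z))
      ((B y).comp (fderiv ℝ V y) + (fderiv ℝ B y).flip (V y)) y :=
    HasFDerivAt.clm_apply (c := B) hB.hasFDerivAt hV.hasFDerivAt
  have h2 : HasFDerivAt (fun z => B z (V z) w) ((ContinuousLinearMap.apply ℝ ℝ w).comp
      ((B y).comp (fderiv ℝ V y) + (fderiv ℝ B y).flip (V y))) y :=
    HasFDerivAt.comp (f := fun z => B z (V z)) y (ContinuousLinearMap.apply ℝ ℝ w).hasFDerivAt h1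
  rw [h2.fderiv, add_comm]
  rfl

variable {H : Type*} [TopologicalSpace H] {I : ModelWithCorners ℝ F H}
  {M : Type*} [TopologicalSpace M] [ChartedSpace H M]

variable (I) in
/-- The bilinear form `β` is `C^∞` in the coordinates of every preferred chart. -/
def IsSmoothForm (β : ∀ m : M, TangentSpace I m →L[ℝ] TangentSpace I m →L[ℝ] ℝ) : Prop :=
  ∀ x₀ : M, ContDiffOn ℝ ∞ (formCoord I β x₀) (extChartAt I x₀).target

variable [I.Boundaryless] [IsManifold I ∞ M]
  {β : ∀ m : M, TangentSpace I m →L[ℝ] TangentSpace I m →L[ℝ] ℝ}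

lemma IsSmoothForm.contDiffAt (hβ : IsSmoothForm I β) {x₀ : M} {y : F}
    (hy : y ∈ (extChartAt I x₀).target) : ContDiffAt ℝ ∞ (formCoord I β x₀) y :=
  (hβ x₀).contDiffAt (extChartAt_target_mem I hy)

lemma IsSmoothForm.differentiableAt (hβ : IsSmoothForm I β) {x₀ : M} {y : F}
    (hy : y ∈ (extChartAt I x₀).target) : DifferentiableAt ℝ (formCoord I β x₀) y :=
  (hβ.contDiffAt hy).differentiableAt (by simp)

lemma IsSmoothVectorField.contDiffAt {X : ∀ m : M, TangentSpace I m}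
    (hX : IsSmoothVectorField I X) {x₀ : M} {y : F} (hy : y ∈ (extChartAt I x₀).target) :
    ContDiffAt ℝ ∞ (vecCoord I X x₀) y :=
  (contDiffOn_vecCoord I hX x₀).contDiffAt (extChartAt_target_mem I hy)

lemma IsSmoothVectorField.differentiableAt {X : ∀ m : M, TangentSpace I m}
    (hX : IsSmoothVectorField I X) {x₀ : M} {y : F} (hy : y ∈ (extChartAt I x₀).target) :
    DifferentiableAt ℝ (vecCoord I X x₀) y :=
  (hX.contDiffAt hy).differentiableAt (by simp)

lemma IsSmoothEndomorphism.contDiffAt {J : ∀ m : M, TangentSpace I m →L[ℝ] TangentSpace I m}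
    (hJ : IsSmoothEndomorphism I J) {x₀ : M} {y : F} (hy : y ∈ (extChartAt I x₀).target) :
    ContDiffAt ℝ ∞ (endCoord I J x₀) y :=
  (contDiffOn_endCoord I hJ x₀).contDiffAt (extChartAt_target_mem I hy)

lemma IsSmoothForm.kahlerForm {g : ∀ m : M, TangentSpace I m →L[ℝ] TangentSpace I m →L[ℝ] ℝ}
    (hg : IsSmoothForm I g) {J : ∀ m : M, TangentSpace I m →L[ℝ] TangentSpace I m}
    (hJ : IsSmoothEndomorphism I J) : IsSmoothForm I (kahlerForm I g J) := by
  intro x₀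
  refine ((hg x₀).clm_comp (contDiffOn_endCoord I hJ x₀)).congr fun y hy => ?_
  ext u w
  exact formCoord_kahlerForm I hy g J u w

/-- The contraction of a smooth form with two smooth vector fields is smooth. -/
lemma IsSmoothForm.contMDiff_apply (hβ : IsSmoothForm I β) {X Y : ∀ m : M, TangentSpace I m}
    (hX : IsSmoothVectorField I X) (hY : IsSmoothVectorField I Y) :
    ContMDiff I 𝓘(ℝ, ℝ) ∞ (fun m => β m (X m) (Y m)) := by
  intro m
  have hm := mem_extChartAt_target (I := I) m
  refine contMDiffAt_of_comp_extChartAt_symm I (n := ⊤) ?_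
  refine (((hβ.contDiffAt hm).clm_apply (hX.contDiffAt hm)).clm_apply
    (hY.contDiffAt hm)).congr_of_eventuallyEq ?_
  filter_upwards [extChartAt_target_mem I hm] with y hy
  exact (formCoord_vecCoord I hy β X Y).symm

lemma IsClosedTwoForm.fderiv_formCoord (h : IsClosedTwoForm I β) (hβ : IsSmoothForm I β)
    {x₀ : M} {y : F} (hy : y ∈ (extChartAt I x₀).target) (u v w : F) :
    fderiv ℝ (formCoord I β x₀) y u v w + fderiv ℝ (formCoord I β x₀) y v w u
      + fderiv ℝ (formCoord I β x₀) y w u v = 0 := by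
  have hd := hβ.differentiableAt hy
  have h1 := h x₀ y hy u v w
  simp only [coordForm_eq_formCoord] at h1
  rwa [fderiv_bilin_apply hd, fderiv_bilin_apply hd, fderiv_bilin_apply hd] at h1

lemma IsSmoothForm.fderiv_formCoord_eq_neg (hβ : IsSmoothForm I β)
    (hskew : ∀ m X Y, β m X Y = -β m Y X) {x₀ : M} {y : F} (hy : y ∈ (extChartAt I x₀).target)
    (u v w : F) : fderiv ℝ (formCoord I β x₀) y u v w = -fderiv ℝ (formCoord I β x₀) y u w v := by
  have hd := hβ.differentiableAt hy
  rw [← fderiv_bilin_apply hd, ← fderiv_bilin_apply hd]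
  have h1 : (fun z => formCoord I β x₀ z v w) = fun z => -formCoord I β x₀ z w v := by
    ext z
    exact hskew _ _ _
  rw [h1, fderiv_fun_neg]
  rfl

lemma IsSmoothForm.fderiv_formCoord_eq (hβ : IsSmoothForm I β)
    (hsymm : ∀ m X Y, β m X Y = β m Y X) {x₀ : M} {y : F} (hy : y ∈ (extChartAt I x₀).target)
    (u v w : F) : fderiv ℝ (formCoord I β x₀) y u v w = fderiv ℝ (formCoord I β x₀) y u w v := by
  have hd := hβ.differentiableAt hy
  rw [← fderiv_bilin_apply hd, ← fderiv_bilin_apply hd]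
  have h1 : (fun z => formCoord I β x₀ z v w) = fun z => formCoord I β x₀ z w v := by
    ext z
    exact hsymm _ _ _
  rw [h1]

lemma contDiffAt_comp_extChartAt_symm {f : M → ℝ} (hf : ContMDiff I 𝓘(ℝ, ℝ) ∞ f) {x₀ : M} {y : F}
    (hy : y ∈ (extChartAt I x₀).target) : ContDiffAt ℝ ∞ (f ∘ (extChartAt I x₀).symm) y :=
  (contDiffOn_comp_extChartAt_symm I hf.contMDiffOn).contDiffAt (extChartAt_target_mem I hy)

/-- The second derivative of a smooth function, in coordinates, is symmetric. -/
lemma fderiv_fderiv_comp_extChartAt_symm_comm {f : M → ℝ} (hf : ContMDiff I 𝓘(ℝ, ℝ) ∞ f) {x₀ : M}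
    {y : F} (hy : y ∈ (extChartAt I x₀).target) (u w : F) :
    fderiv ℝ (fun z => fderiv ℝ (f ∘ (extChartAt I x₀).symm) z w) y u
      = fderiv ℝ (fun z => fderiv ℝ (f ∘ (extChartAt I x₀).symm) z u) y w := by
  have h1 := contDiffAt_comp_extChartAt_symm hf hy
  have hd : DifferentiableAt ℝ (fderiv ℝ (f ∘ (extChartAt I x₀).symm)) y :=
    (h1.fderiv_right (m := ∞) (by simp)).differentiableAt (by simp)
  have h2 : ∀ u w : F, fderiv ℝ (fun z => fderiv ℝ (f ∘ (extChartAt I x₀).symm) z w) y u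
      = fderiv ℝ (fderiv ℝ (f ∘ (extChartAt I x₀).symm)) y u w := by
    intro u w
    have h3 : HasFDerivAt (fun z => fderiv ℝ (f ∘ (extChartAt I x₀).symm) z w)
        ((ContinuousLinearMap.apply ℝ ℝ w).comp
          (fderiv ℝ (fderiv ℝ (f ∘ (extChartAt I x₀).symm)) y)) y :=
      HasFDerivAt.comp (f := fderiv ℝ (f ∘ (extChartAt I x₀).symm)) y
        (ContinuousLinearMap.apply ℝ ℝ w).hasFDerivAt hd.hasFDerivAt
    rw [h3.fderiv]
    rfl
  rw [h2, h2]
  exact h1.isSymmSndFDerivAt (by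
    rw [minSmoothness_of_isRCLikeNormedField]
    exact WithTop.coe_le_coe.2 le_top) u w

/-- If `β(v, ·) = c df`, then the 1-form `β(v, ·)` is closed. -/
lemma fderiv_contraction_comm {v : ∀ m : M, TangentSpace I m} {f : M → ℝ} {c : ℝ}
    (hβ : IsSmoothForm I β) (hv : IsSmoothVectorField I v) (hf : ContMDiff I 𝓘(ℝ, ℝ) ∞ f)
    (h : ∀ m X, β m (v m) X = c * differential I f m X) {x₀ : M} {y : F}
    (hy : y ∈ (extChartAt I x₀).target) (u w : F) :
    fderiv ℝ (formCoord I β x₀) y u (vecCoord I v x₀ y) w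
        + formCoord I β x₀ y (fderiv ℝ (vecCoord I v x₀) y u) w
      = fderiv ℝ (formCoord I β x₀) y w (vecCoord I v x₀ y) u
        + formCoord I β x₀ y (fderiv ℝ (vecCoord I v x₀) y w) u := by
  have h1 : ∀ w : F, (fun z => formCoord I β x₀ z (vecCoord I v x₀ z) w)
      =ᶠ[𝓝 y] fun z => c * fderiv ℝ (f ∘ (extChartAt I x₀).symm) z w := by
    intro w
    filter_upwards [extChartAt_target_mem I hy] with z hz
    rw [formCoord_apply, chartSymmDeriv_vecCoord I hz, h,
      fderiv_comp_extChartAt_symm I hz (hf.mdifferentiableAt (by simp))]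
  have h2 : ∀ u w : F, fderiv ℝ (fun z => c * fderiv ℝ (f ∘ (extChartAt I x₀).symm) z w) y u
      = c * fderiv ℝ (fun z => fderiv ℝ (f ∘ (extChartAt I x₀).symm) z w) y u := by
    intro u w
    have hd : DifferentiableAt ℝ (fun z => fderiv ℝ (f ∘ (extChartAt I x₀).symm) z w) y :=
      (((contDiffAt_comp_extChartAt_symm hf hy).fderiv_right (m := ∞) (by simp)).clm_apply
        contDiffAt_const).differentiableAt (by simp)
    rw [fderiv_const_mul hd]
    rfl
  rw [← fderiv_bilin_contraction (hβ.differentiableAt hy) (hv.differentiableAt hy),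
    ← fderiv_bilin_contraction (hβ.differentiableAt hy) (hv.differentiableAt hy),
    (h1 w).fderiv_eq, (h1 u).fderiv_eq, h2, h2, fderiv_fderiv_comp_extChartAt_symm_comm hf hy]

/-- A Hamiltonian vector field preserves the symplectic form. -/
lemma lieForm_eq_zero_of_hamiltonian {v : ∀ m : M, TangentSpace I m} {f : M → ℝ} {c : ℝ}
    (hβ : IsSmoothForm I β) (hskew : ∀ m X Y, β m X Y = -β m Y X) (hclosed : IsClosedTwoForm I β)
    (hv : IsSmoothVectorField I v) (hf : ContMDiff I 𝓘(ℝ, ℝ) ∞ f)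
    (h : ∀ m X, β m (v m) X = c * differential I f m X) {x₀ : M} {y : F}
    (hy : y ∈ (extChartAt I x₀).target) (u w : F) :
    lieForm (formCoord I β x₀) (vecCoord I v x₀) y u w = 0 := by
  have h1 : ∀ u w, formCoord I β x₀ y u w = -formCoord I β x₀ y w u := fun _ _ => hskew _ _ _
  have h2 := hβ.fderiv_formCoord_eq_neg hskew hy
  have h3 := hclosed.fderiv_formCoord hβ hy
  have h4 := fderiv_contraction_comm hβ hv hf h hy
  unfold lieForm
  generalize formCoord I β x₀ = B at *
  generalize vecCoord I v x₀ = V at *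
  exact lie_eq_zero_of_contraction_closed (β := B y) (β' := fderiv ℝ B y) (v := V y)
    (v' := fderiv ℝ V y) h1 h2 h3 h4 u w

lemma fderiv_add_const_mul_mul_sub_mul {b p q r s : F → ℝ} {y : F} (hb : DifferentiableAt ℝ b y)
    (hp : DifferentiableAt ℝ p y) (hq : DifferentiableAt ℝ q y) (hr : DifferentiableAt ℝ r y)
    (hs : DifferentiableAt ℝ s y) (c : ℝ) (u : F) :
    fderiv ℝ (fun z => b z + c * (p z * q z - r z * s z)) y u
      = fderiv ℝ b y u + c * ((fderiv ℝ p y u * q y + p y * fderiv ℝ q y u)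
        - (fderiv ℝ r y u * s y + r y * fderiv ℝ s y u)) := by
  have h := hb.hasFDerivAt.add (((hp.hasFDerivAt.mul hq.hasFDerivAt).sub
    (hr.hasFDerivAt.mul hs.hasFDerivAt)).const_mul c)
  refine (congrArg (fun A : F →L[ℝ] ℝ => A u) h.fderiv).trans ?_
  simp only [add_apply, smul_apply, sub_apply, smul_eq_mul]
  ring

variable (I) in
/-- The form `df ∧ dh`. -/
def wedgeDifferential (f h : M → ℝ) (m : M) : TangentSpace I m →L[ℝ] TangentSpace I m →L[ℝ] ℝ :=
  (differential I f m).smulRight (differential I h m)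
    - (differential I h m).smulRight (differential I f m)

lemma coordForm_add_smul_wedgeDifferential {f h : M → ℝ} (hf : ContMDiff I 𝓘(ℝ, ℝ) ∞ f)
    (hh : ContMDiff I 𝓘(ℝ, ℝ) ∞ h) (c : ℝ) {x₀ : M} {z : F} (hz : z ∈ (extChartAt I x₀).target)
    (v w : F) : coordForm I (fun m => β m + c • wedgeDifferential I f h m) x₀ z v w
      = formCoord I β x₀ z v w
        + c * (fderiv ℝ (f ∘ (extChartAt I x₀).symm) z v * fderiv ℝ (h ∘ (extChartAt I x₀).symm) z w
          - fderiv ℝ (h ∘ (extChartAt I x₀).symm) z v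
            * fderiv ℝ (f ∘ (extChartAt I x₀).symm) z w) := by
  rw [fderiv_comp_extChartAt_symm I hz (hf.mdifferentiableAt (by simp)),
    fderiv_comp_extChartAt_symm I hz (hf.mdifferentiableAt (by simp)),
    fderiv_comp_extChartAt_symm I hz (hh.mdifferentiableAt (by simp)),
    fderiv_comp_extChartAt_symm I hz (hh.mdifferentiableAt (by simp))]
  rfl

/-- If `β` is closed, then so is `β + c df ∧ dh`. -/
lemma isClosedTwoForm_add_smul_wedgeDifferential (hβ : IsSmoothForm I β)
    (hclosed : IsClosedTwoForm I β) {f h : M → ℝ} (hf : ContMDiff I 𝓘(ℝ, ℝ) ∞ f)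
    (hh : ContMDiff I 𝓘(ℝ, ℝ) ∞ h) (c : ℝ) :
    IsClosedTwoForm I (fun m => β m + c • wedgeDifferential I f h m) := by
  intro x₀ y hy u v w
  have hd : ∀ {k : M → ℝ}, ContMDiff I 𝓘(ℝ, ℝ) ∞ k → ∀ w,
      DifferentiableAt ℝ (fun z => fderiv ℝ (k ∘ (extChartAt I x₀).symm) z w) y := fun hk w =>
    (((contDiffAt_comp_extChartAt_symm hk hy).fderiv_right (m := ∞) (by simp)).clm_apply
      contDiffAt_const).differentiableAt (by simp)
  have hb : ∀ v w, DifferentiableAt ℝ (fun z => formCoord I β x₀ z v w) y := fun v w =>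
    (((hβ.contDiffAt hy).clm_apply contDiffAt_const).clm_apply
      contDiffAt_const).differentiableAt (by simp)
  have h1 : ∀ v w, (fun z => coordForm I (fun m => β m + c • wedgeDifferential I f h m) x₀ z v w)
      =ᶠ[𝓝 y] fun z => formCoord I β x₀ z v w
        + c * (fderiv ℝ (f ∘ (extChartAt I x₀).symm) z v * fderiv ℝ (h ∘ (extChartAt I x₀).symm) z w
          - fderiv ℝ (h ∘ (extChartAt I x₀).symm) z v
            * fderiv ℝ (f ∘ (extChartAt I x₀).symm) z w) := fun v w => by
    filter_upwards [extChartAt_target_mem I hy] with z hz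
    exact coordForm_add_smul_wedgeDifferential hf hh c hz v w
  rw [(h1 v w).fderiv_eq, (h1 w u).fderiv_eq, (h1 u v).fderiv_eq,
    fderiv_add_const_mul_mul_sub_mul (hb v w) (hd hf v) (hd hh w) (hd hh v) (hd hf w),
    fderiv_add_const_mul_mul_sub_mul (hb w u) (hd hf w) (hd hh u) (hd hh w) (hd hf u),
    fderiv_add_const_mul_mul_sub_mul (hb u v) (hd hf u) (hd hh v) (hd hh u) (hd hf v),
    fderiv_bilin_apply (hβ.differentiableAt hy), fderiv_bilin_apply (hβ.differentiableAt hy),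
    fderiv_bilin_apply (hβ.differentiableAt hy),
    fderiv_fderiv_comp_extChartAt_symm_comm hf hy u v,
    fderiv_fderiv_comp_extChartAt_symm_comm hf hy v w,
    fderiv_fderiv_comp_extChartAt_symm_comm hf hy w u,
    fderiv_fderiv_comp_extChartAt_symm_comm hh hy u v,
    fderiv_fderiv_comp_extChartAt_symm_comm hh hy v w,
    fderiv_fderiv_comp_extChartAt_symm_comm hh hy w u]
  linear_combination hclosed.fderiv_formCoord hβ hy u v w

end Forms

/-! ### Linear algebra of hyperkähler structures -/

section Quaternionic

set_option linter.unusedSectionVars false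

variable {F : Type*} [NormedAddCommGroup F] [NormedSpace ℝ F]
  {H : Type*} [TopologicalSpace H] {I : ModelWithCorners ℝ F H}
  {M : Type*} [TopologicalSpace M] [ChartedSpace H M] [IsManifold I 1 M]
  {g : ∀ m : M, TangentSpace I m →L[ℝ] TangentSpace I m →L[ℝ] ℝ}
  {J : Fin 3 → ∀ m : M, TangentSpace I m →L[ℝ] TangentSpace I m}

namespace IsHyperkahler

lemma sq (h : IsHyperkahler I g J) (i : Fin 3) (m : M) (X : TangentSpace I m) :
    J i m (J i m X) = -X := (h.complex i).sq m X

lemma zero_one (h : IsHyperkahler I g J) (m : M) (X : TangentSpace I m) :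
    J 0 m (J 1 m X) = J 2 m X := by
  have q := h.quaternion m (J 2 m X)
  rwa [h.sq, map_neg, map_neg, neg_inj] at q

lemma one_two (h : IsHyperkahler I g J) (m : M) (X : TangentSpace I m) :
    J 1 m (J 2 m X) = J 0 m X := by
  have q := congrArg (J 0 m) (h.quaternion m X)
  rwa [h.sq, map_neg, neg_inj] at q

lemma one_zero (h : IsHyperkahler I g J) (m : M) (X : TangentSpace I m) :
    J 1 m (J 0 m X) = -J 2 m X := by
  rw [← h.one_two, h.sq]

lemma two_zero (h : IsHyperkahler I g J) (m : M) (X : TangentSpace I m) :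
    J 2 m (J 0 m X) = J 1 m X := by
  rw [← h.zero_one, h.one_zero, map_neg, ← h.zero_one, h.sq, neg_neg]

lemma skew (h : IsHyperkahler I g J) (i : Fin 3) (m : M) (X Y : TangentSpace I m) :
    g m (J i m X) Y = -g m X (J i m Y) := by
  have q := h.hermitian i m X (J i m Y)
  rw [h.sq, map_neg] at q
  linarith

end IsHyperkahler

/-- The generator `v = -J₀ T` of the real part of the complexified action. -/
def rotatedField (J : Fin 3 → ∀ m : M, TangentSpace I m →L[ℝ] TangentSpace I m)
    (T : ∀ m : M, TangentSpace I m) (m : M) : TangentSpace I m :=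
  -J 0 m (T m)

variable (I) in
/-- A hyperkähler structure `(g, J₀, J₁, J₂)` with a vector field `T` which is Hamiltonian for the
three symplectic forms, the functions `-xⱼ` being Hamiltonians: `dxⱼ = -ωⱼ(T, ·)`. -/
structure IsTriHamiltonian (g : ∀ m : M, TangentSpace I m →L[ℝ] TangentSpace I m →L[ℝ] ℝ)
    (J : Fin 3 → ∀ m : M, TangentSpace I m →L[ℝ] TangentSpace I m)
    (T : ∀ m : M, TangentSpace I m) (x : Fin 3 → M → ℝ) : Prop where
  hyperkahler : IsHyperkahler I g J
  smooth_metric : IsSmoothForm I g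
  symm : ∀ m X Y, g m X Y = g m Y X
  pos : ∀ m X, X ≠ 0 → 0 < g m X X
  smooth_field : IsSmoothVectorField I T
  smooth_moment : ∀ j, ContMDiff I 𝓘(ℝ, ℝ) ∞ (x j)
  moment : ∀ j m X, differential I (x j) m X = -g m (J j m (T m)) X

variable {T : ∀ m : M, TangentSpace I m} {x : Fin 3 → M → ℝ}

namespace IsTriHamiltonian

lemma kahlerForm_skew (h : IsTriHamiltonian I g J T x) (i : Fin 3) (m : M)
    (X Y : TangentSpace I m) : kahlerForm I g (J i) m X Y = -kahlerForm I g (J i) m Y X := by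
  change g m (J i m X) Y = -g m (J i m Y) X
  rw [h.hyperkahler.skew, h.symm]

lemma kahlerForm_one_zero (h : IsTriHamiltonian I g J T x) (m : M) (X Y : TangentSpace I m) :
    kahlerForm I g (J 1) m (J 0 m X) Y = -kahlerForm I g (J 2) m X Y := by
  change g m (J 1 m (J 0 m X)) Y = -g m (J 2 m X) Y
  rw [h.hyperkahler.one_zero, map_neg, neg_apply]

lemma kahlerForm_two_zero (h : IsTriHamiltonian I g J T x) (m : M) (X Y : TangentSpace I m) :
    kahlerForm I g (J 2) m (J 0 m X) Y = kahlerForm I g (J 1) m X Y := by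
  change g m (J 2 m (J 0 m X)) Y = g m (J 1 m X) Y
  rw [h.hyperkahler.two_zero]

lemma eq_zero_of_kahlerForm (h : IsTriHamiltonian I g J T x) (i : Fin 3) (m : M)
    (X : TangentSpace I m) (hX : ∀ Y, kahlerForm I g (J i) m X Y = 0) : X = 0 := by
  by_contra hne
  have h1 : g m (J i m X) (J i m X) = 0 := hX (J i m X)
  rw [h.hyperkahler.hermitian] at h1
  exact (h.pos m X hne).ne' h1

/-- `dx₀ = g(v, ·)`. -/
lemma differential_zero (h : IsTriHamiltonian I g J T x) (m : M) (X : TangentSpace I m) :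
    differential I (x 0) m X = g m (rotatedField J T m) X := by
  rw [h.moment, rotatedField, map_neg, neg_apply]

/-- `ω₁(v, ·) = -dx₂`. -/
lemma kahlerForm_one_rotatedField (h : IsTriHamiltonian I g J T x) (m : M)
    (X : TangentSpace I m) :
    kahlerForm I g (J 1) m (rotatedField J T m) X = -1 * differential I (x 2) m X := by
  rw [h.moment, rotatedField, map_neg, neg_apply, h.kahlerForm_one_zero]
  change - -g m (J 2 m (T m)) X = _
  ring

/-- `ω₂(v, ·) = dx₁`. -/
lemma kahlerForm_two_rotatedField (h : IsTriHamiltonian I g J T x) (m : M)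
    (X : TangentSpace I m) :
    kahlerForm I g (J 2) m (rotatedField J T m) X = 1 * differential I (x 1) m X := by
  rw [h.moment, rotatedField, map_neg, neg_apply, h.kahlerForm_two_zero, one_mul]
  rfl

lemma metric_nonneg (h : IsTriHamiltonian I g J T x) (m : M) (X : TangentSpace I m) :
    0 ≤ g m X X := by
  by_cases hX : X = 0
  · rw [hX, map_zero]
  · exact (h.pos m X hX).le

end IsTriHamiltonian

/-- The linear map `X ↦ X + a² dx₀(X) v`. Up to the flow of `v`, it is the differential of
`m ↦ φ (a² x₀(m)) m`. -/
def shear (J : Fin 3 → ∀ m : M, TangentSpace I m →L[ℝ] TangentSpace I m)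
    (T : ∀ m : M, TangentSpace I m) (x : Fin 3 → M → ℝ) (a : ℝ) (m : M) (X : TangentSpace I m) :
    TangentSpace I m :=
  X + (a ^ 2 * differential I (x 0) m X) • rotatedField J T m

namespace IsTriHamiltonian

/-- A shear is injective, because `dx₀(v) ≥ 0`. -/
lemma shear_eq_zero (h : IsTriHamiltonian I g J T x) (a : ℝ) (m : M) (X : TangentSpace I m)
    (hX : shear J T x a m X = 0) : X = 0 := by
  have h1 := congrArg (differential I (x 0) m) hX
  rw [shear, map_add, map_smul, map_zero, smul_eq_mul, h.differential_zero m (rotatedField J T m)]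
    at h1
  have h2 : differential I (x 0) m X = 0 := by
    have h3 : differential I (x 0) m X
        * (1 + a ^ 2 * g m (rotatedField J T m) (rotatedField J T m)) = 0 := by
      linear_combination h1
    have h4 := h.metric_nonneg m (rotatedField J T m)
    rcases mul_eq_zero.1 h3 with h5 | h5
    · exact h5
    · exact absurd h5 (by positivity)
  rwa [shear, h2, mul_zero, zero_smul, add_zero] at hX

lemma kahlerForm_one_shear (h : IsTriHamiltonian I g J T x) (a : ℝ) (m : M)
    (X Y : TangentSpace I m) :
    kahlerForm I g (J 1) m (shear J T x a m X) (shear J T x a m Y)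
      = deformedForm I g J x a 1 m X Y := by
  have h1 := h.kahlerForm_one_rotatedField m X
  have h2 := h.kahlerForm_one_rotatedField m Y
  have h3 := h.kahlerForm_skew 1 m X (rotatedField J T m)
  have h4 := h.kahlerForm_skew 1 m (rotatedField J T m) (rotatedField J T m)
  have h5 : deformedForm I g J x a 1 m X Y = kahlerForm I g (J 1) m X Y
      + a ^ 2 * (differential I (x 2) m X * differential I (x 0) m Y
        - differential I (x 0) m X * differential I (x 2) m Y) := rfl
  rw [h5, shear, shear]
  simp only [map_add, map_smul, add_apply, smul_apply, smul_eq_mul]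
  linear_combination a ^ 2 * differential I (x 0) m Y * (h3 - h1)
    + a ^ 2 * differential I (x 0) m X * h2
    + a ^ 2 * differential I (x 0) m X * (a ^ 2 * differential I (x 0) m Y) / 2 * h4

lemma kahlerForm_two_shear (h : IsTriHamiltonian I g J T x) (a : ℝ) (m : M)
    (X Y : TangentSpace I m) :
    kahlerForm I g (J 2) m (shear J T x a m X) (shear J T x a m Y)
      = deformedForm I g J x a 2 m X Y := by
  have h1 := h.kahlerForm_two_rotatedField m X
  have h2 := h.kahlerForm_two_rotatedField m Y
  have h3 := h.kahlerForm_skew 2 m X (rotatedField J T m)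
  have h4 := h.kahlerForm_skew 2 m (rotatedField J T m) (rotatedField J T m)
  have h5 : deformedForm I g J x a 2 m X Y = kahlerForm I g (J 2) m X Y
      + a ^ 2 * (differential I (x 0) m X * differential I (x 1) m Y
        - differential I (x 1) m X * differential I (x 0) m Y) := rfl
  rw [h5, shear, shear]
  simp only [map_add, map_smul, add_apply, smul_apply, smul_eq_mul]
  linear_combination a ^ 2 * differential I (x 0) m Y * (h3 - h1)
    + a ^ 2 * differential I (x 0) m X * h2
    + a ^ 2 * differential I (x 0) m X * (a ^ 2 * differential I (x 0) m Y) / 2 * h4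

/-- The shear intertwines the deformed complex structure with `J₀`. -/
lemma shear_deformedJ (h : IsTriHamiltonian I g J T x) (a : ℝ) (m : M) (X : TangentSpace I m) :
    shear J T x a m (deformedJ I g J T x a 0 m X) = J 0 m (shear J T x a m X) := by
  have hT : differential I (x 0) m (T m) = 0 := by
    have h1 := h.kahlerForm_skew 0 m (T m) (T m)
    change g m (J 0 m (T m)) (T m) = -g m (J 0 m (T m)) (T m) at h1
    rw [h.moment]
    linarith
  have hJX : differential I (x 0) m (J 0 m X) = -g m (T m) X := by
    rw [h.moment, h.hyperkahler.hermitian]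
  have hJT : differential I (x 0) m (J 0 m (T m)) = -g m (T m) (T m) := by
    rw [h.moment, h.hyperkahler.hermitian]
  have hpos : 1 + a ^ 2 * g m (T m) (T m) ≠ 0 := by
    have := h.metric_nonneg m (T m)
    positivity
  have h1 : deformedJ I g J T x a 0 m X = J 0 m X
      - (a ^ 2 / (1 + a ^ 2 * g m (T m) (T m)) * g m (T m) X) • J 0 m (T m)
      + (a ^ 2 * differential I (x 0) m X) • T m := by
    rw [mul_smul, mul_smul]
    rfl
  rw [h1, shear, shear, map_add, map_sub, map_smul, map_smul, hT, hJX, hJT, map_add, map_smul,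
    rotatedField, map_neg, h.hyperkahler.sq]
  simp only [smul_eq_mul, smul_neg, neg_neg]
  have h2 : a ^ 2 / (1 + a ^ 2 * g m (T m) (T m)) * g m (T m) X
      = a ^ 2 * g m (T m) X
        - a ^ 2 * (a ^ 2 / (1 + a ^ 2 * g m (T m) (T m)) * g m (T m) X * g m (T m) (T m)) := by
    field_simp
    ring
  have h3 : a ^ 2 * (-g m (T m) X
      - a ^ 2 / (1 + a ^ 2 * g m (T m) (T m)) * g m (T m) X * -g m (T m) (T m)
      + a ^ 2 * differential I (x 0) m X * 0)
      = -(a ^ 2 / (1 + a ^ 2 * g m (T m) (T m)) * g m (T m) X) := by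
    linear_combination h2
  rw [h3, neg_smul, neg_neg]
  abel

end IsTriHamiltonian

end Quaternionic

/-! ### The deformation as the pull-back by a diffeomorphism -/

section RealLine

/-- A function on the real line whose derivative is at least `1` is bijective. -/
lemma bijective_of_one_le_deriv {f f' : ℝ → ℝ} (hf : ∀ t, HasDerivAt f (f' t) t)
    (hf' : ∀ t, 1 ≤ f' t) : Function.Bijective f := by
  have hmono : Monotone (fun t => f t - t) := by
    refine monotone_of_deriv_nonneg
      (fun t => ((hf t).sub (hasDerivAt_id t)).differentiableAt) fun t => ?_
    have h : deriv (fun t => f t - t) t = f' t - 1 := ((hf t).sub (hasDerivAt_id t)).deriv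
    rw [h]
    exact sub_nonneg.2 (hf' t)
  refine ⟨(strictMono_of_deriv_pos fun t => ?_).injective, ?_⟩
  · rw [(hf t).deriv]
    linarith [hf' t]
  · have hc : Continuous f := continuous_iff_continuousAt.2 fun t => (hf t).continuousAt
    refine hc.surjective ?_ ?_
    · refine Filter.tendsto_atTop_mono' _ ?_ (Filter.tendsto_atTop_add_const_right _ (f 0)
        Filter.tendsto_id)
      filter_upwards [Filter.eventually_ge_atTop 0] with t ht
      have := hmono ht
      simp only [id] at this ⊢
      linarith
    · refine Filter.tendsto_atBot_mono' _ ?_ (Filter.tendsto_atBot_add_const_right _ (f 0)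
        Filter.tendsto_id)
      filter_upwards [Filter.eventually_le_atBot 0] with t ht
      have := hmono ht
      simp only [id] at this ⊢
      linarith

end RealLine

section Deformation

set_option linter.unusedSectionVars false
set_option synthInstance.maxHeartbeats 200000

variable {F : Type*} [NormedAddCommGroup F] [NormedSpace ℝ F] [FiniteDimensional ℝ F]
  {H : Type*} [TopologicalSpace H] {I : ModelWithCorners ℝ F H}
  {M : Type*} [TopologicalSpace M] [ChartedSpace H M] [I.Boundaryless] [IsManifold I ∞ M]
  [T2Space M]
  {g : ∀ m : M, TangentSpace I m →L[ℝ] TangentSpace I m →L[ℝ] ℝ}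
  {J : Fin 3 → ∀ m : M, TangentSpace I m →L[ℝ] TangentSpace I m}
  {T : ∀ m : M, TangentSpace I m} {x : Fin 3 → M → ℝ} {φ : ℝ → M → M}

lemma isSmoothVectorField_rotatedField (h : IsTriHamiltonian I g J T x) :
    IsSmoothVectorField I (rotatedField J T) := by
  have h1 := isSmoothVectorField_apply (h.hyperkahler.complex 0).smooth h.smooth_field
  refine isSmoothVectorField_of_vecCoord I fun m => ?_
  refine (h1.contDiffAt (mem_extChartAt_target (I := I) m)).neg.congr_of_eventuallyEq ?_
  refine Filter.Eventually.of_forall fun y => ?_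
  exact map_neg (chartDeriv I m _) _

/-- The maps `φ s` preserve `ω₁` and `ω₂`. -/
lemma pullbackForm_flow (h : IsTriHamiltonian I g J T x) (hφ0 : ∀ m, φ 0 m = m)
    (hφ : ∀ m, IsMIntegralCurve (fun t => φ t m) (rotatedField J T)) (s : ℝ) (m : M)
    (X Y : TangentSpace I m) :
    pullbackForm I (kahlerForm I g (J 1)) (φ s) m X Y = kahlerForm I g (J 1) m X Y ∧
    pullbackForm I (kahlerForm I g (J 2)) (φ s) m X Y = kahlerForm I g (J 2) m X Y := by
  have hv := isSmoothVectorField_rotatedField h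
  have hsm : ∀ i, IsSmoothForm I (kahlerForm I g (J i)) := fun i =>
    h.smooth_metric.kahlerForm (h.hyperkahler.complex i).smooth
  have key : ∀ (i : Fin 3) (f : M → ℝ) (c : ℝ), ContMDiff I 𝓘(ℝ, ℝ) ∞ f →
      (∀ m X, kahlerForm I g (J i) m (rotatedField J T m) X = c * differential I f m X) →
      pullbackForm I (kahlerForm I g (J i)) (φ s) m X Y = kahlerForm I g (J i) m X Y := by
    intro i f c hf hc
    have h1 := pullbackForm_eq_of_lieForm_eq I (c := 0) (β := kahlerForm I g (J i))
      (contMDiff_flow hv hφ0 hφ) hφ0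
      (flow_add hv hφ0 hφ) hφ (fun m => (hsm i).differentiableAt (mem_extChartAt_target m))
      (fun m u w => by
        rw [lieForm_eq_zero_of_hamiltonian (hsm i) (h.kahlerForm_skew i) (h.hyperkahler.closed i)
          hv hf hc (mem_extChartAt_target m), zero_mul]) s m X Y
    rwa [zero_mul, Real.exp_zero, one_mul] at h1
  exact ⟨key 1 (x 2) (-1) (h.smooth_moment 2) h.kahlerForm_one_rotatedField,
    key 2 (x 1) 1 (h.smooth_moment 1) h.kahlerForm_two_rotatedField⟩

lemma mfderiv_flow_injective {v : ∀ m : M, TangentSpace I m} (hv : IsSmoothVectorField I v)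
    (hφ0 : ∀ m, φ 0 m = m) (hφ : ∀ m, IsMIntegralCurve (fun t => φ t m) v) (s : ℝ) (m : M) :
    Function.Injective (mfderiv I I (φ s) m) := by
  have hsm := contMDiff_flow hv hφ0 hφ
  refine mfderiv_injective_of_leftInverse (f := φ (-s)) (fun p => ?_)
    ((contMDiff_of_uncurry hsm _).mdifferentiable (by simp))
    ((contMDiff_of_uncurry hsm _).mdifferentiable (by simp)) m
  rw [← flow_add hv hφ0 hφ, neg_add_cancel, hφ0]

lemma surjective_of_injective {A : F →L[ℝ] F} (hA : Function.Injective A) :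
    Function.Surjective A :=
  LinearMap.surjective_of_injective (f := (A : F →ₗ[ℝ] F)) hA

/-- The maps `φ s` are holomorphic with respect to `J₀`, because they preserve `ω₁ + iω₂`, which is
non-degenerate and of type `(2, 0)`. -/
lemma mfderiv_flow_complexStructure (h : IsTriHamiltonian I g J T x) (hφ0 : ∀ m, φ 0 m = m)
    (hφ : ∀ m, IsMIntegralCurve (fun t => φ t m) (rotatedField J T)) (s : ℝ) (m : M)
    (X : TangentSpace I m) :
    mfderiv I I (φ s) m (J 0 m X) = J 0 (φ s m) (mfderiv I I (φ s) m X) := by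
  have hsurj : Function.Surjective (mfderiv I I (φ s) m) := surjective_of_injective (F := F)
    (mfderiv_flow_injective (isSmoothVectorField_rotatedField h) hφ0 hφ s m)
  refine sub_eq_zero.1 (h.eq_zero_of_kahlerForm 1 _ _ fun Z => ?_)
  obtain ⟨Y, rfl⟩ := hsurj Z
  have h1 := (pullbackForm_flow h hφ0 hφ s m (J 0 m X) Y).1
  have h2 := (pullbackForm_flow h hφ0 hφ s m X Y).2
  unfold pullbackForm at h1 h2
  rw [map_sub, sub_apply, h1, h.kahlerForm_one_zero, h.kahlerForm_one_zero, h2, sub_self]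

variable (φ x) in
/-- The map `m ↦ φ (a² x₀(m)) m`, where `φ` is the flow of `-J₀ T`. -/
def deformationMap (a : ℝ) (m : M) : M := φ (a ^ 2 * x 0 m) m

lemma contMDiff_deformationMap (h : IsTriHamiltonian I g J T x) (hφ0 : ∀ m, φ 0 m = m)
    (hφ : ∀ m, IsMIntegralCurve (fun t => φ t m) (rotatedField J T)) (a : ℝ) :
    ContMDiff I I ∞ (deformationMap x φ a) := by
  have h1 : ContMDiff I 𝓘(ℝ, ℝ) ∞ (fun m => a ^ 2 * x 0 m) :=
    contMDiff_const.mul (h.smooth_moment 0)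
  exact ContMDiff.comp (g := fun p : ℝ × M => φ p.1 p.2)
    (contMDiff_flow (isSmoothVectorField_rotatedField h) hφ0 hφ) (h1.prodMk contMDiff_id)

/-- The differential of the deformation map is the composition of a shear and of the differential
of the flow. -/
lemma mfderiv_deformationMap (h : IsTriHamiltonian I g J T x) (hφ0 : ∀ m, φ 0 m = m)
    (hφ : ∀ m, IsMIntegralCurve (fun t => φ t m) (rotatedField J T)) (a : ℝ) (m : M)
    (X : TangentSpace I m) : mfderiv I I (deformationMap x φ a) m X
      = mfderiv I I (φ (a ^ 2 * x 0 m)) m (shear J T x a m X) := by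
  have hv := isSmoothVectorField_rotatedField h
  have hsm := contMDiff_flow hv hφ0 hφ
  have hd := (h.smooth_moment 0).mdifferentiable (by simp)
  have h1 : differential I (fun m => a ^ 2 * x 0 m) m X = a ^ 2 * differential I (x 0) m X := by
    have h2 := ((hd m).hasMFDerivAt.const_smul (a ^ 2)).mfderiv
    exact congrArg (fun A : F →L[ℝ] ℝ => A X) h2
  have h3 := mfderiv_flow_comp hsm hφ (f := fun m => a ^ 2 * x 0 m)
    ((contMDiff_const.mul (h.smooth_moment 0)).mdifferentiable (by simp)) m X
  rw [h1] at h3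
  rw [shear, map_add, map_smul, mfderiv_action_apply hφ0 (flow_add hv hφ0 hφ) hφ _
    ((contMDiff_of_uncurry hsm _).mdifferentiable (by simp))]
  exact h3

/-- The deformation map is bijective: along the orbits of `φ` the function `x₀` is increasing, so
that `τ ↦ τ + a² x₀(φ τ p)` is a bijection of the real line. -/
lemma exists_inverse_deformationMap (h : IsTriHamiltonian I g J T x) (hφ0 : ∀ m, φ 0 m = m)
    (hφ : ∀ m, IsMIntegralCurve (fun t => φ t m) (rotatedField J T)) (a : ℝ) :
    ∃ Ψ : M → M, Function.LeftInverse Ψ (deformationMap x φ a) ∧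
      Function.RightInverse Ψ (deformationMap x φ a) := by
  have hadd := flow_add (isSmoothVectorField_rotatedField h) hφ0 hφ
  have hbij : ∀ p, Function.Bijective (fun τ : ℝ => τ + a ^ 2 * x 0 (φ τ p)) := by
    intro p
    refine bijective_of_one_le_deriv (f' := fun τ => 1 + a ^ 2 *
      g (φ τ p) (rotatedField J T (φ τ p)) (rotatedField J T (φ τ p))) (fun τ => ?_) fun τ => ?_
    · have h1 := (((h.smooth_moment 0).mdifferentiable (by simp)) (φ τ p)).hasMFDerivAt.comp τ
        (hφ p τ)
      have h2 : HasFDerivAt (fun τ => x 0 (φ τ p)) ((differential I (x 0) (φ τ p)).comp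
          ((1 : ℝ →L[ℝ] ℝ).smulRight (rotatedField J T (φ τ p)))) τ :=
        hasMFDerivAt_iff_hasFDerivAt.1 h1
      have h3 : HasDerivAt (fun τ => x 0 (φ τ p))
          (g (φ τ p) (rotatedField J T (φ τ p)) (rotatedField J T (φ τ p))) τ := by
        refine h2.hasDerivAt.congr_deriv ?_
        rw [← h.differential_zero]
        change differential I (x 0) (φ τ p) ((1 : ℝ) • rotatedField J T (φ τ p)) = _
        rw [one_smul]
      exact (hasDerivAt_id τ).add (h3.const_mul (a ^ 2))
    · have := h.metric_nonneg (φ τ p) (rotatedField J T (φ τ p))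
      have := mul_nonneg (sq_nonneg a) this
      linarith
  choose τ hτ using fun p => (hbij p).2 0
  simp only at hτ
  refine ⟨fun p => φ (τ p) p, fun m => ?_, fun p => ?_⟩
  · have h1 : τ (deformationMap x φ a m) = -(a ^ 2 * x 0 m) := by
      refine (hbij (deformationMap x φ a m)).1 ?_
      simp only
      rw [hτ, deformationMap, ← hadd, neg_add_cancel, hφ0, neg_add_cancel]
    simp only
    rw [h1, deformationMap, ← hadd, neg_add_cancel, hφ0]
  · rw [deformationMap, ← hadd, add_comm, hτ, hφ0]

lemma mfderiv_deformationMap_injective (h : IsTriHamiltonian I g J T x) (hφ0 : ∀ m, φ 0 m = m)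
    (hφ : ∀ m, IsMIntegralCurve (fun t => φ t m) (rotatedField J T)) (a : ℝ) (m : M) :
    Function.Injective (mfderiv I I (deformationMap x φ a) m) := by
  refine (injective_iff_map_eq_zero _).2 fun X hX => ?_
  rw [mfderiv_deformationMap h hφ0 hφ] at hX
  refine h.shear_eq_zero a m X ?_
  exact mfderiv_flow_injective (isSmoothVectorField_rotatedField h) hφ0 hφ _ m
    (hX.trans (map_zero _).symm)

/-- The deformation map is holomorphic from the deformed complex structure to `J₀`. -/
lemma mfderiv_deformationMap_deformedJ (h : IsTriHamiltonian I g J T x) (hφ0 : ∀ m, φ 0 m = m)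
    (hφ : ∀ m, IsMIntegralCurve (fun t => φ t m) (rotatedField J T)) (a : ℝ) (m : M)
    (X : TangentSpace I m) :
    mfderiv I I (deformationMap x φ a) m (deformedJ I g J T x a 0 m X)
      = J 0 (deformationMap x φ a m) (mfderiv I I (deformationMap x φ a) m X) := by
  rw [mfderiv_deformationMap h hφ0 hφ, mfderiv_deformationMap h hφ0 hφ, h.shear_deformedJ,
    mfderiv_flow_complexStructure h hφ0 hφ]
  rfl

/-- The deformation map pulls `ω₁ + iω₂` back to the deformed form. -/
lemma deformationMap_pullback (h : IsTriHamiltonian I g J T x) (hφ0 : ∀ m, φ 0 m = m)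
    (hφ : ∀ m, IsMIntegralCurve (fun t => φ t m) (rotatedField J T)) (a : ℝ) (m : M)
    (X Y : TangentSpace I m) :
    complexForm I (kahlerForm I g (J 1)) (kahlerForm I g (J 2)) (deformationMap x φ a m)
      (mfderiv I I (deformationMap x φ a) m X) (mfderiv I I (deformationMap x φ a) m Y)
      = complexForm I (deformedForm I g J x a 1) (deformedForm I g J x a 2) m X Y := by
  have h1 := pullbackForm_flow h hφ0 hφ (a ^ 2 * x 0 m) m (shear J T x a m X) (shear J T x a m Y)
  rw [h.kahlerForm_one_shear, h.kahlerForm_two_shear] at h1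
  rw [mfderiv_deformationMap h hφ0 hφ, mfderiv_deformationMap h hφ0 hφ]
  change ((pullbackForm I (kahlerForm I g (J 1)) (φ (a ^ 2 * x 0 m)) m (shear J T x a m X)
    (shear J T x a m Y) : ℝ) : ℂ) + Complex.I * ((pullbackForm I (kahlerForm I g (J 2))
      (φ (a ^ 2 * x 0 m)) m (shear J T x a m X) (shear J T x a m Y) : ℝ) : ℂ) = _
  rw [h1.1, h1.2]
  rfl

end Deformation

/-! ### The deformed complex symplectic structure -/

section ComplexForms

set_option linter.unusedSectionVars false
set_option synthInstance.maxHeartbeats 200000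

variable {F : Type*} [NormedAddCommGroup F] [NormedSpace ℝ F]
  {H : Type*} [TopologicalSpace H] {I : ModelWithCorners ℝ F H}
  {M : Type*} [TopologicalSpace M] [ChartedSpace H M]
  {β γ : ∀ m : M, TangentSpace I m →L[ℝ] TangentSpace I m →L[ℝ] ℝ}

lemma complexForm_apply (m : M) (X Y : TangentSpace I m) :
    complexForm I β γ m X Y = (β m X Y : ℂ) + Complex.I * (γ m X Y : ℂ) := rfl

variable [I.Boundaryless] [IsManifold I ∞ M]

lemma isClosedTwoForm_complexForm (hβ : IsSmoothForm I β) (hγ : IsSmoothForm I γ)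
    (hβc : IsClosedTwoForm I β) (hγc : IsClosedTwoForm I γ) :
    IsClosedTwoForm I (complexForm I β γ) := by
  intro x₀ y hy u v w
  have key : ∀ u v w : F, fderiv ℝ (fun z => coordForm I (complexForm I β γ) x₀ z v w) y u
      = ((fderiv ℝ (fun z => coordForm I β x₀ z v w) y u : ℝ) : ℂ)
        + Complex.I * ((fderiv ℝ (fun z => coordForm I γ x₀ z v w) y u : ℝ) : ℂ) := by
    intro u v w
    have hd : ∀ {δ : ∀ m : M, TangentSpace I m →L[ℝ] TangentSpace I m →L[ℝ] ℝ},
        IsSmoothForm I δ → HasFDerivAt (fun z => ((coordForm I δ x₀ z v w : ℝ) : ℂ))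
          (Complex.ofRealCLM.comp (fderiv ℝ (fun z => coordForm I δ x₀ z v w) y)) y := by
      intro δ hδ
      have h1 : DifferentiableAt ℝ (fun z => coordForm I δ x₀ z v w) y :=
        (((hδ.contDiffAt hy).clm_apply contDiffAt_const).clm_apply
          contDiffAt_const).differentiableAt (by simp)
      exact Complex.ofRealCLM.hasFDerivAt.comp y h1.hasFDerivAt
    have h2 := (hd hβ).add ((hd hγ).const_mul Complex.I)
    exact congrArg (fun A : F →L[ℝ] ℂ => A u) h2.fderiv
  rw [key, key, key]
  have h1 := congrArg (fun r : ℝ => (r : ℂ)) (hβc x₀ y hy u v w)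
  have h2 := congrArg (fun r : ℝ => (r : ℂ)) (hγc x₀ y hy u v w)
  push_cast at h1 h2
  linear_combination h1 + Complex.I * h2

lemma contMDiff_complexForm_apply (hβ : IsSmoothForm I β) (hγ : IsSmoothForm I γ)
    {X Y : ∀ m : M, TangentSpace I m} (hX : IsSmoothVectorField I X)
    (hY : IsSmoothVectorField I Y) :
    ContMDiff I 𝓘(ℝ, ℂ) ∞ (fun m => complexForm I β γ m (X m) (Y m)) := by
  have h : ∀ {δ : ∀ m : M, TangentSpace I m →L[ℝ] TangentSpace I m →L[ℝ] ℝ}, IsSmoothForm I δ →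
      ContMDiff I 𝓘(ℝ, ℂ) ∞ (fun m => ((δ m (X m) (Y m) : ℝ) : ℂ)) := fun hδ =>
    Complex.ofRealCLM.contDiff.contMDiff.comp (hδ.contMDiff_apply hX hY)
  simp only [complexForm_apply]
  exact (h hβ).add (((Complex.I • ContinuousLinearMap.id ℝ ℂ).contDiff.contMDiff).comp (h hγ))

/-- A smooth closed form and a smooth almost complex structure which correspond, under a
diffeomorphism, to a complex symplectic structure form a complex symplectic structure. -/
theorem isComplexSymplectic_of_intertwines [FiniteDimensional ℝ F] {Φ Ψ : M → M}
    (hΦ : ContMDiff I I ∞ Φ) (hΨ : ContMDiff I I ∞ Ψ) (hl : Function.LeftInverse Ψ Φ)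
    (hr : Function.RightInverse Ψ Φ) {J J' : ∀ m : M, TangentSpace I m →L[ℝ] TangentSpace I m}
    {Ω Ω' : ∀ m : M, TangentSpace I m →L[ℝ] TangentSpace I m →L[ℝ] ℂ}
    (h' : IsComplexSymplectic I J' Ω')
    (hJ : ∀ m X, mfderiv I I Φ m (J m X) = J' (Φ m) (mfderiv I I Φ m X))
    (hΩ : ∀ m X Y, Ω' (Φ m) (mfderiv I I Φ m X) (mfderiv I I Φ m Y) = Ω m X Y)
    (hJs : IsSmoothEndomorphism I J)
    (hΩs : ∀ X Y : ∀ m : M, TangentSpace I m, IsSmoothVectorField I X → IsSmoothVectorField I Y →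
      ContMDiff I 𝓘(ℝ, ℂ) ∞ (fun m => Ω m (X m) (Y m)))
    (hΩc : IsClosedTwoForm I Ω) : IsComplexSymplectic I J Ω := by
  have hinj : ∀ m, Function.Injective (mfderiv I I Φ m) := mfderiv_injective_of_leftInverse hl
    (hΨ.mdifferentiable (by simp)) (hΦ.mdifferentiable (by simp))
  refine ⟨⟨hJs, fun m X => hinj m ?_, fun X Y hX hY m =>
      nijenhuis_eq_zero_of_intertwines hΦ hΨ hl hr h'.complex hJ hX hY m⟩,
    fun m X => ?_, hΩs, hΩc, fun m X Y => ?_, fun m X hX => hinj m ?_⟩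
  · rw [hJ, hJ, h'.complex.sq, map_neg]
  · rw [← hΩ, h'.alternating]
  · rw [← hΩ, hJ, h'.type_two_zero, hΩ]
  · rw [map_zero]
    refine h'.nondegenerate _ _ fun Z => ?_
    obtain ⟨Y, rfl⟩ := surjective_of_injective (F := F) (hinj m) Z
    exact (hΩ m X Y).trans (hX Y)

end ComplexForms

section Deformation

set_option linter.unusedSectionVars false
set_option synthInstance.maxHeartbeats 200000

variable {F : Type*} [NormedAddCommGroup F] [NormedSpace ℝ F] [FiniteDimensional ℝ F]
  {H : Type*} [TopologicalSpace H] {I : ModelWithCorners ℝ F H}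
  {M : Type*} [TopologicalSpace M] [ChartedSpace H M] [I.Boundaryless] [IsManifold I ∞ M]
  [T2Space M]
  {g : ∀ m : M, TangentSpace I m →L[ℝ] TangentSpace I m →L[ℝ] ℝ}
  {J : Fin 3 → ∀ m : M, TangentSpace I m →L[ℝ] TangentSpace I m}
  {T : ∀ m : M, TangentSpace I m} {x : Fin 3 → M → ℝ} {φ : ℝ → M → M}

/-- `ω₁ + iω₂` is a complex symplectic form on `(M, J₀)`. -/
theorem isComplexSymplectic_hyperkahler (h : IsTriHamiltonian I g J T x) :
    IsComplexSymplectic I (J 0) (complexForm I (kahlerForm I g (J 1)) (kahlerForm I g (J 2))) := by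
  have hsm : ∀ i, IsSmoothForm I (kahlerForm I g (J i)) := fun i =>
    h.smooth_metric.kahlerForm (h.hyperkahler.complex i).smooth
  have halt : ∀ i m X, kahlerForm I g (J i) m X X = 0 := fun i m X => by
    linarith [h.kahlerForm_skew i m X X]
  refine ⟨h.hyperkahler.complex 0, fun m X => ?_,
    fun X Y hX hY => contMDiff_complexForm_apply (hsm 1) (hsm 2) hX hY,
    isClosedTwoForm_complexForm (hsm 1) (hsm 2) (h.hyperkahler.closed 1) (h.hyperkahler.closed 2),
    fun m X Y => ?_, fun m X hX => h.eq_zero_of_kahlerForm 1 m X fun Y => ?_⟩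
  · rw [complexForm_apply, halt, halt, Complex.ofReal_zero, mul_zero, add_zero]
  · rw [complexForm_apply, complexForm_apply, h.kahlerForm_one_zero, h.kahlerForm_two_zero]
    push_cast
    linear_combination (-(kahlerForm I g (J 2) m X Y : ℂ)) * Complex.I_mul_I
  · simpa [complexForm_apply] using congrArg Complex.re (hX Y)

lemma isSmoothForm_add_smul_wedgeDifferential
    {β : ∀ m : M, TangentSpace I m →L[ℝ] TangentSpace I m →L[ℝ] ℝ} (hβ : IsSmoothForm I β)
    {f k : M → ℝ} (hf : ContMDiff I 𝓘(ℝ, ℝ) ∞ f) (hk : ContMDiff I 𝓘(ℝ, ℝ) ∞ k) (c : ℝ) :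
    IsSmoothForm I (fun m => β m + c • wedgeDifferential I f k m) := by
  intro x₀ y hy
  have hd : ∀ {f : M → ℝ}, ContMDiff I 𝓘(ℝ, ℝ) ∞ f →
      ContDiffAt ℝ ∞ (fderiv ℝ (f ∘ (extChartAt I x₀).symm)) y := fun hf =>
    (contDiffAt_comp_extChartAt_symm hf hy).fderiv_right (m := ∞) (by simp)
  have h1 := (hβ.contDiffAt hy).add
    ((((hd hf).smulRight (hd hk)).sub ((hd hk).smulRight (hd hf))).const_smul c)
  refine (h1.congr_of_eventuallyEq ?_).contDiffWithinAt
  filter_upwards [extChartAt_target_mem I hy] with z hz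
  ext v w
  exact coordForm_add_smul_wedgeDifferential hf hk c hz v w

/-- The deformed complex structure is smooth. -/
lemma isSmoothEndomorphism_deformedJ (h : IsTriHamiltonian I g J T x) (a : ℝ) :
    IsSmoothEndomorphism I (deformedJ I g J T x a 0) := by
  refine isSmoothEndomorphism_of_endCoord I fun x₀ => ?_
  have hy := mem_extChartAt_target (I := I) x₀
  set y := extChartAt I x₀ x₀
  have hJ : ContDiffAt ℝ ∞ (endCoord I (J 0) x₀) y := (h.hyperkahler.complex 0).smooth.contDiffAt hy
  have hT : ContDiffAt ℝ ∞ (vecCoord I T x₀) y := h.smooth_field.contDiffAt hy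
  have hg : ContDiffAt ℝ ∞ (formCoord I g x₀) y := h.smooth_metric.contDiffAt hy
  have hgT : ContDiffAt ℝ ∞ (fun z => formCoord I g x₀ z (vecCoord I T x₀ z)) y :=
    hg.clm_apply hT
  have hx : ContDiffAt ℝ ∞ (fderiv ℝ (x 0 ∘ (extChartAt I x₀).symm)) y :=
    (contDiffAt_comp_extChartAt_symm (h.smooth_moment 0) hy).fderiv_right (m := ∞) (by simp)
  have hk : ContDiffAt ℝ ∞ (fun z => a ^ 2
      / (1 + a ^ 2 * formCoord I g x₀ z (vecCoord I T x₀ z) (vecCoord I T x₀ z))) y := by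
    refine contDiffAt_const.div (contDiffAt_const.add (contDiffAt_const.mul (hgT.clm_apply hT))) ?_
    rw [formCoord_vecCoord I hy]
    have := h.metric_nonneg _ (T ((extChartAt I x₀).symm y))
    positivity
  have h1 := (hJ.sub (hk.smul (hgT.smulRight (hJ.clm_apply hT)))).add
    ((hx.smulRight hT).const_smul (a ^ 2))
  refine h1.congr_of_eventuallyEq ?_
  filter_upwards [extChartAt_target_mem I hy] with z hz
  ext u
  have h2 : formCoord I g x₀ z (vecCoord I T x₀ z) u
      = g ((extChartAt I x₀).symm z) (T _) (chartSymmDeriv I x₀ z u) := by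
    rw [formCoord_apply, chartSymmDeriv_vecCoord I hz]
  have h3 := fderiv_comp_extChartAt_symm I hz ((h.smooth_moment 0).mdifferentiableAt (by simp)) u
  have h4 := (vecCoord_apply_endo I hz (J 0) T).symm
  have h5 : endCoord I (deformedJ I g J T x a 0) x₀ z u = endCoord I (J 0) x₀ z u
      - (a ^ 2 / (1 + a ^ 2 * g ((extChartAt I x₀).symm z) (T _) (T _)))
        • (g ((extChartAt I x₀).symm z) (T _) (chartSymmDeriv I x₀ z u)
          • vecCoord I (fun p => J 0 p (T p)) x₀ z)
      + a ^ 2 • (differential I (x 0) _ (chartSymmDeriv I x₀ z u) • vecCoord I T x₀ z) := by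
    have h6 : ∀ (p : M) (X : TangentSpace I p), deformedJ I g J T x a 0 p X = J 0 p X
        - (a ^ 2 / (1 + a ^ 2 * g p (T p) (T p))) • (g p (T p) X • J 0 p (T p))
        + a ^ 2 • (differential I (x 0) p X • T p) := fun _ _ => rfl
    rw [endCoord_apply, endCoord_apply, h6, map_add, map_sub, map_smul, map_smul, map_smul,
      map_smul]
    rfl
  rw [h5, ← h2, ← h3, ← h4, ← formCoord_vecCoord I hz]
  rfl

/-- The deformation map is a complex symplectomorphism from the deformed complex symplectic
structure to the original one. -/
theorem isComplexSymplectomorphism_deformationMap (h : IsTriHamiltonian I g J T x)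
    (hφ0 : ∀ m, φ 0 m = m)
    (hφ : ∀ m, IsMIntegralCurve (fun t => φ t m) (rotatedField J T)) (a : ℝ) :
    IsComplexSymplectomorphism I (deformedJ I g J T x a 0)
      (complexForm I (deformedForm I g J x a 1) (deformedForm I g J x a 2)) (J 0)
      (complexForm I (kahlerForm I g (J 1)) (kahlerForm I g (J 2))) (deformationMap x φ a) := by
  obtain ⟨Ψ, hl, hr⟩ := exists_inverse_deformationMap h hφ0 hφ a
  have hΦ := contMDiff_deformationMap h hφ0 hφ a
  have hΨ := contMDiff_of_mfderiv_injective hΦ hl hr (mfderiv_deformationMap_injective h hφ0 hφ a)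
  have htarget := isComplexSymplectic_hyperkahler h
  have hsm : ∀ i, IsSmoothForm I (deformedForm I g J x a i) := fun i =>
    isSmoothForm_add_smul_wedgeDifferential
      (h.smooth_metric.kahlerForm (h.hyperkahler.complex i).smooth)
      (h.smooth_moment _) (h.smooth_moment _) _
  have hcl : ∀ i, IsClosedTwoForm I (deformedForm I g J x a i) := fun i =>
    isClosedTwoForm_add_smul_wedgeDifferential
      (h.smooth_metric.kahlerForm (h.hyperkahler.complex i).smooth) (h.hyperkahler.closed i)
      (h.smooth_moment _) (h.smooth_moment _) _
  refine ⟨isComplexSymplectic_of_intertwines hΦ hΨ hl hr htarget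
      (mfderiv_deformationMap_deformedJ h hφ0 hφ a) (deformationMap_pullback h hφ0 hφ a)
      (isSmoothEndomorphism_deformedJ h a)
      (fun X Y hX hY => contMDiff_complexForm_apply (hsm 1) (hsm 2) hX hY)
      (isClosedTwoForm_complexForm (hsm 1) (hsm 2) (hcl 1) (hcl 2)),
    htarget, ⟨⟨⟨⟨deformationMap x φ a, Ψ, hl, hr⟩, hΦ, hΨ⟩, rfl⟩,
      mfderiv_deformationMap_deformedJ h hφ0 hφ a⟩, deformationMap_pullback h hφ0 hφ a⟩

end Deformation

/-! ### Complexified actions -/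

section ComplexifiedAction

set_option linter.unusedSectionVars false

variable {F : Type*} [NormedAddCommGroup F] [NormedSpace ℝ F] [FiniteDimensional ℝ F]
  {H : Type*} [TopologicalSpace H] {I : ModelWithCorners ℝ F H}
  {M : Type*} [TopologicalSpace M] [ChartedSpace H M] [I.Boundaryless] [IsManifold I ∞ M]
  [T2Space M]
  {J : ∀ m : M, TangentSpace I m →L[ℝ] TangentSpace I m}
  {T v : ∀ m : M, TangentSpace I m} {P φ : ℝ → M → M}

lemma isMIntegralCurve_unique (hv : IsSmoothVectorField I v) {γ γ' : ℝ → M}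
    (hγ : IsMIntegralCurve γ v) (hγ' : IsMIntegralCurve γ' v) (h : γ 0 = γ' 0) (t : ℝ) :
    γ t = γ' t :=
  congrFun (isMIntegralCurve_Ioo_eq_of_contMDiff_boundaryless (t₀ := 0) hv.contMDiff_one
    hγ hγ' h) t

/-- A map which preserves a complete vector field commutes with its flow. -/
lemma flow_comm_of_mfderiv_apply (hv : IsSmoothVectorField I v) (hφ0 : ∀ m, φ 0 m = m)
    (hφ : ∀ m, IsMIntegralCurve (fun t => φ t m) v) {f : M → M} (hf : MDifferentiable I I f)
    (h : ∀ m, mfderiv I I f m (v m) = v (f m)) (s : ℝ) (m : M) : f (φ s m) = φ s (f m) :=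
  isMIntegralCurve_unique hv ((hφ m).comp_of_mfderiv_apply hf h) (hφ (f m))
    (by simp only [Function.comp_apply, hφ0]) s

/-- The action of `ℂ` given by two commuting flows. -/
def complexAction (P φ : ℝ → M → M) (z : ℂ) (m : M) : M := φ z.re (P z.im m)

lemma isComplexifiedAction_complexAction (hP0 : ∀ m, P 0 m = m)
    (hPadd : ∀ s t m, P (s + t) m = P s (P t m)) (hPT : ∀ m, IsMIntegralCurve (fun t => P t m) T)
    (hφ0 : ∀ m, φ 0 m = m) (hφadd : ∀ s t m, φ (s + t) m = φ s (φ t m))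
    (hφ : ∀ m, IsMIntegralCurve (fun t => φ t m) (fun p => -J p (T p)))
    (hcomm : ∀ t s m, P t (φ s m) = φ s (P t m)) :
    IsComplexifiedAction I J T (complexAction P φ) where
  zero m := by simp only [complexAction, Complex.zero_re, Complex.zero_im, hP0, hφ0]
  add z w m := by
    simp only [complexAction, Complex.add_re, Complex.add_im, hφadd, hPadd, hcomm]
  imaginary m := by
    have h : (fun t : ℝ => complexAction P φ (t * Complex.I) m) = fun t => P t m := by
      ext t
      simp [complexAction, hφ0]
    rw [h]
    exact hPT m
  real m := by
    have h : (fun τ : ℝ => complexAction P φ (τ : ℂ) m) = fun τ => φ τ m := by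
      ext τ
      simp [complexAction, hP0]
    rw [h]
    exact hφ m

lemma IsComplexifiedAction.eq_complexAction (hT : IsSmoothVectorField I T)
    (hv : IsSmoothVectorField I (fun p => -J p (T p))) (hP0 : ∀ m, P 0 m = m)
    (hPT : ∀ m, IsMIntegralCurve (fun t => P t m) T) (hφ0 : ∀ m, φ 0 m = m)
    (hφ : ∀ m, IsMIntegralCurve (fun t => φ t m) (fun p => -J p (T p)))
    {ψ : ℂ → M → M} (hψ : IsComplexifiedAction I J T ψ) : ψ = complexAction P φ := by
  ext z m
  have h1 : ∀ m, ψ (z.im * Complex.I) m = P z.im m := fun m =>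
    isMIntegralCurve_unique hT (hψ.imaginary m) (hPT m) (by simp [hψ.zero, hP0]) z.im
  have h2 : ∀ m, ψ (z.re : ℂ) m = φ z.re m := fun m =>
    isMIntegralCurve_unique hv (hψ.real m) (hφ m) (by simp [hψ.zero, hφ0]) z.re
  rw [complexAction, ← h1, ← h2, ← hψ.add, Complex.re_add_im]

end ComplexifiedAction

/-! ### Kähler structures with a homothetic gradient flow -/

section Homothety

set_option linter.unusedSectionVars false
set_option synthInstance.maxHeartbeats 200000

variable {F : Type*} [NormedAddCommGroup F] [NormedSpace ℝ F]

lemma fderiv_bilin_apply₂ {B : F → F →L[ℝ] F →L[ℝ] ℝ} {V W : F → F} {y : F}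
    (hB : DifferentiableAt ℝ B y) (hV : DifferentiableAt ℝ V y) (hW : DifferentiableAt ℝ W y)
    (u : F) : fderiv ℝ (fun z => B z (V z) (W z)) y u
      = fderiv ℝ B y u (V y) (W y) + B y (fderiv ℝ V y u) (W y) + B y (V y) (fderiv ℝ W y u) := by
  have h1 : HasFDerivAt (fun z => B z (V z))
      ((B y).comp (fderiv ℝ V y) + (fderiv ℝ B y).flip (V y)) y :=
    HasFDerivAt.clm_apply (c := B) hB.hasFDerivAt hV.hasFDerivAt
  have h2 := HasFDerivAt.clm_apply h1 hW.hasFDerivAt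
  rw [h2.fderiv]
  change B y (V y) (fderiv ℝ W y u) + (B y (fderiv ℝ V y u) (W y) + fderiv ℝ B y u (V y) (W y)) = _
  ring

lemma fderiv_clm_apply_const {A : F → F →L[ℝ] F} {y : F} (hA : DifferentiableAt ℝ A y) (u w : F) :
    fderiv ℝ (fun z => A z u) y w = fderiv ℝ A y w u := by
  have h : HasFDerivAt (fun z => A z u) ((ContinuousLinearMap.apply ℝ F u).comp (fderiv ℝ A y)) y :=
    HasFDerivAt.comp (f := A) y (ContinuousLinearMap.apply ℝ F u).hasFDerivAt hA.hasFDerivAt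
  rw [h.fderiv]
  rfl

/-- The identities satisfied by the metric `B`, the complex structure `A` and the homothetic
gradient field `V` in coordinates imply that `V` rescales the form `B(A ·, ·)`. -/
lemma lieForm_comp_eq {B K : F → F →L[ℝ] F →L[ℝ] ℝ} {A : F → F →L[ℝ] F} {V : F → F} {y : F}
    (hB : DifferentiableAt ℝ B y) (hA : DifferentiableAt ℝ A y)
    (hK : ∀ᶠ z in 𝓝 y, ∀ u w, K z u w = B z (A z u) w)
    (hKd : DifferentiableAt ℝ K y)
    (gsymm : ∀ u v, B y u v = B y v u)
    (gsymm' : ∀ w u v, fderiv ℝ B y w u v = fderiv ℝ B y w v u)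
    (gnondeg : ∀ u, (∀ v, B y u v = 0) → u = 0)
    (herm : ∀ᶠ z in 𝓝 y, ∀ u v, B z (A z u) (A z v) = B z u v)
    (hJ : ∀ᶠ z in 𝓝 y, ∀ u, A z (A z u) = -u)
    (hN : ∀ u v, fderiv ℝ A y (A y u) v - fderiv ℝ A y (A y v) u + A y (fderiv ℝ A y v u)
      - A y (fderiv ℝ A y u v) = 0)
    (hclosed : ∀ u v w, fderiv ℝ K y u v w + fderiv ℝ K y v w u + fderiv ℝ K y w u v = 0)
    (hR : ∀ u v, lieForm B V y u v = 2 * B y u v)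
    (hgrad : ∀ u v, fderiv ℝ B y u (V y) v + B y (fderiv ℝ V y u) v
      = fderiv ℝ B y v (V y) u + B y (fderiv ℝ V y v) u) (u w : F) :
    lieForm K V y u w = 2 * K y u w := by
  have hAu : ∀ u, DifferentiableAt ℝ (fun z => A z u) y := fun u =>
    hA.clm_apply (differentiableAt_const u)
  have hK' : ∀ w u v, fderiv ℝ K y w u v = fderiv ℝ B y w (A y u) v + B y (fderiv ℝ A y w u) v := by
    intro w u v
    have h1 : (fun z => K z u v) =ᶠ[𝓝 y] fun z => B z (A z u) v := hK.mono fun z hz => hz u v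
    rw [← fderiv_bilin_apply hKd, h1.fderiv_eq, fderiv_bilin_contraction hB (hAu u),
      fderiv_clm_apply_const hA]
  have herm' : ∀ w u v, fderiv ℝ B y w (A y u) (A y v) + B y (fderiv ℝ A y w u) (A y v)
      + B y (A y u) (fderiv ℝ A y w v) = fderiv ℝ B y w u v := by
    intro w u v
    have h1 : (fun z => B z (A z u) (A z v)) =ᶠ[𝓝 y] fun z => B z u v :=
      herm.mono fun z hz => hz u v
    have h2 := fderiv_bilin_apply₂ hB (hAu u) (hAu v) w
    rw [h1.fderiv_eq, fderiv_bilin_apply hB, fderiv_clm_apply_const hA,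
      fderiv_clm_apply_const hA] at h2
    exact h2.symm
  have hJ' : ∀ w u, fderiv ℝ A y w (A y u) + A y (fderiv ℝ A y w u) = 0 := by
    intro w u
    have h1 : (fun z => A z (A z u)) =ᶠ[𝓝 y] fun _ => -u := hJ.mono fun z hz => hz u
    have h2 := (hA.hasFDerivAt.clm_apply (hAu u).hasFDerivAt).fderiv
    rw [h1.fderiv_eq, fderiv_fun_const] at h2
    have h3 := congrArg (fun L : F →L[ℝ] F => L w) h2
    change (0 : F) = A y (fderiv ℝ (fun z => A z u) y w) + fderiv ℝ A y w (A y u) at h3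
    rw [fderiv_clm_apply_const hA, add_comm] at h3
    exact h3.symm
  have hclosed' : ∀ u v w, (fderiv ℝ B y u (A y v) w + B y (fderiv ℝ A y u v) w)
      + (fderiv ℝ B y v (A y w) u + B y (fderiv ℝ A y v w) u)
      + (fderiv ℝ B y w (A y u) v + B y (fderiv ℝ A y w u) v) = 0 := by
    intro u v w
    rw [← hK', ← hK', ← hK']
    exact hclosed u v w
  have hL := lie_complexStructure_eq_zero (g := B y) (g' := fderiv ℝ B y) (J := A y)
    (J' := fderiv ℝ A y) (R := V y) (R' := fderiv ℝ V y) gsymm gsymm' gnondeg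
    herm.self_of_nhds herm' hJ.self_of_nhds hJ' hN hclosed' hR hgrad u
  have h1 := congrArg (fun X => B y X w) hL
  have h2 := hR (A y u) w
  have hKy := hK.self_of_nhds
  simp only [map_sub, map_add, sub_apply, add_apply, map_zero, zero_apply] at h1
  unfold lieForm at h2 ⊢
  rw [hK', hKy, hKy, hKy]
  linarith

variable {H : Type*} [TopologicalSpace H] {I : ModelWithCorners ℝ F H}
  {M : Type*} [TopologicalSpace M] [ChartedSpace H M] [I.Boundaryless] [IsManifold I ∞ M]
  {g : ∀ m : M, TangentSpace I m →L[ℝ] TangentSpace I m →L[ℝ] ℝ}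
  {J : ∀ m : M, TangentSpace I m →L[ℝ] TangentSpace I m}
  {T R : ∀ m : M, TangentSpace I m} {P D : ℝ → M → M} {r : M → ℝ}

/-- On a Kähler manifold, a homothetic flow `D` (`D_t^* g = e^{2t} g`) whose generator `R` is a
gradient (`g(R, ·) = c dr`) rescales the Kähler form in the same way as the metric. -/
lemma lieForm_kahlerForm_of_homothety [FiniteDimensional ℝ F] [T2Space M]
    (hJ : IsComplexStructure I J) (hg : IsSmoothForm I g)
    (gsymm : ∀ m X Y, g m X Y = g m Y X) (gpos : ∀ m X, X ≠ 0 → 0 < g m X X)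
    (herm : ∀ m (X Y : TangentSpace I m), g m (J m X) (J m Y) = g m X Y)
    (hclosed : IsClosedTwoForm I (kahlerForm I g J))
    (hD : ContMDiff (𝓘(ℝ, ℝ).prod I) I ∞ (fun p : ℝ × M => D p.1 p.2)) (hD0 : ∀ m, D 0 m = m)
    (hDR : ∀ m, IsMIntegralCurve (fun t => D t m) R) (hR : IsSmoothVectorField I R)
    (hDg : ∀ t m (X Y : TangentSpace I m), pullbackForm I g (D t) m X Y = Real.exp (2 * t) * g m X Y)
    {c : ℝ} (hr : ContMDiff I 𝓘(ℝ, ℝ) ∞ r)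
    (hgrad : ∀ m X, g m (R m) X = c * differential I r m X)
    (m : M) (u w : F) :
    lieForm (formCoord I (kahlerForm I g J) m) (vecCoord I R m) (extChartAt I m m) u w
      = 2 * formCoord I (kahlerForm I g J) m (extChartAt I m m) u w := by
  have hy := mem_extChartAt_target (I := I) m
  have hT := extChartAt_target_mem I hy
  have hK := hg.kahlerForm hJ.smooth
  refine lieForm_comp_eq (hg.differentiableAt hy)
    ((hJ.smooth.contDiffAt hy).differentiableAt (by simp)) (A := endCoord I J m) ?_
    (hK.differentiableAt hy) (fun u v => gsymm _ _ _) (fun w u v =>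
      hg.fderiv_formCoord_eq gsymm hy w u v) (fun u hu => ?_) ?_ ?_
    (nijenhuis_coord I hJ m rfl rfl) (hclosed.fderiv_formCoord hK hy)
    (fun u v => lieForm_eq_of_pullbackForm_eq I hD hD0 hDR m (hg.differentiableAt hy)
      (fun t X Y => hDg t m X Y) u v)
    (fun u v => fderiv_contraction_comm hg hR hr hgrad hy u v) u w
  · filter_upwards [hT] with z hz u w
    exact formCoord_kahlerForm I hz g J u w
  · by_contra hne
    have h1 : chartSymmDeriv I m (extChartAt I m m) u ≠ 0 := by
      intro h0
      have h2 := chartDeriv_chartSymmDeriv I hy u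
      rw [h0, map_zero] at h2
      exact hne h2.symm
    exact (gpos _ _ h1).ne' (hu u)
  · filter_upwards [hT] with z hz u w
    rw [formCoord_apply, chartSymmDeriv_endCoord I hz, chartSymmDeriv_endCoord I hz, herm]
    rfl
  · filter_upwards [hT] with z hz u
    rw [endCoord_apply, chartSymmDeriv_endCoord I hz, hJ.sq, map_neg,
      chartDeriv_chartSymmDeriv I hz]

lemma differential_eq_fderiv {f : M → ℝ} {x₀ q : M} (hq : q ∈ (extChartAt I x₀).source)
    (hf : MDifferentiableAt I 𝓘(ℝ, ℝ) f q) (X : TangentSpace I q) :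
    differential I f q X = fderiv ℝ (f ∘ (extChartAt I x₀).symm) (extChartAt I x₀ q)
      (chartDeriv I x₀ q X) := by
  obtain ⟨y, hy, rfl⟩ : ∃ y ∈ (extChartAt I x₀).target, q = (extChartAt I x₀).symm y :=
    ⟨_, (extChartAt I x₀).map_source hq, ((extChartAt I x₀).left_inv hq).symm⟩
  rw [(extChartAt I x₀).right_inv hy, fderiv_comp_extChartAt_symm I hy hf,
    chartSymmDeriv_chartDeriv I hy]

/-- If the flow with generator `T` preserves the closed form `β` and if the field `R`, which
commutes with `T`, rescales `β` with weight `2`, then `β(T, R) / 2` is a Hamiltonian of `T`. -/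
lemma differential_contraction_of_homothety
    {β : ∀ m : M, TangentSpace I m →L[ℝ] TangentSpace I m →L[ℝ] ℝ} (hβ : IsSmoothForm I β)
    (hskew : ∀ m X Y, β m X Y = -β m Y X) (hclosed : IsClosedTwoForm I β)
    (hT : IsSmoothVectorField I T) (hR : IsSmoothVectorField I R)
    (hTβ : ∀ m u w, lieForm (formCoord I β m) (vecCoord I T m) (extChartAt I m m) u w = 0)
    (hRβ : ∀ m u w, lieForm (formCoord I β m) (vecCoord I R m) (extChartAt I m m) u w
      = 2 * formCoord I β m (extChartAt I m m) u w)
    (hRT : ∀ m, fderiv ℝ (vecCoord I T m) (extChartAt I m m) (vecCoord I R m (extChartAt I m m))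
      = fderiv ℝ (vecCoord I R m) (extChartAt I m m) (vecCoord I T m (extChartAt I m m)))
    (m : M) (X : TangentSpace I m) :
    differential I (fun m => β m (T m) (R m)) m X = 2 * β m (T m) X := by
  have hy := mem_extChartAt_target (I := I) m
  have hm := mem_extChartAt_source (I := I) m
  have h1 : (fun m => β m (T m) (R m)) ∘ (extChartAt I m).symm =ᶠ[𝓝 (extChartAt I m m)]
      fun z => formCoord I β m z (vecCoord I T m z) (vecCoord I R m z) := by
    filter_upwards [extChartAt_target_mem I hy] with z hz
    exact (formCoord_vecCoord I hz β T R).symm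
  have h2 : vecCoord I T m (extChartAt I m m) = chartDeriv I m m (T m) := by
    unfold vecCoord
    rw [(extChartAt I m).left_inv hm]
  rw [differential_eq_fderiv hm ((hβ.contMDiff_apply hT hR).mdifferentiableAt (by simp)),
    h1.fderiv_eq, fderiv_bilin_apply₂ (hβ.differentiableAt hy) (hT.differentiableAt hy)
      (hR.differentiableAt hy), ← formCoord_chartDeriv I β hm, ← h2]
  exact deriv_contraction_of_lie (β := formCoord I β m (extChartAt I m m))
    (fun u w => hskew _ _ _) (hclosed.fderiv_formCoord hβ hy) (hTβ m) (hRβ m) (hRT m) _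

/-- A map which rescales the metric and the Kähler form with the same factor is holomorphic. -/
lemma mfderiv_complexStructure_of_pullbackForm (gpos : ∀ m X, X ≠ 0 → 0 < g m X X) {f : M → M}
    {m : M} (hf : Function.Surjective (mfderiv I I f m)) {k : ℝ}
    (hg : ∀ X Y, pullbackForm I g f m X Y = k * g m X Y)
    (hK : ∀ X Y, pullbackForm I (kahlerForm I g J) f m X Y = k * kahlerForm I g J m X Y)
    (X : TangentSpace I m) : mfderiv I I f m (J m X) = J (f m) (mfderiv I I f m X) := by
  have key : ∀ Z, g (f m) (mfderiv I I f m (J m X) - J (f m) (mfderiv I I f m X)) Z = 0 := by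
    intro Z
    obtain ⟨Y, rfl⟩ := hf Z
    rw [map_sub, sub_apply]
    exact sub_eq_zero.2 ((hg (J m X) Y).trans (hK X Y).symm)
  by_contra hne
  exact (gpos _ _ (sub_ne_zero.2 hne)).ne' (key _)

/-- An isometry which is holomorphic preserves the Kähler form. -/
lemma pullbackForm_kahlerForm {f : M → M} {m : M}
    (hg : ∀ X Y, pullbackForm I g f m X Y = g m X Y)
    (hJ : ∀ X, mfderiv I I f m (J m X) = J (f m) (mfderiv I I f m X)) (X Y : TangentSpace I m) :
    pullbackForm I (kahlerForm I g J) f m X Y = kahlerForm I g J m X Y := by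
  have h := hg (J m X) Y
  unfold pullbackForm at h ⊢
  rw [hJ] at h
  exact h

end Homothety

/-! ### Generators of families of maps -/

section FlowGenerator

set_option linter.unusedSectionVars false

variable {F : Type*} [NormedAddCommGroup F] [NormedSpace ℝ F]
  {H : Type*} [TopologicalSpace H] {I : ModelWithCorners ℝ F H}
  {M : Type*} [TopologicalSpace M] [ChartedSpace H M]
  {F' : Type*} [NormedAddCommGroup F'] [NormedSpace ℝ F']
  {H' : Type*} [TopologicalSpace H'] {I' : ModelWithCorners ℝ F' H'}
  {N : Type*} [TopologicalSpace N] [ChartedSpace H' N] {P : ℝ → M → M}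

variable (I P) in
/-- The velocity at time `0` of the curve `t ↦ P t m`. -/
def flowGenerator (m : M) : TangentSpace I m :=
  show F from mfderiv 𝓘(ℝ, ℝ) I (fun t : ℝ => P t m) 0 (1 : ℝ)

lemma hasMFDerivAt_flowGenerator (hP0 : ∀ m, P 0 m = m) {m : M}
    (hP : MDifferentiableAt 𝓘(ℝ, ℝ) I (fun t => P t m) 0) :
    HasMFDerivAt 𝓘(ℝ, ℝ) I (fun t => P t m) 0
      ((1 : ℝ →L[ℝ] ℝ).smulRight (flowGenerator I P (P 0 m))) := by
  have h1 : ∀ p, p = m → (flowGenerator I P p : F)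
      = mfderiv 𝓘(ℝ, ℝ) I (fun t : ℝ => P t m) 0 (1 : ℝ) := by
    rintro _ rfl
    rfl
  have h2 : (1 : ℝ →L[ℝ] ℝ).smulRight (flowGenerator I P (P 0 m))
      = mfderiv 𝓘(ℝ, ℝ) I (fun t : ℝ => P t m) 0 := by
    refine ContinuousLinearMap.ext fun c => ?_
    have h3 : mfderiv 𝓘(ℝ, ℝ) I (fun t : ℝ => P t m) 0 (c • (1 : ℝ))
        = c • mfderiv 𝓘(ℝ, ℝ) I (fun t : ℝ => P t m) 0 (1 : ℝ) := map_smul _ _ _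
    have h4 : c • (1 : ℝ) = c := by simp
    rw [h4] at h3
    exact (congrArg (fun X : F => c • X) (h1 _ (hP0 m))).trans h3.symm
  rw [h2]
  exact hP.hasMFDerivAt

/-- The differential of a map on the generator of a family `P` is computed along the curves
`t ↦ P t m`. -/
lemma mfderiv_flowGenerator (hP0 : ∀ m, P 0 m = m) {m : M}
    (hP : MDifferentiableAt 𝓘(ℝ, ℝ) I (fun t => P t m) 0) {f : M → N}
    (hf : MDifferentiable I I' f) :
    (mfderiv I I' f m (flowGenerator I P m) : F')
      = mfderiv 𝓘(ℝ, ℝ) I' (fun t => f (P t m)) 0 (1 : ℝ) := by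
  have h1 := ((hf (P 0 m)).hasMFDerivAt.comp (0 : ℝ) (hasMFDerivAt_flowGenerator hP0 hP)).mfderiv
  have h2 : ∀ p, p = m → (mfderiv I I' f p (flowGenerator I P p) : F')
      = mfderiv I I' f m (flowGenerator I P m) := by
    rintro _ rfl
    rfl
  rw [← h2 _ (hP0 m)]
  have h3 := congrArg (fun A : ℝ →L[ℝ] F' => A 1) h1
  refine Eq.trans ?_ h3.symm
  change _ = mfderiv I I' f (P 0 m) ((1 : ℝ) • flowGenerator I P (P 0 m))
  rw [one_smul]

end FlowGenerator

/-! ### The cone -/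

section ConeGeometry

set_option linter.unusedSectionVars false
set_option synthInstance.maxHeartbeats 200000

variable {E : Type*} [NormedAddCommGroup E] [NormedSpace ℝ E]
  {S : Type*} [TopologicalSpace S] [ChartedSpace E S]

lemma contMDiff_coneRadius :
    ContMDiff (coneModel E) 𝓘(ℝ, ℝ) ∞ (coneRadius : Cone S → ℝ) :=
  contMDiff_subtype_val.comp contMDiff_fst

lemma contMDiff_coneLink :
    ContMDiff (coneModel E) 𝓘(ℝ, E) ∞ (fun p : Cone S => p.2) := contMDiff_snd

lemma mdifferentiableAt_coneRadius (m : Cone S) :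
    MDifferentiableAt (coneModel E) 𝓘(ℝ, ℝ) coneRadius m :=
  contMDiff_coneRadius.mdifferentiableAt (by simp)

lemma mdifferentiableAt_coneLink (m : Cone S) :
    MDifferentiableAt (coneModel E) 𝓘(ℝ, E) (fun p : Cone S => p.2) m :=
  contMDiff_coneLink.mdifferentiableAt (by simp)

/-- A map into the cone is smooth if its radial and link components are smooth. -/
lemma contMDiff_cone {F : Type*} [NormedAddCommGroup F] [NormedSpace ℝ F]
    {H : Type*} [TopologicalSpace H] {I : ModelWithCorners ℝ F H}
    {M : Type*} [TopologicalSpace M] [ChartedSpace H M] {f : M → Cone S}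
    (h1 : ContMDiff I 𝓘(ℝ, ℝ) ∞ (fun m => coneRadius (f m)))
    (h2 : ContMDiff I 𝓘(ℝ, E) ∞ (fun m => (f m).2)) : ContMDiff I (coneModel E) ∞ f :=
  ((ContMDiff.subtypeVal_comp_iff PosReal (fun m => (f m).1)).1 h1).prodMk h2

lemma coneRadius_pos (m : Cone S) : 0 < coneRadius m := m.1.2

/-- The dilation `(ρ, s) ↦ (e^t ρ, s)`. -/
def dilation (t : ℝ) (m : Cone S) : Cone S :=
  (⟨Real.exp t * coneRadius m, mul_pos (Real.exp_pos t) (coneRadius_pos m)⟩, m.2)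

lemma coneRadius_dilation (t : ℝ) (m : Cone S) :
    coneRadius (dilation t m) = Real.exp t * coneRadius m := rfl

lemma cone_ext {m m' : Cone S} (h1 : coneRadius m = coneRadius m') (h2 : m.2 = m'.2) : m = m' :=
  Prod.ext (Subtype.ext h1) h2

lemma dilation_zero (m : Cone S) : dilation 0 m = m :=
  cone_ext (by rw [coneRadius_dilation, Real.exp_zero, one_mul]) rfl

lemma dilation_add (s t : ℝ) (m : Cone S) : dilation (s + t) m = dilation s (dilation t m) :=
  cone_ext (by rw [coneRadius_dilation, coneRadius_dilation, coneRadius_dilation, Real.exp_add,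
    mul_assoc]) rfl

lemma contMDiff_coneRadius_snd : ContMDiff (𝓘(ℝ, ℝ).prod (coneModel E)) 𝓘(ℝ, ℝ) ∞
    (fun p : ℝ × Cone S => coneRadius p.2) :=
  ContMDiff.comp (g := (coneRadius : Cone S → ℝ)) (f := fun p : ℝ × Cone S => p.2)
    contMDiff_coneRadius contMDiff_snd

lemma contMDiff_coneLink_snd : ContMDiff (𝓘(ℝ, ℝ).prod (coneModel E)) 𝓘(ℝ, E) ∞
    (fun p : ℝ × Cone S => p.2.2) :=
  ContMDiff.comp (g := fun p : Cone S => p.2) (f := fun p : ℝ × Cone S => p.2)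
    contMDiff_coneLink contMDiff_snd

lemma contMDiff_dilation : ContMDiff (𝓘(ℝ, ℝ).prod (coneModel E)) (coneModel E) ∞
    (fun p : ℝ × Cone S => dilation p.1 p.2) := by
  refine contMDiff_cone ?_ contMDiff_coneLink_snd
  exact (Real.contDiff_exp.contMDiff.comp contMDiff_fst).mul contMDiff_coneRadius_snd

variable {α : ℝ → S → S}

lemma contMDiff_coneAct
    (hα : ContMDiff (𝓘(ℝ, ℝ).prod 𝓘(ℝ, E)) 𝓘(ℝ, E) ∞ (fun p : ℝ × S => α p.1 p.2)) :
    ContMDiff (𝓘(ℝ, ℝ).prod (coneModel E)) (coneModel E) ∞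
      (fun p : ℝ × Cone S => coneAct α p.1 p.2) :=
  contMDiff_cone contMDiff_coneRadius_snd
    (hα.comp (contMDiff_fst.prodMk contMDiff_coneLink_snd))

variable (E) in
/-- The Euler field `ρ ∂/∂ρ`. -/
def eulerField (m : Cone S) : TangentSpace (coneModel E) m :=
  flowGenerator (coneModel E) dilation m

lemma mdifferentiableAt_orbit {P : ℝ → Cone S → Cone S}
    (hP : ContMDiff (𝓘(ℝ, ℝ).prod (coneModel E)) (coneModel E) ∞
      (fun p : ℝ × Cone S => P p.1 p.2)) (m : Cone S) (t : ℝ) :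
    MDifferentiableAt 𝓘(ℝ, ℝ) (coneModel E) (fun t => P t m) t :=
  (hP.comp (contMDiff_id.prodMk contMDiff_const)).mdifferentiableAt (by simp)

/-- The differential of the radial coordinate. -/
abbrev radialDeriv (m : Cone S) : TangentSpace (coneModel E) m →L[ℝ] ℝ :=
  differential (coneModel E) coneRadius m

/-- The differential of the projection to the link. -/
abbrev linkDeriv (m : Cone S) : TangentSpace (coneModel E) m →L[ℝ] TangentSpace 𝓘(ℝ, E) m.2 :=
  mfderiv (coneModel E) 𝓘(ℝ, E) (fun p : Cone S => p.2) m

lemma radialDeriv_eulerField (m : Cone S) : radialDeriv m (eulerField E m) = coneRadius m := by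
  have h1 := mfderiv_flowGenerator (I := coneModel E) (I' := 𝓘(ℝ, ℝ)) (P := dilation)
    dilation_zero (mdifferentiableAt_orbit contMDiff_dilation m 0)
    (contMDiff_coneRadius.mdifferentiable (by simp))
  have h2 : HasDerivAt (fun t => coneRadius (dilation t m)) (Real.exp 0 * coneRadius m) 0 :=
    (Real.hasDerivAt_exp 0).mul_const _
  rw [Real.exp_zero, one_mul] at h2
  refine h1.trans ?_
  rw [h2.hasFDerivAt.hasMFDerivAt.mfderiv]
  change (1 : ℝ) • coneRadius m = coneRadius m
  exact one_smul _ _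

lemma linkDeriv_eulerField (m : Cone S) : linkDeriv m (eulerField E m) = 0 := by
  have h1 := mfderiv_flowGenerator (I := coneModel E) (I' := 𝓘(ℝ, E)) (P := dilation)
    dilation_zero (mdifferentiableAt_orbit contMDiff_dilation m 0)
    (f := fun p : Cone S => p.2) (contMDiff_coneLink.mdifferentiable (by simp))
  refine h1.trans ?_
  change mfderiv 𝓘(ℝ, ℝ) 𝓘(ℝ, E) (fun _ : ℝ => m.2) 0 (1 : ℝ) = _
  rw [mfderiv_const]
  rfl

/-- A tangent vector of the cone is determined by its radial and link components. -/
lemma eq_zero_of_coneDeriv {m : Cone S} {X : TangentSpace (coneModel E) m}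
    (h1 : radialDeriv m X = 0) (h2 : linkDeriv m X = 0) : X = 0 := by
  have hsnd : ∀ Y : TangentSpace (coneModel E) m, linkDeriv m Y = (Y : ℝ × E).2 := by
    intro Y
    rw [linkDeriv, mfderiv_snd]
    rfl
  have hR := hsnd (eulerField E m)
  rw [linkDeriv_eulerField] at hR
  have hR1 : ((eulerField E m : ℝ × E)).1 ≠ 0 := by
    intro h0
    have h3 : eulerField E m = 0 := Prod.ext h0 hR.symm
    have h4 := radialDeriv_eulerField (E := E) m
    rw [h3, map_zero] at h4
    exact (coneRadius_pos m).ne h4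
  rw [hsnd] at h2
  -- `X` is a multiple of the Euler field
  have h5 : X = ((X : ℝ × E).1 / (eulerField E m : ℝ × E).1) • eulerField E m := by
    refine Prod.ext ?_ ?_
    · exact (div_mul_cancel₀ _ hR1).symm
    · refine h2.trans ?_
      change (0 : E) = ((X : ℝ × E).1 / (eulerField E m : ℝ × E).1) • (eulerField E m : ℝ × E).2
      rw [← hR]
      exact (smul_zero _).symm
  have h6 := h1
  rw [h5, map_smul, radialDeriv_eulerField, smul_eq_mul] at h6
  rw [h5, (mul_eq_zero.1 h6).resolve_right (coneRadius_pos m).ne', zero_smul]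

variable [IsManifold 𝓘(ℝ, E) ∞ S]
  {gS : ContMDiffRiemannianMetric 𝓘(ℝ, E) ∞ E (fun s : S => TangentSpace 𝓘(ℝ, E) s)}

lemma coneMetric_apply (m : Cone S) (X Y : TangentSpace (coneModel E) m) :
    coneMetric gS m X Y = radialDeriv m X * radialDeriv m Y
      + coneRadius m ^ 2 * gS.inner m.2 (linkDeriv m X) (linkDeriv m Y) := rfl

lemma coneMetric_symm (m : Cone S) (X Y : TangentSpace (coneModel E) m) :
    coneMetric gS m X Y = coneMetric gS m Y X := by
  rw [coneMetric_apply, coneMetric_apply, gS.symm, mul_comm (radialDeriv m X)]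

lemma coneMetric_pos (m : Cone S) (X : TangentSpace (coneModel E) m) (hX : X ≠ 0) :
    0 < coneMetric gS m X X := by
  rw [coneMetric_apply]
  have hρ := coneRadius_pos m
  by_cases h : linkDeriv m X = 0
  · have h1 : radialDeriv m X ≠ 0 := fun h1 => hX (eq_zero_of_coneDeriv h1 h)
    rw [h, map_zero]
    have h2 : 0 < radialDeriv m X * radialDeriv m X := mul_self_pos.2 h1
    simpa using h2
  · have h1 := gS.pos m.2 _ h
    have h2 := mul_self_nonneg (radialDeriv m X)
    have h3 : 0 < coneRadius m ^ 2 := by positivity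
    have := mul_pos h3 h1
    linarith

/-- The Euler field is the gradient of `ρ²/2`. -/
lemma coneMetric_eulerField (m : Cone S) (X : TangentSpace (coneModel E) m) :
    coneMetric gS m (eulerField E m) X
      = 1 / 2 * differential (coneModel E) (fun p : Cone S => coneRadius p ^ 2) m X := by
  have h3 := (hasDerivAt_pow 2 (coneRadius m)).hasFDerivAt.hasMFDerivAt.comp m
    (mdifferentiableAt_coneRadius (E := E) m).hasMFDerivAt
  have h4 : differential (coneModel E) (fun p : Cone S => coneRadius p ^ 2) m X
      = radialDeriv m X * (2 * coneRadius m ^ 1) :=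
    congrArg (fun A : ℝ × E →L[ℝ] ℝ => A X) h3.mfderiv
  rw [coneMetric_apply, radialDeriv_eulerField, linkDeriv_eulerField, map_zero, h4, zero_apply]
  ring

/-- Dilations are homotheties of the cone metric. -/
lemma pullbackForm_dilation (t : ℝ) (m : Cone S) (X Y : TangentSpace (coneModel E) m) :
    pullbackForm (coneModel E) (coneMetric gS) (dilation t) m X Y
      = Real.exp (2 * t) * coneMetric gS m X Y := by
  have hd : MDifferentiableAt (coneModel E) (coneModel E) (dilation t) m :=
    (contMDiff_of_uncurry (I := coneModel E) (M := Cone S) contMDiff_dilation t).mdifferentiableAt (by simp)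
  have h1 : ∀ X, radialDeriv (dilation t m) (mfderiv (coneModel E) (coneModel E) (dilation t) m X)
      = Real.exp t * radialDeriv m X := by
    intro X
    have h2 := (mdifferentiableAt_coneRadius (dilation t m)).hasMFDerivAt.comp m
      hd.hasMFDerivAt
    have h3 := (mdifferentiableAt_coneRadius (E := E) m).hasMFDerivAt
      |>.const_smul (Real.exp t)
    exact congrArg (fun A : ℝ × E →L[ℝ] ℝ => A X) (hasMFDerivAt_unique h2 h3)
  have h2 : ∀ X, linkDeriv (dilation t m) (mfderiv (coneModel E) (coneModel E) (dilation t) m X)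
      = linkDeriv m X := by
    intro X
    have h2 := (mdifferentiableAt_coneLink (dilation t m)).hasMFDerivAt.comp m
      hd.hasMFDerivAt
    have h3 := (mdifferentiableAt_coneLink (E := E) m).hasMFDerivAt
    exact congrArg (fun A : ℝ × E →L[ℝ] E => A X) (hasMFDerivAt_unique h2 h3)
  have h3 : Real.exp (2 * t) = Real.exp t ^ 2 := by
    rw [← Real.exp_nat_mul]
    norm_num
  unfold pullbackForm
  rw [coneMetric_apply, coneMetric_apply, h1, h1, h2, h2, coneRadius_dilation, h3]
  change _ + _ * gS.inner m.2 (linkDeriv m X) (linkDeriv m Y) = _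
  ring

/-- The extension to the cone of an isometric action is isometric. -/
lemma pullbackForm_coneAct
    (hα : ContMDiff (𝓘(ℝ, ℝ).prod 𝓘(ℝ, E)) 𝓘(ℝ, E) ∞ (fun p : ℝ × S => α p.1 p.2))
    (hiso : ∀ (t : ℝ) (s : S) (X Y : TangentSpace 𝓘(ℝ, E) s),
      gS.inner (α t s) (mfderiv 𝓘(ℝ, E) 𝓘(ℝ, E) (α t) s X) (mfderiv 𝓘(ℝ, E) 𝓘(ℝ, E) (α t) s Y)
        = gS.inner s X Y) (t : ℝ) (m : Cone S) (X Y : TangentSpace (coneModel E) m) :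
    pullbackForm (coneModel E) (coneMetric gS) (coneAct α t) m X Y = coneMetric gS m X Y := by
  have hd : MDifferentiableAt (coneModel E) (coneModel E) (coneAct α t) m :=
    (contMDiff_of_uncurry (I := coneModel E) (M := Cone S) (contMDiff_coneAct hα) t).mdifferentiableAt (by simp)
  have hdα : MDifferentiableAt 𝓘(ℝ, E) 𝓘(ℝ, E) (α t) m.2 :=
    (contMDiff_of_uncurry hα t).mdifferentiableAt (by simp)
  have h1 : ∀ X, radialDeriv (coneAct α t m)
      (mfderiv (coneModel E) (coneModel E) (coneAct α t) m X) = radialDeriv m X := by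
    intro X
    have h2 := (mdifferentiableAt_coneRadius (coneAct α t m)).hasMFDerivAt.comp
      m hd.hasMFDerivAt
    have h3 := (mdifferentiableAt_coneRadius (E := E) m).hasMFDerivAt
    exact congrArg (fun A : ℝ × E →L[ℝ] ℝ => A X) (hasMFDerivAt_unique h2 h3)
  have h2 : ∀ X, linkDeriv (coneAct α t m)
      (mfderiv (coneModel E) (coneModel E) (coneAct α t) m X)
      = mfderiv 𝓘(ℝ, E) 𝓘(ℝ, E) (α t) m.2 (linkDeriv m X) := by
    intro X
    have h2 := (mdifferentiableAt_coneLink (coneAct α t m)).hasMFDerivAt.comp m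
      hd.hasMFDerivAt
    have h3 := hdα.hasMFDerivAt.comp m
      (mdifferentiableAt_coneLink (E := E) m).hasMFDerivAt
    exact congrArg (fun A : ℝ × E →L[ℝ] E => A X) (hasMFDerivAt_unique h2 h3)
  unfold pullbackForm
  rw [coneMetric_apply, coneMetric_apply, h1, h1, h2, h2]
  change _ + _ * gS.inner (α t m.2) _ _ = _
  rw [hiso]
  rfl

/-- The cone metric is smooth. -/
lemma isSmoothForm_coneMetric : IsSmoothForm (coneModel E) (coneMetric gS) := by
  intro x₀
  have hS : ContDiffOn ℝ ∞ (formCoord 𝓘(ℝ, E) (fun s : S => gS.inner s) x₀.2)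
      (extChartAt 𝓘(ℝ, E) x₀.2).target := contDiffOn_formCoord 𝓘(ℝ, E) gS.contMDiff x₀.2
  have htgt : ∀ y ∈ (extChartAt (coneModel E) x₀).target,
      y.2 ∈ (extChartAt 𝓘(ℝ, E) x₀.2).target := by
    intro y hy
    rw [extChartAt_prod] at hy
    exact hy.2
  have hsnd : ∀ y, ((extChartAt (coneModel E) x₀).symm y).2
      = (extChartAt 𝓘(ℝ, E) x₀.2).symm y.2 := by
    intro y
    rw [extChartAt_prod]
    rfl
  intro y hy
  have hρ : ContDiffAt ℝ ∞ (coneRadius ∘ (extChartAt (coneModel E) x₀).symm) y :=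
    contDiffAt_comp_extChartAt_symm contMDiff_coneRadius hy
  have hS' : ContDiffAt ℝ ∞ (fun z : ℝ × E =>
      formCoord 𝓘(ℝ, E) (fun s : S => gS.inner s) x₀.2 z.2) y :=
    ContDiffAt.comp (g := formCoord 𝓘(ℝ, E) (fun s : S => gS.inner s) x₀.2) y
      (hS.contDiffAt (extChartAt_target_mem _ (htgt y hy))) contDiffAt_snd
  have hdρ := hρ.fderiv_right (m := ∞) (by simp)
  have h0 : ContDiffAt ℝ ∞ (fun z : ℝ × E =>
      ((ContinuousLinearMap.snd ℝ ℝ E).precomp ℝ).comp ((formCoord 𝓘(ℝ, E)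
        (fun s : S => gS.inner s) x₀.2 z.2).comp (ContinuousLinearMap.snd ℝ ℝ E))) y :=
    contDiffAt_const.clm_comp (hS'.clm_comp contDiffAt_const)
  have h1 := (hdρ.smulRight hdρ).add ((hρ.pow 2).smul h0)
  refine (h1.congr_of_eventuallyEq ?_).contDiffWithinAt
  filter_upwards [extChartAt_target_mem _ hy] with z hz
  refine ContinuousLinearMap.ext fun u => ContinuousLinearMap.ext fun w => ?_
  have hρd : MDifferentiableAt (coneModel E) 𝓘(ℝ, ℝ) coneRadius
      ((extChartAt (coneModel E) x₀).symm z) := contMDiff_coneRadius.mdifferentiableAt (by simp)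
  have h2 : ∀ u : ℝ × E, (linkDeriv _ (chartSymmDeriv (coneModel E) x₀ z u) : E)
      = chartSymmDeriv 𝓘(ℝ, E) x₀.2 z.2 u.2 := by
    intro u
    have h3 := (mdifferentiableAt_coneLink (E := E)
      ((extChartAt (coneModel E) x₀).symm z)).hasMFDerivAt.comp z
      (mdifferentiableAt_extChartAt_symm _ hz).hasMFDerivAt
    have h4 := HasMFDerivAt.comp (f := fun z : ℝ × E => z.2) z
      (mdifferentiableAt_extChartAt_symm 𝓘(ℝ, E) (htgt z hz)).hasMFDerivAt
      (hasFDerivAt_snd.hasMFDerivAt)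
    have h5 : (fun p : Cone S => p.2) ∘ (extChartAt (coneModel E) x₀).symm
        = (extChartAt 𝓘(ℝ, E) x₀.2).symm ∘ fun z : ℝ × E => z.2 := funext hsnd
    rw [h5] at h3
    exact congrArg (fun A : ℝ × E →L[ℝ] E => A u) (hasMFDerivAt_unique h3 h4)
  have h3 : formCoord (coneModel E) (coneMetric gS) x₀ z u w
      = fderiv ℝ (coneRadius ∘ (extChartAt (coneModel E) x₀).symm) z u
        * fderiv ℝ (coneRadius ∘ (extChartAt (coneModel E) x₀).symm) z w
        + coneRadius ((extChartAt (coneModel E) x₀).symm z) ^ 2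
          * formCoord 𝓘(ℝ, E) (fun s : S => gS.inner s) x₀.2 z.2 u.2 w.2 := by
    rw [formCoord_apply, coneMetric_apply, fderiv_comp_extChartAt_symm _ hz hρd,
      fderiv_comp_extChartAt_symm _ hz hρd, formCoord_apply, ← h2, ← h2]
    rfl
  rw [h3]
  rfl

end ConeGeometry

/-! ### The hyperkähler cone -/

section HyperkahlerCone

set_option linter.unusedSectionVars false
set_option synthInstance.maxHeartbeats 200000

variable {E : Type*} [NormedAddCommGroup E] [NormedSpace ℝ E] [FiniteDimensional ℝ E]
  {S : Type*} [TopologicalSpace S] [T2Space S] [ChartedSpace E S] [IsManifold 𝓘(ℝ, E) ∞ S]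
  {gS : ContMDiffRiemannianMetric 𝓘(ℝ, E) ∞ E (fun s : S => TangentSpace 𝓘(ℝ, E) s)}
  {J : Fin 3 → ∀ m : Cone S, TangentSpace (coneModel E) m →L[ℝ] TangentSpace (coneModel E) m}
  {α : ℝ → S → S}

lemma hasMFDerivAt_dilation (m : Cone S) :
    HasMFDerivAt 𝓘(ℝ, ℝ) (coneModel E) (fun t => dilation t m) 0
      ((1 : ℝ →L[ℝ] ℝ).smulRight (eulerField E (dilation 0 m))) :=
  hasMFDerivAt_flowGenerator dilation_zero (mdifferentiableAt_orbit contMDiff_dilation m 0)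

lemma isSmoothVectorField_eulerField :
    IsSmoothVectorField (coneModel E) (eulerField E : ∀ m : Cone S, TangentSpace (coneModel E) m) :=
  isSmoothVectorField_of_flow contMDiff_dilation dilation_zero hasMFDerivAt_dilation

lemma isMIntegralCurve_dilation (m : Cone S) :
    IsMIntegralCurve (I := coneModel E) (fun t => dilation t m) (eulerField E) :=
  isMIntegralCurve_of_flow dilation_add dilation_zero hasMFDerivAt_dilation m

lemma mdifferentiable_dilation (t : ℝ) :
    MDifferentiable (coneModel E) (coneModel E) (dilation t : Cone S → Cone S) :=
  (contMDiff_of_uncurry (I := coneModel E) (M := Cone S) contMDiff_dilation t).mdifferentiable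
    (by simp)

lemma mfderiv_dilation_surjective (t : ℝ) (m : Cone S) :
    Function.Surjective (mfderiv (coneModel E) (coneModel E) (dilation t) m) := by
  refine surjective_of_injective (F := ℝ × E) (mfderiv_injective_of_leftInverse
    (f := dilation (-t)) (fun p => ?_) (mdifferentiable_dilation _) (mdifferentiable_dilation _) m)
  rw [← dilation_add, neg_add_cancel, dilation_zero]

namespace IsHyperkahlerAction

lemma coneAct_zero (hα : IsHyperkahlerAction gS J α) (m : Cone S) : coneAct α 0 m = m :=
  Prod.ext rfl (hα.zero m.2)

lemma coneAct_add (hα : IsHyperkahlerAction gS J α) (s t : ℝ) (m : Cone S) :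
    coneAct α (s + t) m = coneAct α s (coneAct α t m) :=
  Prod.ext rfl (hα.add s t m.2)

lemma hasMFDerivAt_coneAct (hα : IsHyperkahlerAction gS J α) (m : Cone S) :
    HasMFDerivAt 𝓘(ℝ, ℝ) (coneModel E) (fun t => coneAct α t m) 0
      ((1 : ℝ →L[ℝ] ℝ).smulRight (generator E α (coneAct α 0 m))) :=
  hasMFDerivAt_flowGenerator hα.coneAct_zero
    (mdifferentiableAt_orbit (contMDiff_coneAct hα.smooth) m 0)

lemma isSmoothVectorField_generator (hα : IsHyperkahlerAction gS J α) :
    IsSmoothVectorField (coneModel E) (generator E α) :=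
  isSmoothVectorField_of_flow (contMDiff_coneAct hα.smooth) hα.coneAct_zero
    hα.hasMFDerivAt_coneAct

lemma isMIntegralCurve_coneAct (hα : IsHyperkahlerAction gS J α) (m : Cone S) :
    IsMIntegralCurve (I := coneModel E) (fun t => coneAct α t m) (generator E α) :=
  isMIntegralCurve_of_flow hα.coneAct_add hα.coneAct_zero hα.hasMFDerivAt_coneAct m

lemma mdifferentiable_coneAct (hα : IsHyperkahlerAction gS J α) (t : ℝ) :
    MDifferentiable (coneModel E) (coneModel E) (coneAct α t) :=
  (contMDiff_of_uncurry (I := coneModel E) (M := Cone S)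
    (contMDiff_coneAct hα.smooth) t).mdifferentiable (by simp)

lemma mfderiv_coneAct_generator (hα : IsHyperkahlerAction gS J α) (t : ℝ) (m : Cone S) :
    mfderiv (coneModel E) (coneModel E) (coneAct α t) m (generator E α m)
      = generator E α (coneAct α t m) :=
  mfderiv_action_apply hα.coneAct_zero hα.coneAct_add hα.isMIntegralCurve_coneAct t
    (hα.mdifferentiable_coneAct t) m

/-- The generator of the action is invariant under dilations. -/
lemma mfderiv_dilation_generator (hα : IsHyperkahlerAction gS J α) (t : ℝ) (m : Cone S) :
    mfderiv (coneModel E) (coneModel E) (dilation t) m (generator E α m)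
      = generator E α (dilation t m) := by
  have h := mfderiv_apply_of_isMIntegralCurve_comp (P := dilation t)
    (hα.isMIntegralCurve_coneAct m) (mdifferentiable_dilation t)
    (hα.isMIntegralCurve_coneAct (dilation t m)) 0
  beta_reduce at h
  rwa [hα.coneAct_zero] at h

/-- The moment maps are invariant under the action. -/
lemma coneMoment_coneAct (hα : IsHyperkahlerAction gS J α) (j : Fin 3) (t : ℝ) (m : Cone S) :
    coneMoment J α j (coneAct α t m) = coneMoment J α j m := by
  have h1 : ContMDiff (coneModel E) 𝓘(ℝ, ℝ) ∞ (fun p : Cone S => coneRadius p ^ 2) :=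
    contMDiff_coneRadius.pow 2
  have h2 : MDifferentiable (coneModel E) 𝓘(ℝ, ℝ) (fun p : Cone S => coneRadius p ^ 2) :=
    h1.mdifferentiable (by simp)
  have h3 := ((h2 (coneAct α t m)).hasMFDerivAt.comp m
    (hα.mdifferentiable_coneAct t m).hasMFDerivAt)
  have h4 : ∀ X, differential (coneModel E) (fun p : Cone S => coneRadius p ^ 2) (coneAct α t m)
      (mfderiv (coneModel E) (coneModel E) (coneAct α t) m X)
      = differential (coneModel E) (fun p : Cone S => coneRadius p ^ 2) m X := fun X =>
    congrArg (fun A : ℝ × E →L[ℝ] ℝ => A X) (hasMFDerivAt_unique h3 (h2 m).hasMFDerivAt)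
  unfold coneMoment
  rw [← hα.mfderiv_coneAct_generator, ← hα.triholomorphic, h4]

end IsHyperkahlerAction

lemma isSmoothForm_kahlerForm_cone (hJ : IsHyperkahler (coneModel E) (coneMetric gS) J)
    (i : Fin 3) : IsSmoothForm (coneModel E) (kahlerForm (coneModel E) (coneMetric gS) (J i)) :=
  isSmoothForm_coneMetric.kahlerForm (hJ.complex i).smooth

/-- The Euler field rescales the Kähler forms. -/
lemma lieForm_eulerField (hJ : IsHyperkahler (coneModel E) (coneMetric gS) J) (i : Fin 3)
    (m : Cone S) (u w : ℝ × E) :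
    lieForm (formCoord (coneModel E) (kahlerForm (coneModel E) (coneMetric gS) (J i)) m)
      (vecCoord (coneModel E) (eulerField E) m) (extChartAt (coneModel E) m m) u w
      = 2 * formCoord (coneModel E) (kahlerForm (coneModel E) (coneMetric gS) (J i)) m
        (extChartAt (coneModel E) m m) u w :=
  lieForm_kahlerForm_of_homothety (hJ.complex i) isSmoothForm_coneMetric coneMetric_symm
    coneMetric_pos (hJ.hermitian i) (hJ.closed i) contMDiff_dilation dilation_zero
    isMIntegralCurve_dilation isSmoothVectorField_eulerField pullbackForm_dilation
    (contMDiff_coneRadius.pow 2) coneMetric_eulerField m u w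

/-- Dilations are holomorphic. -/
lemma mfderiv_dilation_complexStructure (hJ : IsHyperkahler (coneModel E) (coneMetric gS) J)
    (i : Fin 3) (t : ℝ) (m : Cone S) (X : TangentSpace (coneModel E) m) :
    mfderiv (coneModel E) (coneModel E) (dilation t) m (J i m X)
      = J i (dilation t m) (mfderiv (coneModel E) (coneModel E) (dilation t) m X) :=
  mfderiv_complexStructure_of_pullbackForm coneMetric_pos (mfderiv_dilation_surjective t m)
    (pullbackForm_dilation t m)
    (pullbackForm_eq_of_lieForm_eq (coneModel E) contMDiff_dilation dilation_zero dilation_add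
      isMIntegralCurve_dilation
      (fun m => (isSmoothForm_kahlerForm_cone hJ i).differentiableAt (mem_extChartAt_target m))
      (lieForm_eulerField hJ i) t m) X

lemma coneMoment_eq (j : Fin 3) (m : Cone S) :
    coneMoment J α j m = -(1 / 2) * kahlerForm (coneModel E) (coneMetric gS) (J j) m
      (generator E α m) (eulerField E m) := by
  change _ = -(1 / 2) * coneMetric gS m (J j m (generator E α m)) (eulerField E m)
  rw [coneMetric_symm, coneMetric_eulerField, coneMoment]
  ring

/-- The functions `coneMoment J α j` are moment maps of the action. -/
theorem isTriHamiltonian_cone (hJ : IsHyperkahler (coneModel E) (coneMetric gS) J)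
    (hα : IsHyperkahlerAction gS J α) :
    IsTriHamiltonian (coneModel E) (coneMetric gS) J (generator E α) (coneMoment J α) := by
  have hT := hα.isSmoothVectorField_generator
  have hx : ∀ j, coneMoment J α j = fun m => -(1 / 2) * kahlerForm (coneModel E) (coneMetric gS)
      (J j) m (generator E α m) (eulerField E m) := fun j => funext (coneMoment_eq j)
  have hs : ∀ j, ContMDiff (coneModel E) 𝓘(ℝ, ℝ) ∞ (fun m => kahlerForm (coneModel E)
      (coneMetric gS) (J j) m (generator E α m) (eulerField E m)) := fun j =>
    (isSmoothForm_kahlerForm_cone hJ j).contMDiff_apply hT isSmoothVectorField_eulerField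
  refine ⟨hJ, isSmoothForm_coneMetric, coneMetric_symm, coneMetric_pos, hT, fun j => ?_,
    fun j m X => ?_⟩
  · rw [hx]
    exact contMDiff_const.mul (hs j)
  · have hskew : ∀ m X Y, kahlerForm (coneModel E) (coneMetric gS) (J j) m X Y
        = -kahlerForm (coneModel E) (coneMetric gS) (J j) m Y X := by
      intro m X Y
      change coneMetric gS m (J j m X) Y = -coneMetric gS m (J j m Y) X
      rw [hJ.skew, coneMetric_symm]
    have hTβ : ∀ m u w, lieForm (formCoord (coneModel E) (kahlerForm (coneModel E) (coneMetric gS)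
        (J j)) m) (vecCoord (coneModel E) (generator E α) m) (extChartAt (coneModel E) m m) u w
        = 0 := by
      intro m u w
      rw [lieForm_eq_of_pullbackForm_eq (coneModel E) (c := 0) (contMDiff_coneAct hα.smooth)
        hα.coneAct_zero hα.isMIntegralCurve_coneAct m
        ((isSmoothForm_kahlerForm_cone hJ j).differentiableAt (mem_extChartAt_target m))
        (fun t X Y => ?_), zero_mul]
      rw [zero_mul, Real.exp_zero, one_mul]
      exact pullbackForm_kahlerForm (pullbackForm_coneAct hα.smooth hα.isometry t m)
        (hα.triholomorphic j t m) X Y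
    have h1 := differential_contraction_of_homothety (isSmoothForm_kahlerForm_cone hJ j) hskew
      (hJ.closed j) hT isSmoothVectorField_eulerField hTβ (lieForm_eulerField hJ j)
      (fun m => (fderiv_vecCoord_eq_of_invariant contMDiff_dilation dilation_zero
        hasMFDerivAt_dilation hT hα.mfderiv_dilation_generator (mem_extChartAt_target m)).symm) m X
    have h2 := (((hs j).mdifferentiable (by simp) m).hasMFDerivAt.const_smul (-(1 / 2 : ℝ))).mfderiv
    have h3 : differential (coneModel E) (coneMoment J α j) m X
        = -(1 / 2) * differential (coneModel E) (fun m => kahlerForm (coneModel E) (coneMetric gS)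
          (J j) m (generator E α m) (eulerField E m)) m X := by
      rw [hx]
      exact congrArg (fun A : ℝ × E →L[ℝ] ℝ => A X) h2
    rw [h3, h1]
    change _ = -kahlerForm (coneModel E) (coneMetric gS) (J j) m (generator E α m) X
    ring

lemma mfderiv_dilation_rotatedField (hJ : IsHyperkahler (coneModel E) (coneMetric gS) J)
    (hα : IsHyperkahlerAction gS J α) (t : ℝ) (m : Cone S) :
    mfderiv (coneModel E) (coneModel E) (dilation t) m (rotatedField J (generator E α) m)
      = rotatedField J (generator E α) (dilation t m) := by
  rw [rotatedField, rotatedField, map_neg, mfderiv_dilation_complexStructure hJ,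
    hα.mfderiv_dilation_generator]

lemma mfderiv_coneAct_rotatedField (hα : IsHyperkahlerAction gS J α) (t : ℝ) (m : Cone S) :
    mfderiv (coneModel E) (coneModel E) (coneAct α t) m (rotatedField J (generator E α) m)
      = rotatedField J (generator E α) (coneAct α t m) := by
  rw [rotatedField, rotatedField, map_neg, hα.triholomorphic, hα.mfderiv_coneAct_generator]

/-- A vector field on the cone which is invariant under dilations is complete: by compactness of the
link, its integral curves exist for a uniform time on `{1} × S`, hence everywhere. -/
theorem exists_flow_of_dilation_invariant [CompactSpace S]
    {v : ∀ m : Cone S, TangentSpace (coneModel E) m} (hv : IsSmoothVectorField (coneModel E) v)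
    (hD : ∀ t m, mfderiv (coneModel E) (coneModel E) (dilation t) m (v m) = v (dilation t m)) :
    ∃ φ : ℝ → Cone S → Cone S, (∀ m, φ 0 m = m) ∧ ∀ m, IsMIntegralCurve (fun t => φ t m) v := by
  let e : S → Cone S := fun s => (⟨1, Set.mem_Ioi.2 one_pos⟩, s)
  have he : Continuous e := continuous_const.prodMk continuous_id
  have h1 : ∃ ε > 0, ∀ s ∈ (univ : Set S), ∃ γ : ℝ → Cone S, γ 0 = e s ∧
      IsMIntegralCurveOn γ v (Ioo (-ε) ε) := by
    refine isCompact_univ.induction_on (p := fun A : Set S => ∃ ε > 0, ∀ s ∈ A, ∃ γ : ℝ → Cone S,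
      γ 0 = e s ∧ IsMIntegralCurveOn γ v (Ioo (-ε) ε)) ⟨1, one_pos, fun s hs => hs.elim⟩ ?_ ?_ ?_
    · rintro A B hAB ⟨ε, hε, h⟩
      exact ⟨ε, hε, fun s hs => h s (hAB hs)⟩
    · rintro A B ⟨ε, hε, h⟩ ⟨δ, hδ, h'⟩
      refine ⟨min ε δ, lt_min hε hδ, ?_⟩
      rintro s (hs | hs)
      · obtain ⟨γ, hγ0, hγ⟩ := h s hs
        exact ⟨γ, hγ0, hγ.mono (Ioo_subset_Ioo (neg_le_neg (min_le_left _ _)) (min_le_left _ _))⟩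
      · obtain ⟨γ, hγ0, hγ⟩ := h' s hs
        exact ⟨γ, hγ0, hγ.mono (Ioo_subset_Ioo (neg_le_neg (min_le_right _ _)) (min_le_right _ _))⟩
    · intro s _
      obtain ⟨c, ε, hε, hc, -⟩ := exists_local_flow hv (e s)
      exact ⟨_, mem_nhdsWithin_of_mem_nhds (he.continuousAt.eventually hc), ε, hε,
        fun s' hs' => ⟨c (e s'), hs'.1, hs'.2⟩⟩
  obtain ⟨ε, hε, h⟩ := h1
  have h2 : ∀ m : Cone S, ∃ γ : ℝ → Cone S, γ 0 = m ∧ IsMIntegralCurveOn γ v (Ioo (-ε) ε) := by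
    intro m
    obtain ⟨γ, hγ0, hγ⟩ := h m.2 (mem_univ _)
    refine ⟨dilation (Real.log (coneRadius m)) ∘ γ, ?_, fun t ht => ?_⟩
    · rw [Function.comp_apply, hγ0]
      refine cone_ext ?_ rfl
      rw [coneRadius_dilation, Real.exp_log (coneRadius_pos m)]
      exact mul_one _
    · refine ((mdifferentiable_dilation _ (γ t)).hasMFDerivAt.comp_hasMFDerivWithinAt t
        (hγ t ht)).congr_mfderiv ?_
      ext
      change mfderiv (coneModel E) (coneModel E) _ (γ t) ((1 : ℝ) • v (γ t)) = (1 : ℝ) • v _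
      rw [one_smul, one_smul, hD]
  choose φ hφ0 hφ using exists_isMIntegralCurve_of_isMIntegralCurveOn hv.contMDiff_one hε h2
  exact ⟨fun t m => φ m t, hφ0, hφ⟩

end HyperkahlerCone

theorem mainTheorem8
    {E : Type*} [NormedAddCommGroup E] [NormedSpace ℝ E] [FiniteDimensional ℝ E]
    {S : Type*} [TopologicalSpace S] [T2Space S] [CompactSpace S]
    [ChartedSpace E S] [IsManifold 𝓘(ℝ, E) ∞ S]
    (gS : ContMDiffRiemannianMetric 𝓘(ℝ, E) ∞ E (fun s : S => TangentSpace 𝓘(ℝ, E) s))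
    (J : Fin 3 → ∀ m : Cone S,
      TangentSpace (coneModel E) m →L[ℝ] TangentSpace (coneModel E) m)
    (hJ : IsHyperkahler (coneModel E) (coneMetric gS) J)
    (α : ℝ → S → S) (hα : IsHyperkahlerAction gS J α)
    (a : ℝ) (ha : 0 < a) :
    ∃ φ : ℂ → Cone S → Cone S,
      IsComplexifiedAction (coneModel E) (J 0) (generator E α) φ ∧
      (∀ ψ : ℂ → Cone S → Cone S,
        IsComplexifiedAction (coneModel E) (J 0) (generator E α) ψ → ψ = φ) ∧
      ∃ Φ : Cone S → Cone S,
        (∀ m, Φ m = φ ((a ^ 2 * coneMoment J α 0 m : ℝ) : ℂ) m) ∧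
        (∀ t m, Φ (coneAct α t m) = coneAct α t (Φ m)) ∧
        IsComplexSymplectomorphism (coneModel E)
          (deformedJ (coneModel E) (coneMetric gS) J (generator E α) (coneMoment J α) a 0)
          (complexForm (coneModel E)
            (deformedForm (coneModel E) (coneMetric gS) J (coneMoment J α) a 1)
            (deformedForm (coneModel E) (coneMetric gS) J (coneMoment J α) a 2))
          (J 0)
          (complexForm (coneModel E)
            (kahlerForm (coneModel E) (coneMetric gS) (J 1))
            (kahlerForm (coneModel E) (coneMetric gS) (J 2)))
          Φ := by
  have h := isTriHamiltonian_cone hJ hα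
  have hv := isSmoothVectorField_rotatedField h
  obtain ⟨φ, hφ0, hφ⟩ := exists_flow_of_dilation_invariant hv (mfderiv_dilation_rotatedField hJ hα)
  have hcomm : ∀ t s m, coneAct α t (φ s m) = φ s (coneAct α t m) := fun t s m =>
    flow_comm_of_mfderiv_apply hv hφ0 hφ (hα.mdifferentiable_coneAct t)
      (mfderiv_coneAct_rotatedField hα t) s m
  refine ⟨complexAction (coneAct α) φ,
    isComplexifiedAction_complexAction hα.coneAct_zero hα.coneAct_add hα.isMIntegralCurve_coneAct
      hφ0 (flow_add hv hφ0 hφ) hφ hcomm,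
    fun ψ hψ => hψ.eq_complexAction h.smooth_field hv hα.coneAct_zero hα.isMIntegralCurve_coneAct
      hφ0 hφ,
    deformationMap (coneMoment J α) φ a, fun m => ?_, fun t m => ?_,
    isComplexSymplectomorphism_deformationMap h hφ0 hφ a⟩
  · rw [complexAction, Complex.ofReal_re, Complex.ofReal_im, hα.coneAct_zero]
    rfl
  · rw [deformationMap, deformationMap, hα.coneMoment_coneAct, hcomm]
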